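/- **Theorem (second-order convergence).** Let $1<\alpha\le 2$, $1<\gamma\le 2$, $\lambda\ge 0$, $b>0$, $T>0$, and put $\beta=\gamma-1$, $\kappa_\alpha=\frac{1}{2\cos(\alpha\pi/2)}$. Let $u$ be a classical solution on $[0,b]\times[0,T]$ of the space-time tempered fractional diffusion-wave equation with force term $f$, $$\partial_t u(x,t)=\frac{1}{\Gamma(\gamma-1)}\int_0^t (t-s)^{\gamma-2}e^{-\lambda(t-s)}\,\nabla_x^\alpha u(x,s)\,ds+f(x,t),\qquad 0<x<b,\ 0<t\le T,$$ with $u(x,0)=0$ and $u(0,t)=u(b,t)=0$. Here $\nabla_x^\alpha=-\kappa_\alpha({}_0D_x^\alpha+{}_xD_b^\alpha)$ is the Riesz derivative built from the left and right Riemann–Liouville derivatives on $(0,b)$ (so $\nabla_x^2=\partial_x^2$). "Classical" means that $u$ is continuous on $[0,b]\times[0,T]$, that the Riemann–Liouville integrals of order $2-\alpha$ of $u(\cdot,t)$ are twice differentiable on $(0,b)$, that the time integral converges absolutely, and that $\partial_tu$ exists. For integers $M,N\ge1$ let $h=b/M$, $\tau=T/N$, $x_i=ih$, $t_n=n\tau$,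 $t_{n+1/2}=(n+\frac12)\tau$. Let $w_0=1$, $w_1=-4+2^{3-\alpha}$, $w_2=6-2^{5-\alpha}+3^{3-\alpha}$ and $$w_m=(m+1)^{3-\alpha}-4m^{3-\alpha}+6(m-1)^{3-\alpha}-4(m-2)^{3-\alpha}+(m-3)^{3-\alpha}\quad(m\ge3);$$ let $w_{i,i}=2w_1$, $w_{i,j}=w_0+w_2$ if $|i-j|=1$, $w_{i,j}=w_{|i-j|+1}$ if $|i-j|\ge2$; and for a grid function $v=(v_i)$ let $$\nabla_h^\alpha v_i=-\frac{\kappa_\alpha}{\Gamma(4-\alpha)h^\alpha}\sum_{j=1}^{M-1}w_{i,j}v_j .$$ Let $l_k=e^{-\lambda k\tau}\left(\tfrac32\right)^{-\beta}\sum_{m=0}^k3^{-m}g_mg_{k-m}$, where $g_m=\frac{\beta(\beta+1)\cdots(\beta+m-1)}{m!}$ is the $m$-th Taylor coefficient of $(1-z)^{-\beta}$. The scheme is $$u_i^{n+1}-u_i^n=\frac{\tau^\gamma}{2}\sum_{k=0}^n l_k\nabla_h^\alpha\left(u_i^{n+1-k}+u_i^{n-k}\right)+\tau f(x_i,t_{n+1/2}),\qquad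 1\le i\le M-1,\ 0\le n<N,$$ with $u_i^0=0$ and $u_0^n=u_M^n=0$. The local truncation error $R_i^{n+1}$ is the residual of the exact solution in the scheme, $$R_i^{n+1}=u(x_i,t_{n+1})-u(x_i,t_n)-\frac{\tau^\gamma}{2}\sum_{k=0}^n l_k\nabla_h^\alpha\left(u(x_i,t_{n+1-k})+u(x_i,t_{n-k})\right)-\tau f(x_i,t_{n+1/2}).$$ The discrete $L^2$ norm is $\|v\|=\left(h\sum_{i=1}^{M-1}v_i^2\right)^{1/2}$. (i) Let $C_u>0$ and $M,N\ge1$ be such that on this mesh $|R_i^{n+1}|\le C_u\,\tau(\tau^2+h^2)$ for all $1\le i\le M-1$, $0\le n<N$. Then every solution $(u_i^n)$ of the scheme satisfies $$\|u(x_\cdot,t_n)-u_\cdot^n\|\le 2C_u\,b^{1/2}\,T\,(\tau^2+h^2),\qquad n=0,1,\dots,N .$$ (ii) If $u$ is sufficiently smooth, in the sense that on $[0,b]\times[0,T]$ it agrees with a $C^6$ function on $\mathbb R^2$ that vanishes whenever $x\le0$, $x\ge b$ or $t\le0$, then there is a constant $C_u>0$, independent of $\tau$ and $h$ (that is, of $M$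 and $N$), such that for all $M,N\ge1$ one has $|R_i^{n+1}|\le C_u\,\tau(\tau^2+h^2)$ for all $1\le i\le M-1$, $0\le n<N$, and hence the error bound in (i) holds with this $C_u$ on every mesh. -/

import Mathlib

open Set

noncomputable section

namespace TemperedWave

/-! ### The continuous problem -/

/-- Left Riemann--Liouville integral of order `2 - α` with base point `0`
(for `α = 2` this is the integral of order `0`, i.e. the identity). -/
def leftIntegral (α : ℝ) (g : ℝ → ℝ) : ℝ → ℝ :=
  if α = 2 then g
  else fun x => 1 / Real.Gamma (2 - α) * ∫ ξ in (0 : ℝ)..x, (x - ξ) ^ (1 - α) * g ξ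

/-- Right Riemann--Liouville integral of order `2 - α` with base point `b`
(for `α = 2` this is the integral of order `0`, i.e. the identity). -/
def rightIntegral (α b : ℝ) (g : ℝ → ℝ) : ℝ → ℝ :=
  if α = 2 then g
  else fun x => 1 / Real.Gamma (2 - α) * ∫ ξ in x..b, (ξ - x) ^ (1 - α) * g ξ

/-- Left Riemann--Liouville derivative of order `α`. -/
def leftRL (α : ℝ) (g : ℝ → ℝ) (x : ℝ) : ℝ := deriv (deriv (leftIntegral α g)) x

/-- Right Riemann--Liouville derivative of order `α`. -/
def rightRL (α b : ℝ) (g : ℝ → ℝ) (x : ℝ) : ℝ := deriv (deriv (rightIntegral α b g)) x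

/-- The constant `κ_α`. -/
def kappa (α : ℝ) : ℝ := 1 / (2 * Real.cos (α * Real.pi / 2))

/-- Riesz fractional derivative of order `α` on `(0, b)`; for `α = 2` it is the ordinary second
derivative. -/
def riesz (α b : ℝ) (g : ℝ → ℝ) (x : ℝ) : ℝ := -kappa α * (leftRL α g x + rightRL α b g x)

/-- Two-fold differentiability on `s`. -/
def TwiceDifferentiableOn (g : ℝ → ℝ) (s : Set ℝ) : Prop :=
  DifferentiableOn ℝ g s ∧ DifferentiableOn ℝ (deriv g) s

/-- The integrand of the tempered fractional integral of order `β` at time `t`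
(without the factor `1 / Γ(β)`). -/
def temperedIntegrand (β lam : ℝ) (g : ℝ → ℝ) (t s : ℝ) : ℝ :=
  (t - s) ^ (β - 1) * Real.exp (-lam * (t - s)) * g s

/-- Tempered fractional integral of order `β`. -/
def temperedIntegral (β lam : ℝ) (g : ℝ → ℝ) (t : ℝ) : ℝ :=
  1 / Real.Gamma β * ∫ s in (0 : ℝ)..t, temperedIntegrand β lam g t s

/-- `u` is a (classical) solution on `[0, b] × [0, T]` of
`∂ₜ u = I_t^{γ-1,λ} ∇_x^α u + f` with zero initial value and homogeneous Dirichlet boundary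
values. All derivatives and integrals in the equation are required to exist. -/
structure IsExactSolution (α γ lam b T : ℝ) (f u : ℝ → ℝ → ℝ) : Prop where
  continuousOn : ContinuousOn (fun p : ℝ × ℝ => u p.1 p.2) (Icc 0 b ×ˢ Icc 0 T)
  initial : ∀ x ∈ Icc 0 b, u x 0 = 0
  boundary_left : ∀ t ∈ Icc 0 T, u 0 t = 0
  boundary_right : ∀ t ∈ Icc 0 T, u b t = 0
  left_diff : ∀ t ∈ Icc 0 T, TwiceDifferentiableOn (leftIntegral α fun y => u y t) (Ioo 0 b)
  right_diff : ∀ t ∈ Icc 0 T, TwiceDifferentiableOn (rightIntegral α b fun y => u y t) (Ioo 0 b)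
  integrable : ∀ x ∈ Ioo 0 b, ∀ t ∈ Ioc 0 T, IntervalIntegrable
    (temperedIntegrand (γ - 1) lam (fun s => riesz α b (fun y => u y s) x) t)
    MeasureTheory.volume 0 t
  equation : ∀ x ∈ Ioo 0 b, ∀ t ∈ Ioc 0 T, HasDerivWithinAt (fun s => u x s)
    (temperedIntegral (γ - 1) lam (fun s => riesz α b (fun y => u y s) x) t + f x t) (Icc 0 T) t

/-- On `[0, b] × [0, T]` the function `u` agrees with a `C⁶` function on the plane which vanishes
for `x ∉ (0, b)` and for `t ≤ 0`: the extension of `u` by zero in space and to negative times is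
`C⁶`. -/
def HasSmoothZeroExtension (b T : ℝ) (u : ℝ → ℝ → ℝ) : Prop :=
  ∃ v : ℝ × ℝ → ℝ, ContDiff ℝ 6 v ∧
    (∀ x ∈ Icc 0 b, ∀ t ∈ Icc 0 T, v (x, t) = u x t) ∧
    ∀ x t, x ≤ 0 ∨ b ≤ x ∨ t ≤ 0 → v (x, t) = 0

/-! ### The finite difference scheme -/

/-- Space step `h = b / M`. -/
def spaceStep (b : ℝ) (M : ℕ) : ℝ := b / M

/-- Time step `τ = T / N`. -/
def timeStep (T : ℝ) (N : ℕ) : ℝ := T / N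

/-- The weights `w_m^α`. -/
def wWeight (α : ℝ) : ℕ → ℝ
  | 0 => 1
  | 1 => -4 + (2 : ℝ) ^ (3 - α)
  | 2 => 6 - (2 : ℝ) ^ (5 - α) + (3 : ℝ) ^ (3 - α)
  | k + 3 =>
    let m : ℝ := (k : ℝ) + 3
    (m + 1) ^ (3 - α) - 4 * m ^ (3 - α) + 6 * (m - 1) ^ (3 - α)
      - 4 * (m - 2) ^ (3 - α) + (m - 3) ^ (3 - α)

/-- The matrix entries `w_{i,j}^α`. -/
def wMat (α : ℝ) (i j : ℕ) : ℝ :=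
  if j + 1 < i then wWeight α (i - j + 1)
  else if j + 1 = i then wWeight α 0 + wWeight α 2
  else if j = i then 2 * wWeight α 1
  else if j = i + 1 then wWeight α 0 + wWeight α 2
  else wWeight α (j - i + 1)

/-- The discrete Riesz derivative `∇_h^α` of a grid function at the node `i`. -/
def discreteRiesz (α b : ℝ) (M : ℕ) (V : ℕ → ℝ) (i : ℕ) : ℝ :=
  -kappa α / (Real.Gamma (4 - α) * spaceStep b M ^ α) *
    ∑ j ∈ Finset.Icc 1 (M - 1), wMat α i j * V j

/-- `g_m^{-β}`, the `m`-th Taylor coefficient of `(1 - z)^{-β}`, that is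
`β (β + 1) ⋯ (β + m - 1) / m!`. -/
def gCoeff (β : ℝ) (m : ℕ) : ℝ := ∏ j ∈ Finset.range m, (β + j) / (j + 1)

/-- The weights `l_k^β` of the second-order tempered convolution quadrature. -/
def lWeight (β lam τ : ℝ) (k : ℕ) : ℝ :=
  Real.exp (-lam * k * τ) * (3 / 2 : ℝ) ^ (-β) *
    ∑ m ∈ Finset.range (k + 1), ((3 : ℝ) ^ m)⁻¹ * gCoeff β m * gCoeff β (k - m)

/-- The memory term
`(τ^γ / 2) ∑_{k=0}^n l_k^{γ-1} ∇_h^α (V_i^{n+1-k} + V_i^{n-k})` of the scheme.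
Grid functions are written `V i n`, with `i` the space and `n` the time index. -/
def memoryTerm (α γ lam b T : ℝ) (M N : ℕ) (V : ℕ → ℕ → ℝ) (i n : ℕ) : ℝ :=
  timeStep T N ^ γ / 2 * ∑ k ∈ Finset.range (n + 1), lWeight (γ - 1) lam (timeStep T N) k *
    discreteRiesz α b M (fun j => V j (n + 1 - k) + V j (n - k)) i

/-- The force at the half step, `f_i^{n+1/2} = f(x_i, (n + 1/2) τ)`. -/
def halfForce (b T : ℝ) (M N : ℕ) (f : ℝ → ℝ → ℝ) (i n : ℕ) : ℝ :=
  f (i * spaceStep b M) (((n : ℝ) + 1 / 2) * timeStep T N)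

/-- `U` solves the scheme, with zero initial and boundary values. -/
structure IsSchemeSolution (α γ lam b T : ℝ) (M N : ℕ) (f : ℝ → ℝ → ℝ) (U : ℕ → ℕ → ℝ) :
    Prop where
  initial : ∀ i ≤ M, U i 0 = 0
  boundary_left : ∀ n ≤ N, U 0 n = 0
  boundary_right : ∀ n ≤ N, U M n = 0
  step : ∀ i ∈ Finset.Icc 1 (M - 1), ∀ n < N,
    U i (n + 1) - U i n =
      memoryTerm α γ lam b T M N U i n + timeStep T N * halfForce b T M N f i n

/-- Restriction of a function to the grid: `u(x_i, t_n)`. -/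
def gridValues (b T : ℝ) (M N : ℕ) (u : ℝ → ℝ → ℝ) (i n : ℕ) : ℝ :=
  u (i * spaceStep b M) (n * timeStep T N)

/-- The residual `R_i^{n+1}` obtained by inserting `u` in the scheme. -/
def residual (α γ lam b T : ℝ) (M N : ℕ) (f u : ℝ → ℝ → ℝ) (i n : ℕ) : ℝ :=
  gridValues b T M N u i (n + 1) - gridValues b T M N u i n
    - memoryTerm α γ lam b T M N (gridValues b T M N u) i n
    - timeStep T N * halfForce b T M N f i n

/-- The local truncation bound `|R_i^{n+1}| ≤ C τ (τ² + h²)` on the `(M, N)` mesh. -/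
def TruncationBound (α γ lam b T : ℝ) (M N : ℕ) (f u : ℝ → ℝ → ℝ) (C : ℝ) : Prop :=
  ∀ i ∈ Finset.Icc 1 (M - 1), ∀ n < N,
    |residual α γ lam b T M N f u i n| ≤
      C * timeStep T N * (timeStep T N ^ 2 + spaceStep b M ^ 2)

/-- The discrete `L²` norm `(h ∑_{i=1}^{M-1} V_i²)^{1/2}`. -/
def discreteNorm (b : ℝ) (M : ℕ) (V : ℕ → ℝ) : ℝ :=
  Real.sqrt (spaceStep b M * ∑ i ∈ Finset.Icc 1 (M - 1), V i ^ 2)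

end TemperedWave

end

/-!
The error bound is an energy estimate combined with a consistency estimate.

**Stability.** The matrix `w_{i,j}` is the fourth central difference of `|x|^{3-α}` evaluated at
`i - j` (`wMat_eq_diffFour`). Since `|x|^p` is, up to a positive factor,
`∫₀^∞ (1 - cos (x t)) t^{-1-p} dt` for `0 < p < 2`, the negative of that fourth difference is the
cosine transform of a nonnegative weight (`diffFour_spectral`). In time, the weights `l_k` are, up to
a positive factor, the Taylor coefficients of `((1 - w) (1 - w / 3))^{-β}` at `w = e^{-λτ} z`. For
`0 < β ≤ 1` this symbol has nonnegative real part on the unit disc (`re_symbol_nonneg`), so by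
Parseval's identity the causal convolution form `∑ₙ ∑ₖ l_k z_{n-k} z_n` is nonnegative
(`lWeight_form_nonneg`). Averaging over spatial frequencies shows that the memory term dissipates when
the error equation is tested with `e^{n+1} + e^n` (`sum_memoryTerm_mul_nonpos`); what remains is the
truncation error paired with `e^{n+1} + e^n`, and evaluating at the time level where the norm of the
error is largest gives `stability`.

**Consistency in space.** For a smooth function vanishing outside `(0, b)`, the left and right
Riemann--Liouville derivatives of order `α` are fractional integrals of order `4 - α` of the fourth
derivative (`leftRL_eq_rayConv`). Summation by parts moves the fourth difference from `|x|^{3-α}` to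
the grid function, which turns the discrete Riesz derivative into a trapezoidal sum for the same
integrals, with error `O(h²)` (`exists_abs_discreteRiesz_sub_riesz_le`). Moving only two differences
gives bounds that are uniform in the mesh (`exists_abs_discreteRiesz_le`); hence for smooth `u` the
time function `∇_h^α u(x_i, ·)` is smooth and vanishes for negative times, uniformly in `h`.

**Consistency in time.** Two Abel summations rewrite the Grünwald--Letnikov sum of order `β` against
`g_m^{β+2}`, whose two-term asymptotics (`exists_gCoeff_asymptotics`) leave quadrature sums for
fractional integrals of the second derivative; the sum is therefore
`I^β G + (β τ / 2) I^β G' + O(τ²)` (`exists_abs_grunwald_sub_le`). The factor `(3/2 - z/2)^{-β}` is a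
probability filter with mean `β / 2`, which removes the first-order term
(`exists_abs_bdf_sub_le`). Conjugation by `e^{λ t}` introduces the tempering, and averaging two grid
points gives the value at the half step (`exists_abs_tempered_sub_le`).

Together with the midpoint rule for `∂ₜ u` these give the truncation error
(`exists_truncationBound`).
-/

namespace TemperedWave

/-! ### The coefficients of `(1 - z)^{-β}` -/

theorem gCoeff_zero (β : ℝ) : gCoeff β 0 = 1 := by simp [gCoeff]

theorem gCoeff_succ (β : ℝ) (m : ℕ) : gCoeff β (m + 1) = gCoeff β m * ((β + m) / (m + 1)) := by
  rw [gCoeff, gCoeff, Finset.prod_range_succ]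

theorem gCoeff_pos {β : ℝ} (hβ : 0 < β) (m : ℕ) : 0 < gCoeff β m :=
  Finset.prod_pos fun j _ => by positivity

theorem gCoeff_le_one {β : ℝ} (hβ : 0 < β) (hβ' : β ≤ 1) (m : ℕ) : gCoeff β m ≤ 1 :=
  Finset.prod_le_one (fun j _ => by positivity) fun j _ => by
    rw [div_le_one (by positivity)]; linarith

/-- Pascal's rule: the sequence of exponent `s - 1` is the difference of that of exponent `s`. -/
theorem gCoeff_sub_gCoeff (s : ℝ) (m : ℕ) :
    gCoeff s (m + 1) - gCoeff s m = gCoeff (s - 1) (m + 1) := by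
  have key : ∀ m : ℕ, gCoeff (s - 1) (m + 1) = gCoeff s m * ((s - 1) / (m + 1)) := by
    intro m
    induction m with
    | zero => simp [gCoeff]
    | succ m ih =>
      rw [gCoeff_succ (s - 1), ih, gCoeff_succ s m]
      have h1 : (m : ℝ) + 1 ≠ 0 := by positivity
      have h2 : ((m + 1 : ℕ) : ℝ) + 1 ≠ 0 := by positivity
      push_cast at h2 ⊢
      field_simp
      ring
  rw [key, gCoeff_succ]
  have h1 : (m : ℝ) + 1 ≠ 0 := by positivity
  field_simp
  ring

theorem succ_mul_gCoeff_succ (β : ℝ) (m : ℕ) :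
    ((m : ℝ) + 1) * gCoeff β (m + 1) = β * gCoeff (β + 1) m := by
  induction m with
  | zero => simp [gCoeff]
  | succ m ih =>
    rw [gCoeff_succ β (m + 1), gCoeff_succ (β + 1) m]
    have h1 : (m : ℝ) + 1 ≠ 0 := by positivity
    have h2 : ((m + 1 : ℕ) : ℝ) + 1 ≠ 0 := by positivity
    have : gCoeff β (m + 1) = β * gCoeff (β + 1) m / (m + 1) := by
      field_simp; linarith
    rw [this]
    push_cast at h2 ⊢
    field_simp
    ring

theorem gCoeff_eq_choose (β : ℝ) (m : ℕ) : gCoeff β m = Ring.choose (β + m - 1) m := by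
  rw [← Ring.multichoose_eq]
  have h := Ring.factorial_nsmul_multichoose_eq_ascPochhammer β m
  have h2 : (m.factorial : ℝ) * gCoeff β m = (ascPochhammer ℕ m).smeval β := by
    rw [Polynomial.ascPochhammer_smeval_eq_eval]
    clear h
    induction m with
    | zero => simp [gCoeff]
    | succ m ih =>
      rw [ascPochhammer_succ_eval, ← ih, gCoeff_succ, Nat.factorial_succ]
      have h1 : (m : ℝ) + 1 ≠ 0 := by positivity
      push_cast
      field_simp
  have h3 : (m.factorial : ℝ) ≠ 0 := by positivity
  apply mul_left_cancel₀ h3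
  rw [h2, ← h, nsmul_eq_mul]

theorem hasSum_gCoeff_mul_pow (β : ℝ) {w : ℂ} (hw : ‖w‖ < 1) :
    HasSum (fun m => (gCoeff β m : ℂ) * w ^ m) ((1 - w) ^ (-β : ℂ)) := by
  have h := (Complex.one_div_one_sub_cpow_hasFPowerSeriesOnBall_zero (β : ℂ)).hasSum (y := w)
    (by
      rw [Metric.mem_eball, edist_zero_right, ← ofReal_norm, ENNReal.ofReal_lt_one]
      exact hw)
  simp only [zero_add] at h
  rw [Complex.cpow_neg, ← one_div]
  refine h.congr_fun fun m => ?_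
  rw [gCoeff_eq_choose, Complex.ofReal_choose]
  simp [mul_comm]

theorem hasSum_gCoeff_mul_pow_real (β : ℝ) {x : ℝ} (hx : |x| < 1) :
    HasSum (fun m => gCoeff β m * x ^ m) ((1 - x) ^ (-β)) := by
  have h := hasSum_gCoeff_mul_pow β (w := (x : ℂ)) (by simpa using hx)
  have h1 : (0 : ℝ) ≤ 1 - x := by linarith [(abs_lt.1 hx).2]
  have h2 : ((1 - (x : ℂ)) ^ (-β : ℂ)) = (((1 - x) ^ (-β) : ℝ) : ℂ) := by
    rw [Complex.ofReal_cpow h1]; simp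
  rw [h2] at h
  exact_mod_cast h

/-! ### Second-order asymptotics of the coefficients -/

theorem abs_log_one_add_sub_log_one_sub_le {y : ℝ} (hy : 0 ≤ y) (hy' : y ≤ 1 / 2) :
    |Real.log (1 + y) - Real.log (1 - y) - 2 * y| ≤ 4 * y ^ 3 := by
  have hq : y ^ 3 / (1 - y) ≤ 2 * y ^ 3 := by
    rw [div_le_iff₀ (by linarith)]
    nlinarith [pow_nonneg hy 3]
  have h1 := Real.abs_log_sub_add_sum_range_le (x := y) (by rw [abs_of_nonneg hy]; linarith) 2
  have h2 := Real.abs_log_sub_add_sum_range_le (x := -y)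
    (by rw [abs_neg, abs_of_nonneg hy]; linarith) 2
  rw [abs_neg] at h2
  rw [abs_of_nonneg hy] at h1 h2
  simp only [Finset.sum_range_succ, Finset.sum_range_zero] at h1 h2
  norm_num at h1 h2
  have h1' := abs_le.1 (h1.trans hq)
  have h2' := abs_le.1 (h2.trans hq)
  rw [abs_le]
  constructor <;> linarith [h1'.1, h1'.2, h2'.1, h2'.2]

theorem abs_log_add_sub_log_sub_le {x δ : ℝ} (hδ : 0 ≤ δ) (hx : 2 * δ ≤ x) (hx0 : 0 < x) :
    |Real.log (x + δ) - Real.log (x - δ) - 2 * δ / x| ≤ 4 * (δ / x) ^ 3 := by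
  have hy : δ / x ≤ 1 / 2 := by rw [div_le_iff₀ hx0]; linarith
  have h := abs_log_one_add_sub_log_one_sub_le (y := δ / x) (by positivity) hy
  have e1 : x + δ = x * (1 + δ / x) := by field_simp
  have e2 : x - δ = x * (1 - δ / x) := by field_simp
  have h0 : 0 ≤ δ / x := by positivity
  rw [e1, e2, Real.log_mul hx0.ne' (by linarith), Real.log_mul hx0.ne' (by linarith)]
  convert h using 2
  ring

/-- A sequence tending to zero with increments of order `n⁻³` is of order `n⁻²`. -/
theorem abs_le_of_tendsto_of_abs_sub_le {a : ℕ → ℝ} {C : ℝ} (hC : 0 ≤ C)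
    (ha : Filter.Tendsto a Filter.atTop (nhds 0))
    (hd : ∀ k : ℕ, |a (k + 1) - a k| ≤ C / ((k : ℝ) + 1) ^ 3) (k : ℕ) :
    |a k| ≤ 2 * C / ((k : ℝ) + 1) ^ 2 := by
  set b : ℕ → ℝ := fun k => 2 * C / ((k : ℝ) + 1) ^ 2
  have hb : Filter.Tendsto b Filter.atTop (nhds 0) := by
    have := (tendsto_one_div_add_atTop_nhds_zero_nat (𝕜 := ℝ)).pow 2
    have := this.const_mul (2 * C)
    simpa [b, div_eq_mul_inv] using this
  have hbd : ∀ k : ℕ, C / ((k : ℝ) + 1) ^ 3 ≤ b k - b (k + 1) := by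
    intro k
    have hk : (0 : ℝ) ≤ k := k.cast_nonneg
    simp only [b]
    push_cast
    rw [div_sub_div _ _ (by positivity) (by positivity),
      div_le_div_iff₀ (by positivity) (by positivity)]
    have : 0 ≤ C * ((k : ℝ) + 1) ^ 2 *
        ((2 * ((k : ℝ) + 1 + 1) ^ 2 - 2 * ((k : ℝ) + 1) ^ 2) * ((k : ℝ) + 1) -
          ((k : ℝ) + 1 + 1) ^ 2) := by
      have : 0 ≤ ((2 * ((k : ℝ) + 1 + 1) ^ 2 - 2 * ((k : ℝ) + 1) ^ 2) * ((k : ℝ) + 1) -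
          ((k : ℝ) + 1 + 1) ^ 2) := by nlinarith
      positivity
    nlinarith
  have h1 : Antitone fun k => a k + b k := antitone_nat_of_succ_le fun k => by
    linarith [(abs_le.1 (hd k)).2, hbd k]
  have h2 : Monotone fun k => a k - b k := monotone_nat_of_le_succ fun k => by
    linarith [(abs_le.1 (hd k)).1, hbd k]
  have h3 := h1.le_of_tendsto (by simpa using ha.add hb) k
  have h4 := h2.ge_of_tendsto (by simpa using ha.sub hb) k
  rw [abs_le]
  constructor <;> linarith

/-- Euler's limit formula for the Gamma function, in terms of the coefficients of `(1 - z)^{-s}`. -/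
theorem tendsto_gCoeff (s : ℝ) (hs : 0 < s) :
    Filter.Tendsto (fun n : ℕ => gCoeff s (n + 1) * ((n : ℝ) + 1) / (n : ℝ) ^ s) Filter.atTop
      (nhds (Real.Gamma s)⁻¹) := by
  refine ((Real.GammaSeq_tendsto_Gamma s).inv₀ (Real.Gamma_pos_of_pos hs).ne').congr fun n => ?_
  have hf : (∏ j ∈ Finset.range (n + 1), ((j : ℝ) + 1)) = (n + 1) * (n.factorial : ℝ) := by
    have := congrArg (Nat.cast (R := ℝ)) (Finset.prod_range_add_one_eq_factorial (n + 1))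
    rw [Nat.factorial_succ] at this
    push_cast at this
    exact this
  rw [Real.GammaSeq, gCoeff, Finset.prod_div_distrib, hf]
  have h1 : (n : ℝ) + 1 ≠ 0 := by positivity
  have h2 : (n.factorial : ℝ) ≠ 0 := by positivity
  field_simp

/-- The logarithm of `Γ(n + β + 1) / (Γ(n) (n + β/2)^{β+1})` at `n = k + 1`. -/
noncomputable def logRatio (β : ℝ) (k : ℕ) : ℝ :=
  Real.log (gCoeff (β + 2) k) + Real.log (Real.Gamma (β + 2)) -
    (β + 1) * Real.log ((k : ℝ) + 1 + β / 2)

theorem tendsto_logRatio {β : ℝ} (hβ : 0 < β) :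
    Filter.Tendsto (logRatio β) Filter.atTop (nhds 0) := by
  have h0 := tendsto_gCoeff (β + 2) (by linarith)
  have hG := Real.Gamma_pos_of_pos (show 0 < β + 2 by linarith)
  have h1 := (Real.continuousAt_log (inv_pos.2 hG).ne').tendsto.comp h0
  rw [← Filter.tendsto_add_atTop_iff_nat 1]
  have h2 : Filter.Tendsto (fun n : ℕ => (1 + (2 + β / 2) / (n : ℝ))) Filter.atTop (nhds 1) := by
    simpa using (tendsto_const_div_atTop_nhds_zero_nat (2 + β / 2)).const_add (1 : ℝ)
  have h2' := (Real.continuousAt_log one_ne_zero).tendsto.comp h2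
  have h3 : Filter.Tendsto (fun n : ℕ => (1 + 1 / (n : ℝ))) Filter.atTop (nhds 1) := by
    simpa using (tendsto_const_div_atTop_nhds_zero_nat (1 : ℝ)).const_add (1 : ℝ)
  have h3' := (Real.continuousAt_log one_ne_zero).tendsto.comp h3
  have h4 := (((h1.add_const (Real.log (Real.Gamma (β + 2)))).sub h3').sub (h2'.const_mul (β + 1)))
  simp only [Real.log_inv, Real.log_one, mul_zero, sub_zero, neg_add_cancel] at h4
  refine h4.congr' ?_
  filter_upwards [Filter.eventually_gt_atTop 0] with n hn
  have hn' : (0 : ℝ) < n := by exact_mod_cast hn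
  have hg := gCoeff_pos (show 0 < β + 2 by linarith) (n + 1)
  simp only [Function.comp, logRatio]
  have e3 : (1 + 1 / (n : ℝ)) = (n + 1) / n := by field_simp
  have e2 : (1 + (2 + β / 2) / (n : ℝ)) = (((n + 1 : ℕ) : ℝ) + 1 + β / 2) / n := by
    push_cast; field_simp; ring
  rw [e3, e2, Real.log_div (by positivity) (by positivity), Real.log_div (by positivity) hn'.ne',
    Real.log_div (by positivity) hn'.ne', Real.log_mul hg.ne' (by positivity), Real.log_rpow hn']
  ring

/-- The increments are of third order because, by the choice of the shift `β/2`, both logarithmic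
differences are centred at the same point `k + 1 + (β + 1)/2`. -/
theorem abs_logRatio_sub_le {β : ℝ} (hβ : 0 < β) (hβ' : β ≤ 1) (k : ℕ) :
    |logRatio β (k + 1) - logRatio β k| ≤ 5 / ((k : ℝ) + 1) ^ 3 := by
  have hk : (0 : ℝ) ≤ k := k.cast_nonneg
  set x : ℝ := (k : ℝ) + 1 + (β + 1) / 2 with hx
  have hx0 : 0 < x := by positivity
  have h1 := abs_log_add_sub_log_sub_le (x := x) (δ := (β + 1) / 2) (by linarith)
    (by rw [hx]; linarith) hx0
  have h2 := abs_log_add_sub_log_sub_le (x := x) (δ := 1 / 2) (by linarith)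
    (by rw [hx]; linarith) hx0
  have hg := gCoeff_pos (show 0 < β + 2 by linarith) k
  have e : logRatio β (k + 1) - logRatio β k =
      (Real.log (x + (β + 1) / 2) - Real.log (x - (β + 1) / 2) - 2 * ((β + 1) / 2) / x) -
      (β + 1) * (Real.log (x + 1 / 2) - Real.log (x - 1 / 2) - 2 * (1 / 2) / x) := by
    rw [logRatio, logRatio, gCoeff_succ, Real.log_mul hg.ne' (by positivity),
      Real.log_div (by positivity) (by positivity)]
    have a1 : x + (β + 1) / 2 = β + 2 + k := by rw [hx]; ring
    have a2 : x - (β + 1) / 2 = k + 1 := by rw [hx]; ring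
    have a3 : x + 1 / 2 = ((k + 1 : ℕ) : ℝ) + 1 + β / 2 := by rw [hx]; push_cast; ring
    have a4 : x - 1 / 2 = (k : ℝ) + 1 + β / 2 := by rw [hx]; ring
    rw [a1, a2, a3, a4]
    ring
  rw [e]
  refine (abs_sub _ _).trans ?_
  rw [abs_mul, abs_of_pos (by linarith : 0 < β + 1)]
  have hxk : (k : ℝ) + 1 ≤ x := by rw [hx]; linarith
  have b1 : 4 * ((β + 1) / 2 / x) ^ 3 ≤ 4 / ((k : ℝ) + 1) ^ 3 := by
    have : (β + 1) / 2 / x ≤ 1 / ((k : ℝ) + 1) := by gcongr; linarith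
    calc 4 * ((β + 1) / 2 / x) ^ 3 ≤ 4 * (1 / ((k : ℝ) + 1)) ^ 3 := by gcongr
      _ = _ := by rw [div_pow]; ring
  have b2 : (β + 1) * (4 * (1 / 2 / x) ^ 3) ≤ 1 / ((k : ℝ) + 1) ^ 3 := by
    have : 1 / 2 / x ≤ 1 / 2 / ((k : ℝ) + 1) := by gcongr
    calc (β + 1) * (4 * (1 / 2 / x) ^ 3) ≤ 2 * (4 * (1 / 2 / ((k : ℝ) + 1)) ^ 3) := by
          gcongr; linarith
      _ = _ := by field_simp; norm_num
  calc _ ≤ 4 * ((β + 1) / 2 / x) ^ 3 + (β + 1) * (4 * (1 / 2 / x) ^ 3) := by gcongr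
    _ ≤ 4 / ((k : ℝ) + 1) ^ 3 + 1 / ((k : ℝ) + 1) ^ 3 := add_le_add b1 b2
    _ = _ := by ring

theorem abs_logRatio_le {β : ℝ} (hβ : 0 < β) (hβ' : β ≤ 1) (k : ℕ) :
    |logRatio β k| ≤ 10 / ((k : ℝ) + 1) ^ 2 := by
  have := abs_le_of_tendsto_of_abs_sub_le (by norm_num) (tendsto_logRatio hβ)
    (abs_logRatio_sub_le hβ hβ') k
  norm_num at this
  exact this

theorem abs_exp_sub_one_le_mul_exp (a : ℝ) : |Real.exp a - 1| ≤ |a| * Real.exp |a| := by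
  rcases le_total 0 a with h | h
  · rw [abs_of_nonneg h, abs_of_nonneg (by linarith [Real.one_le_exp h])]
    have := Real.add_one_le_exp (-a)
    have h2 : Real.exp (-a) * Real.exp a = 1 := by rw [← Real.exp_add]; simp
    nlinarith [Real.exp_pos a]
  · rw [abs_of_nonpos h, abs_of_nonpos (by linarith [Real.exp_le_one_iff.2 h])]
    have := Real.add_one_le_exp a
    have h3 : 1 ≤ Real.exp (-a) := Real.one_le_exp (by linarith)
    nlinarith

/-- Upper and lower first-order Taylor bounds for `(n + y)^σ` with `1 ≤ σ ≤ 2`. -/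
theorem abs_add_rpow_sub_le {n y σ : ℝ} (hn : 0 < n) (hy : 0 ≤ y) (hσ : 1 ≤ σ) (hσ' : σ ≤ 2) :
    |(n + y) ^ σ - (n ^ σ + σ * y * n ^ (σ - 1))| ≤ y ^ 2 * n ^ (σ - 2) := by
  have hz : 0 ≤ y / n := by positivity
  have e : (n + y) ^ σ = n ^ σ * (1 + y / n) ^ σ := by
    rw [← Real.mul_rpow hn.le (by linarith)]; congr 1; field_simp
  have e1 : n ^ (σ - 1) = n ^ σ / n := by rw [Real.rpow_sub_one hn.ne']
  have e2 : n ^ (σ - 2) = n ^ σ / n ^ 2 := by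
    rw [Real.rpow_sub hn]; norm_num
  have hl : 1 + σ * (y / n) ≤ (1 + y / n) ^ σ :=
    one_add_mul_self_le_rpow_one_add (by linarith) hσ
  have hu : (1 + y / n) ^ σ ≤ 1 + σ * (y / n) + (y / n) ^ 2 := by
    have h1 : (1 + y / n) ^ (σ - 1) ≤ 1 + (σ - 1) * (y / n) :=
      rpow_one_add_le_one_add_mul_self (by linarith) (by linarith) (by linarith)
    have h2 : (1 + y / n) ^ σ = (1 + y / n) ^ (σ - 1) * (1 + y / n) := by
      rw [Real.rpow_sub_one (by positivity)]; field_simp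
    rw [h2]
    nlinarith [mul_nonneg hz hz]
  have hp : 0 < n ^ σ := Real.rpow_pos_of_pos hn σ
  have e3 : (n + y) ^ σ - (n ^ σ + σ * y * n ^ (σ - 1)) =
      n ^ σ * ((1 + y / n) ^ σ - (1 + σ * (y / n))) := by
    rw [e, e1]; ring
  have e4 : y ^ 2 * n ^ (σ - 2) = n ^ σ * (y / n) ^ 2 := by rw [e2]; ring
  rw [e3, e4, abs_of_nonneg (mul_nonneg hp.le (by linarith))]
  gcongr
  linarith

theorem gCoeff_mul_Gamma_eq {β : ℝ} (hβ : 0 < β) (k : ℕ) :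
    gCoeff (β + 2) k * Real.Gamma (β + 2) =
      ((k : ℝ) + 1 + β / 2) ^ (β + 1) * Real.exp (logRatio β k) := by
  have hg := gCoeff_pos (show 0 < β + 2 by linarith) k
  have hG := Real.Gamma_pos_of_pos (show 0 < β + 2 by linarith)
  rw [logRatio, Real.exp_sub, Real.exp_add, Real.exp_log hg, Real.exp_log hG,
    Real.rpow_def_of_pos (by positivity), mul_comm (β + 1)]
  field_simp

/-- Two-term asymptotics of `g_k^{β+2}`. The ratio of Gamma functions is `(k + 1 + β/2)^{β+1}` up to
a factor `1 + O(k⁻²)`, and this power is then expanded at `k + 1`. -/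
theorem exists_gCoeff_asymptotics {β : ℝ} (hβ : 0 < β) (hβ' : β ≤ 1) :
    ∃ C : ℝ, 0 ≤ C ∧ ∀ k : ℕ,
      |gCoeff (β + 2) k - (((k : ℝ) + 1) ^ (β + 1) / Real.Gamma (β + 2) +
        β / 2 * ((k : ℝ) + 1) ^ β / Real.Gamma (β + 1))| ≤ C * ((k : ℝ) + 1) ^ (β - 1) := by
  have hG := Real.Gamma_pos_of_pos (show 0 < β + 2 by linarith)
  have hG1 := Real.Gamma_pos_of_pos (show 0 < β + 1 by linarith)
  have hrec : Real.Gamma (β + 2) = (β + 1) * Real.Gamma (β + 1) := by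
    rw [← Real.Gamma_add_one (by linarith)]; congr 1; ring
  refine ⟨(40 * Real.exp 10 + 1) / Real.Gamma (β + 2), by positivity, fun k => ?_⟩
  have hk : (0 : ℝ) ≤ k := k.cast_nonneg
  set n : ℝ := (k : ℝ) + 1 with hn
  have hn1 : 1 ≤ n := by linarith
  have hn0 : 0 < n := by linarith
  have h1 := abs_add_rpow_sub_le (n := n) (y := β / 2) (σ := β + 1) hn0 (by linarith)
    (by linarith) (by linarith)
  have es : β + 1 - 1 = β := by ring
  have es2 : β + 1 - 2 = β - 1 := by ring
  rw [es, es2] at h1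
  have hpos : 0 < n ^ (β - 1) := Real.rpow_pos_of_pos hn0 _
  have h1' : |(n + β / 2) ^ (β + 1) - (n ^ (β + 1) + (β + 1) * (β / 2) * n ^ β)| ≤
      1 * n ^ (β - 1) := h1.trans (by gcongr; nlinarith)
  have ha := abs_logRatio_le hβ hβ' k
  rw [← hn] at ha
  have ha10 : |logRatio β k| ≤ 10 := ha.trans (by
    rw [div_le_iff₀ (by positivity)]; nlinarith)
  have h2 : |Real.exp (logRatio β k) - 1| ≤ 10 / n ^ 2 * Real.exp 10 :=
    (abs_exp_sub_one_le_mul_exp _).trans (by gcongr)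
  have h3 : (n + β / 2) ^ (β + 1) ≤ 4 * n ^ (β + 1) := by
    calc (n + β / 2) ^ (β + 1) ≤ (2 * n) ^ (β + 1) := by gcongr; linarith
      _ = 2 ^ (β + 1) * n ^ (β + 1) := Real.mul_rpow (by norm_num) hn0.le
      _ ≤ 2 ^ (2 : ℝ) * n ^ (β + 1) := by gcongr <;> linarith
      _ = _ := by norm_num
  have h4 : |gCoeff (β + 2) k * Real.Gamma (β + 2) - (n + β / 2) ^ (β + 1)| ≤
      40 * Real.exp 10 * n ^ (β - 1) := by
    have e : gCoeff (β + 2) k * Real.Gamma (β + 2) - (n + β / 2) ^ (β + 1) =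
        (n + β / 2) ^ (β + 1) * (Real.exp (logRatio β k) - 1) := by
      rw [gCoeff_mul_Gamma_eq hβ, ← hn]; ring
    have e2 : n ^ (β - 1) = n ^ (β + 1) / n ^ 2 := by
      rw [← es2, Real.rpow_sub hn0]; norm_num
    rw [e, abs_mul, abs_of_nonneg (by positivity), e2]
    calc _ ≤ 4 * n ^ (β + 1) * (10 / n ^ 2 * Real.exp 10) := by gcongr
      _ = _ := by ring
  have h5 : gCoeff (β + 2) k - (n ^ (β + 1) / Real.Gamma (β + 2) +
      β / 2 * n ^ β / Real.Gamma (β + 1)) =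
      ((gCoeff (β + 2) k * Real.Gamma (β + 2) - (n + β / 2) ^ (β + 1)) +
        ((n + β / 2) ^ (β + 1) - (n ^ (β + 1) + (β + 1) * (β / 2) * n ^ β))) /
        Real.Gamma (β + 2) := by
    rw [hrec]; field_simp; ring
  rw [h5, abs_div, abs_of_pos hG, div_mul_eq_mul_div]
  gcongr
  refine (abs_add_le _ _).trans ?_
  linarith

/-! ### Positivity of the quadrature weights -/

/-- The Taylor coefficients of `((1 - w) (1 - w / 3))^{-β}`. -/
noncomputable def bdfCoeff (β : ℝ) (k : ℕ) : ℝ :=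
  ∑ m ∈ Finset.range (k + 1), ((3 : ℝ) ^ m)⁻¹ * gCoeff β m * gCoeff β (k - m)

theorem lWeight_eq (β lam τ : ℝ) (k : ℕ) :
    lWeight β lam τ k = (3 / 2 : ℝ) ^ (-β) * (bdfCoeff β k * Real.exp (-lam * τ) ^ k) := by
  rw [lWeight, ← Real.exp_nat_mul, bdfCoeff, show (k : ℝ) * (-lam * τ) = -lam * k * τ by ring]
  ring

theorem hasSum_bdfCoeff_mul_pow {β : ℝ} (hβ : 0 < β) {w : ℂ} (hw : ‖w‖ < 1) :
    HasSum (fun k => (bdfCoeff β k : ℂ) * w ^ k)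
      ((1 - w / 3) ^ (-β : ℂ) * (1 - w) ^ (-β : ℂ)) := by
  have hw3 : ‖w / 3‖ < 1 := by
    rw [norm_div]; norm_num; linarith [norm_nonneg w]
  have hs : ∀ {v : ℂ}, ‖v‖ < 1 → Summable fun m => ‖(gCoeff β m : ℂ) * v ^ m‖ := by
    intro v hv
    have := (hasSum_gCoeff_mul_pow_real β (x := ‖v‖) (by simpa using hv)).summable
    refine this.congr fun m => ?_
    rw [norm_mul, norm_pow, Complex.norm_real, Real.norm_of_nonneg (gCoeff_pos hβ m).le]
  have h := hasSum_sum_range_mul_of_summable_norm (hs hw3) (hs hw)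
  rw [(hasSum_gCoeff_mul_pow β hw3).tsum_eq, (hasSum_gCoeff_mul_pow β hw).tsum_eq] at h
  refine h.congr_fun fun k => ?_
  rw [bdfCoeff]
  push_cast
  rw [Finset.sum_mul]
  refine Finset.sum_congr rfl fun m hm => ?_
  have hm' : m ≤ k := Nat.lt_succ_iff.1 (Finset.mem_range.1 hm)
  have e : w ^ k = w ^ m * w ^ (k - m) := by rw [← pow_add]; congr 1; omega
  rw [e, div_pow]
  ring

/-- The symbol `((1 - w) (1 - w / 3))^{-β}` maps the unit disc to the right half plane; for
`β = 1` this is the A-stability of the second-order backward difference formula. -/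
theorem re_symbol_nonneg {β : ℝ} (hβ : 0 < β) (hβ' : β ≤ 1) {w : ℂ} (hw : ‖w‖ < 1) :
    0 ≤ ((1 - w / 3) ^ (-β : ℂ) * (1 - w) ^ (-β : ℂ)).re := by
  have hre : |w.re| < 1 := (Complex.abs_re_le_norm w).trans_lt hw
  obtain ⟨h1, h2⟩ := abs_lt.1 hre
  have ha : 0 < (1 - w / 3).re := by simp; linarith
  have hb : 0 < (1 - w).re := by simp; linarith
  have ha0 : (1 - w / 3) ≠ 0 := fun h => by rw [h] at ha; simp at ha
  have hb0 : (1 - w) ≠ 0 := fun h => by rw [h] at hb; simp at hb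
  have haa := Complex.abs_arg_lt_pi_div_two_iff.2 (Or.inl ha)
  have hba := Complex.abs_arg_lt_pi_div_two_iff.2 (Or.inl hb)
  have hsum : (1 - w / 3).arg + (1 - w).arg ∈ Ioc (-Real.pi) Real.pi := by
    rw [abs_lt] at haa hba
    constructor <;> linarith [haa.1, haa.2, hba.1, hba.2]
  rw [Complex.cpow_def_of_ne_zero ha0, Complex.cpow_def_of_ne_zero hb0, ← Complex.exp_add,
    ← add_mul, ← Complex.log_mul ha0 hb0 hsum]
  -- it suffices that `v = (1 - w / 3) (1 - w)` has nonnegative real part, since `β ≤ 1`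
  set v := (1 - w / 3) * (1 - w) with hv
  have hv0 : v ≠ 0 := mul_ne_zero ha0 hb0
  have hvre : 0 ≤ v.re := by
    have hn : w.re ^ 2 + w.im ^ 2 ≤ 1 := by
      have := Complex.sq_norm w
      rw [Complex.normSq_apply] at this
      nlinarith [norm_nonneg w]
    have : v.re = (1 - w.re / 3) * (1 - w.re) - w.im ^ 2 / 3 := by
      simp [hv]; ring
    rw [this]
    nlinarith [sq_nonneg (1 - w.re)]
  have hva : |v.arg| ≤ Real.pi / 2 := Complex.abs_arg_le_pi_div_two_iff.2 hvre
  rw [Complex.exp_re]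
  refine mul_nonneg (Real.exp_pos _).le (Real.cos_nonneg_of_mem_Icc ?_)
  have him : (Complex.log v * (-β : ℂ)).im = -(β * v.arg) := by
    rw [show (-β : ℂ) = ((-β : ℝ) : ℂ) by simp, Complex.im_mul_ofReal, Complex.log_im]; ring
  rw [him, mem_Icc, ← abs_le, abs_neg, abs_mul, abs_of_pos hβ]
  nlinarith [abs_nonneg v.arg]

theorem tsum_bdfCoeff_cos_nonneg {β q : ℝ} (hβ : 0 < β) (hβ' : β ≤ 1) (hq : 0 ≤ q) (hq' : q < 1)
    (θ : ℝ) : 0 ≤ ∑' k : ℕ, bdfCoeff β k * q ^ k * Real.cos (k * θ) := by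
  set w : ℂ := q * Complex.exp (θ * Complex.I) with hwdef
  have hw : ‖w‖ < 1 := by
    rw [hwdef, norm_mul, Complex.norm_exp_ofReal_mul_I, Complex.norm_real,
      Real.norm_of_nonneg hq]; simpa
  have h := Complex.hasSum_re (hasSum_bdfCoeff_mul_pow hβ hw)
  have e : ∀ k : ℕ, ((bdfCoeff β k : ℂ) * w ^ k).re = bdfCoeff β k * q ^ k * Real.cos (k * θ) := by
    intro k
    have : (bdfCoeff β k : ℂ) * w ^ k =
        ((bdfCoeff β k * q ^ k : ℝ) : ℂ) * Complex.exp (((k * θ : ℝ) : ℂ) * Complex.I) := by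
      rw [hwdef, mul_pow, ← Complex.exp_nat_mul]
      push_cast
      rw [← mul_assoc (k : ℂ)]
      ring
    rw [this, Complex.re_ofReal_mul, Complex.exp_ofReal_mul_I_re]
  simp only [e] at h
  rw [h.tsum_eq]
  exact re_symbol_nonneg hβ hβ' hw

theorem integral_cos_int_mul (j : ℤ) :
    ∫ θ in (0 : ℝ)..2 * Real.pi, Real.cos (j * θ) = if j = 0 then 2 * Real.pi else 0 := by
  split_ifs with h
  · simp [h]
  · have hj : (j : ℝ) ≠ 0 := by exact_mod_cast h
    rw [intervalIntegral.integral_comp_mul_left (fun x => Real.cos x) hj, integral_cos]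
    have : Real.sin ((j : ℝ) * (2 * Real.pi)) = 0 := by
      have := Real.sin_int_mul_pi (2 * j)
      push_cast at this
      rw [← this]; congr 1; ring
    simp [this]

/-- The orthogonality relations pair the `k`-th cosine mode of `|∑ zₙ e^{inθ}|²` with the
autocorrelation of `z` at lag `k`. -/
theorem integral_cos_mul_normSq (z : ℕ → ℝ) (N k : ℕ) :
    ∫ θ in (0 : ℝ)..2 * Real.pi, Real.cos (k * θ) *
      ((∑ n ∈ Finset.range N, z n * Real.cos (n * θ)) ^ 2 +
        (∑ n ∈ Finset.range N, z n * Real.sin (n * θ)) ^ 2) =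
      2 * Real.pi * ∑ n ∈ Finset.range N, if k ≤ n then z (n - k) * z n else 0 := by
  have e : ∀ θ : ℝ, Real.cos (k * θ) *
      ((∑ n ∈ Finset.range N, z n * Real.cos (n * θ)) ^ 2 +
        (∑ n ∈ Finset.range N, z n * Real.sin (n * θ)) ^ 2) =
      ∑ n ∈ Finset.range N, ∑ m ∈ Finset.range N, (z n * z m / 2) *
        (Real.cos (((k + n - m : ℤ) : ℝ) * θ) + Real.cos (((k + m - n : ℤ) : ℝ) * θ)) := by
    intro θ
    rw [sq, sq, Finset.sum_mul_sum, Finset.sum_mul_sum, ← Finset.sum_add_distrib, Finset.mul_sum]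
    refine Finset.sum_congr rfl fun n _ => ?_
    rw [← Finset.sum_add_distrib, Finset.mul_sum]
    refine Finset.sum_congr rfl fun m _ => ?_
    have e1 : (((k + n - m : ℤ) : ℝ) * θ) = k * θ + (n * θ - m * θ) := by push_cast; ring
    have e2 : (((k + m - n : ℤ) : ℝ) * θ) = k * θ - (n * θ - m * θ) := by push_cast; ring
    rw [e1, e2, Real.cos_add, Real.cos_sub (k * θ), Real.cos_sub (n * θ)]
    ring
  simp only [e]
  have hint : ∀ j : ℤ, IntervalIntegrable (fun θ : ℝ => Real.cos (j * θ)) MeasureTheory.volume 0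
      (2 * Real.pi) := fun j => (by fun_prop : Continuous _).intervalIntegrable _ _
  rw [intervalIntegral.integral_finsetSum fun n _ =>
    (by fun_prop : Continuous _).intervalIntegrable _ _]
  have e3 : ∀ n ∈ Finset.range N, (∫ θ in (0 : ℝ)..2 * Real.pi,
      ∑ m ∈ Finset.range N, (z n * z m / 2) *
        (Real.cos (((k + n - m : ℤ) : ℝ) * θ) + Real.cos (((k + m - n : ℤ) : ℝ) * θ))) =
      ∑ m ∈ Finset.range N, (Real.pi * (if k + n = m then z n * z m else 0) +
        Real.pi * (if k + m = n then z m * z n else 0)) := by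
    intro n _
    rw [intervalIntegral.integral_finsetSum fun n _ =>
      (by fun_prop : Continuous _).intervalIntegrable _ _]
    refine Finset.sum_congr rfl fun m _ => ?_
    rw [intervalIntegral.integral_const_mul, intervalIntegral.integral_add (hint _) (hint _),
      integral_cos_int_mul, integral_cos_int_mul]
    have c1 : ((k : ℤ) + n - m = 0) ↔ k + n = m := by omega
    have c2 : ((k : ℤ) + m - n = 0) ↔ k + m = n := by omega
    simp only [c1, c2]
    split_ifs <;> ring
  rw [Finset.sum_congr rfl e3]
  simp only [Finset.sum_add_distrib]
  rw [Finset.sum_comm (f := fun n m => Real.pi * (if k + n = m then z n * z m else 0)),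
    ← two_mul, mul_assoc, mul_right_inj' two_ne_zero, Finset.mul_sum]
  refine Finset.sum_congr rfl fun n hn => ?_
  rw [← Finset.mul_sum]
  congr 1
  by_cases hkn : k ≤ n
  · rw [if_pos hkn, Finset.sum_eq_single_of_mem (n - k)
      (Finset.mem_range.2 (by have := Finset.mem_range.1 hn; omega))]
    · rw [if_pos (by omega)]
    · intro m _ hm
      rw [if_neg (by omega)]
  · rw [if_neg hkn]
    exact Finset.sum_eq_zero fun m _ => if_neg (by omega)

/-- A summable sequence whose cosine series is nonnegative defines a nonnegative causal
convolution form. -/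
theorem convolution_form_nonneg_of_cos {d : ℕ → ℝ} (hd : Summable fun k => |d k|)
    (hcos : ∀ θ : ℝ, 0 ≤ ∑' k : ℕ, d k * Real.cos (k * θ)) (z : ℕ → ℝ) (N : ℕ) :
    0 ≤ ∑ n ∈ Finset.range N, ∑ k ∈ Finset.range (n + 1), d k * (z (n - k) * z n) := by
  set Z : ℝ → ℝ := fun θ => (∑ n ∈ Finset.range N, z n * Real.cos (n * θ)) ^ 2 +
        (∑ n ∈ Finset.range N, z n * Real.sin (n * θ)) ^ 2 with hZ
  have hZc : Continuous Z := by fun_prop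
  have hsum : ∀ θ : ℝ, Summable fun k : ℕ => d k * Real.cos (k * θ) := fun θ =>
    Summable.of_norm_bounded hd fun k => by
      rw [Real.norm_eq_abs, abs_mul]
      exact mul_le_of_le_one_right (abs_nonneg _) (Real.abs_cos_le_one _)
  have h := intervalIntegral.hasSum_integral_of_dominated_convergence
    (μ := MeasureTheory.volume) (a := 0) (b := 2 * Real.pi)
    (F := fun (k : ℕ) θ => d k * (Real.cos (k * θ) * Z θ))
    (f := fun θ => (∑' k : ℕ, d k * Real.cos (k * θ)) * Z θ)
    (fun k θ => |d k| * Z θ)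
    (fun k => (by fun_prop : Continuous _).aestronglyMeasurable)
    (fun k => Filter.Eventually.of_forall fun θ _ => by
      have hZ0 : 0 ≤ Z θ := by simp only [hZ]; positivity
      rw [Real.norm_eq_abs, abs_mul, abs_mul, abs_of_nonneg hZ0]
      gcongr
      exact mul_le_of_le_one_left hZ0 (Real.abs_cos_le_one _))
    (Filter.Eventually.of_forall fun θ _ => hd.mul_right _)
    (by simp only [tsum_mul_right]; exact (by fun_prop : Continuous _).intervalIntegrable _ _)
    (Filter.Eventually.of_forall fun θ _ => by
      simpa only [mul_assoc] using (hsum θ).hasSum.mul_right (Z θ))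
  simp only [intervalIntegral.integral_const_mul, hZ, integral_cos_mul_normSq] at h
  -- by orthogonality the integral of the nonnegative product is `2 π` times the form
  have hnn : 0 ≤ ∫ θ in (0 : ℝ)..2 * Real.pi, (∑' k : ℕ, d k * Real.cos (k * θ)) * Z θ :=
    intervalIntegral.integral_nonneg (by positivity) fun θ _ =>
      mul_nonneg (hcos θ) (by simp only [hZ]; positivity)
  have h2 := h.unique (hasSum_sum_of_ne_finset_zero (s := Finset.range N) fun k hk => by
    have hk' : N ≤ k := by simpa using hk
    rw [Finset.sum_eq_zero fun n hn => if_neg (by have := Finset.mem_range.1 hn; omega)]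
    simp)
  simp only [hZ] at hnn
  rw [h2] at hnn
  have h3 : ∑ k ∈ Finset.range N, d k * (2 * Real.pi *
      ∑ n ∈ Finset.range N, if k ≤ n then z (n - k) * z n else 0) =
      2 * Real.pi * ∑ n ∈ Finset.range N, ∑ k ∈ Finset.range (n + 1),
        d k * (z (n - k) * z n) := by
    simp only [Finset.mul_sum]
    rw [Finset.sum_comm]
    refine Finset.sum_congr rfl fun n hn => ?_
    have hsub : Finset.range (n + 1) ⊆ Finset.range N :=
      Finset.range_subset_range.2 (Finset.mem_range.1 hn)
    rw [← Finset.sum_subset hsub]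
    · refine Finset.sum_congr rfl fun k hk => ?_
      rw [if_pos (Nat.lt_succ_iff.1 (Finset.mem_range.1 hk))]
      ring
    · intro k _ hk
      rw [if_neg (by simpa using hk)]
      simp
  rw [h3] at hnn
  exact nonneg_of_mul_nonneg_right hnn (by positivity)

/-- The weights are `bdfCoeff β k * q ^ k` with `q = e^{-λτ}`. For `q < 1` the cosine criterion
applies; `q = 1`, that is `λ = 0`, follows by continuity of the finite form in `q`. -/
theorem lWeight_form_nonneg {β lam τ : ℝ} (hβ : 0 < β) (hβ' : β ≤ 1) (hlam : 0 ≤ lam)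
    (hτ : 0 ≤ τ) (z : ℕ → ℝ) (N : ℕ) :
    0 ≤ ∑ n ∈ Finset.range N, ∑ k ∈ Finset.range (n + 1),
      lWeight β lam τ k * (z (n - k) * z n) := by
  set Q : ℝ → ℝ := fun q => ∑ n ∈ Finset.range N, ∑ k ∈ Finset.range (n + 1),
    bdfCoeff β k * q ^ k * (z (n - k) * z n) with hQ
  have hQc : Continuous Q := by fun_prop
  have h1 : ∀ q ∈ Ico (0 : ℝ) 1, 0 ≤ Q q := by
    intro q hq
    refine convolution_form_nonneg_of_cos (d := fun k => bdfCoeff β k * q ^ k) ?_ ?_ z N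
    · have h := (hasSum_bdfCoeff_mul_pow hβ (w := (q : ℂ)) (by
        rw [Complex.norm_real, Real.norm_of_nonneg hq.1]; exact hq.2)).summable.norm
      refine h.congr fun k => ?_
      rw [norm_mul, norm_pow, Complex.norm_real, Complex.norm_real, abs_mul, abs_pow]
      rfl
    · exact tsum_bdfCoeff_cos_nonneg hβ hβ' hq.1 hq.2
  have h2 : ∀ q ∈ Icc (0 : ℝ) 1, 0 ≤ Q q := by
    intro q hq
    have hcl : q ∈ closure (Ico (0 : ℝ) 1) := by rwa [closure_Ico zero_ne_one]
    exact closure_minimal (s := Ico (0 : ℝ) 1) (t := Q ⁻¹' Ici 0) h1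
      (isClosed_Ici.preimage hQc) hcl
  have h3 := h2 (Real.exp (-lam * τ)) ⟨(Real.exp_pos _).le,
    Real.exp_le_one_iff.2 (by nlinarith [mul_nonneg hlam hτ])⟩
  have h4 : ∑ n ∈ Finset.range N, ∑ k ∈ Finset.range (n + 1),
      lWeight β lam τ k * (z (n - k) * z n) = (3 / 2 : ℝ) ^ (-β) * Q (Real.exp (-lam * τ)) := by
    simp only [hQ, Finset.mul_sum, lWeight_eq]
    refine Finset.sum_congr rfl fun n _ => Finset.sum_congr rfl fun k _ => by ring
  rw [h4]
  exact mul_nonneg (by positivity) h3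

/-! ### Spectral representation of the discrete Riesz derivative -/

theorem integrableOn_one_sub_cos_mul_rpow {p : ℝ} (hp : 0 < p) (hp' : p < 2) (x : ℝ) :
    MeasureTheory.IntegrableOn (fun t : ℝ => (1 - Real.cos (x * t)) * t ^ (-1 - p)) (Ioi 0) := by
  have hm : MeasureTheory.AEStronglyMeasurable
      (fun t : ℝ => (1 - Real.cos (x * t)) * t ^ (-1 - p)) MeasureTheory.volume := by
    have : Measurable fun t : ℝ => (1 - Real.cos (x * t)) * t ^ (-1 - p) := by fun_prop
    exact this.aestronglyMeasurable
  rw [← Ioc_union_Ioi_eq_Ioi (zero_le_one (α := ℝ))]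
  refine MeasureTheory.IntegrableOn.union ?_ ?_
  · have h1 : MeasureTheory.IntegrableOn (fun t : ℝ => x ^ 2 / 2 * t ^ (1 - p)) (Ioc 0 1) := by
      have := (intervalIntegral.intervalIntegrable_rpow' (a := 0) (b := 1)
        (show -1 < 1 - p by linarith)).const_mul (x ^ 2 / 2)
      rwa [intervalIntegrable_iff, uIoc_of_le zero_le_one] at this
    refine MeasureTheory.Integrable.mono' h1 hm.restrict ?_
    refine (MeasureTheory.ae_restrict_mem measurableSet_Ioc).mono fun t ht => ?_
    have hp0 : 0 ≤ t ^ (-1 - p) := Real.rpow_nonneg ht.1.le _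
    have hc : 0 ≤ 1 - Real.cos (x * t) := by linarith [Real.cos_le_one (x * t)]
    rw [Real.norm_of_nonneg (mul_nonneg hc hp0)]
    have e : t ^ (1 - p) = t ^ 2 * t ^ (-1 - p) := by
      rw [← Real.rpow_natCast, ← Real.rpow_add ht.1]; congr 1; push_cast; ring
    rw [e]
    have := Real.one_sub_sq_div_two_le_cos (x := x * t)
    nlinarith
  · have h1 := (integrableOn_Ioi_rpow_of_lt (show -1 - p < -1 by linarith)
      (zero_lt_one (α := ℝ))).const_mul 2
    refine MeasureTheory.Integrable.mono' h1 hm.restrict ?_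
    refine (MeasureTheory.ae_restrict_mem measurableSet_Ioi).mono fun t ht => ?_
    have ht0 : (0 : ℝ) < t := lt_trans zero_lt_one ht
    have hp0 : 0 ≤ t ^ (-1 - p) := Real.rpow_nonneg ht0.le _
    have hc : 0 ≤ 1 - Real.cos (x * t) := by linarith [Real.cos_le_one (x * t)]
    rw [Real.norm_of_nonneg (mul_nonneg hc hp0)]
    gcongr
    linarith [Real.neg_one_le_cos (x * t)]

/-- The normalizing constant `∫₀^∞ (1 - cos t) t^{-1-p} dt`. -/
noncomputable def cosConst (p : ℝ) : ℝ := ∫ t in Ioi (0 : ℝ), (1 - Real.cos t) * t ^ (-1 - p)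

theorem cosConst_pos {p : ℝ} (hp : 0 < p) (hp' : p < 2) : 0 < cosConst p := by
  have hi := integrableOn_one_sub_cos_mul_rpow hp hp' 1
  simp only [one_mul] at hi
  rw [cosConst, MeasureTheory.setIntegral_pos_iff_support_of_nonneg_ae _ hi]
  · refine lt_of_lt_of_le ?_ (MeasureTheory.measure_mono (s := Ioo (0 : ℝ) 1) ?_)
    · simp
    · intro t ht
      refine ⟨?_, ht.1⟩
      rw [Function.mem_support]
      have h1 : Real.cos t < 1 := by
        rw [← Real.cos_zero]
        exact Real.cos_lt_cos_of_nonneg_of_le_pi le_rfl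
          (by linarith [ht.2, Real.pi_gt_three]) ht.1
      have := Real.rpow_pos_of_pos ht.1 (-1 - p)
      exact (mul_pos (by linarith) this).ne'
  · refine (MeasureTheory.ae_restrict_mem measurableSet_Ioi).mono fun t ht => ?_
    exact mul_nonneg (by linarith [Real.cos_le_one t]) (Real.rpow_nonneg (le_of_lt ht) _)

/-- `|x|^p` is a superposition of the functions `1 - cos (x t)`. -/
theorem integral_one_sub_cos_mul_rpow {p : ℝ} (hp : 0 < p) (x : ℝ) :
    ∫ t in Ioi (0 : ℝ), (1 - Real.cos (x * t)) * t ^ (-1 - p) = |x| ^ p * cosConst p := by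
  rcases eq_or_ne x 0 with rfl | hx
  · simp [Real.zero_rpow hp.ne']
  · have hx0 : 0 < |x| := abs_pos.2 hx
    have h := MeasureTheory.integral_comp_mul_left_Ioi
      (fun t => (1 - Real.cos t) * t ^ (-1 - p)) 0 hx0
    rw [mul_zero, smul_eq_mul] at h
    have e : ∀ t ∈ Ioi (0 : ℝ), (1 - Real.cos (x * t)) * t ^ (-1 - p) =
        |x| ^ (1 + p) * ((1 - Real.cos (|x| * t)) * (|x| * t) ^ (-1 - p)) := by
      intro t ht
      have hc : Real.cos (|x| * t) = Real.cos (x * t) := by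
        rcases abs_choice x with h | h <;> rw [h]
        rw [neg_mul, Real.cos_neg]
      have ht0 : (0 : ℝ) < t := ht
      rw [hc, Real.mul_rpow hx0.le ht0.le]
      have : |x| ^ (1 + p) * |x| ^ (-1 - p) = 1 := by
        rw [← Real.rpow_add hx0]; simp
      linear_combination (-(1 - Real.cos (x * t)) * t ^ (-1 - p)) * this
    rw [MeasureTheory.setIntegral_congr_fun measurableSet_Ioi e,
      MeasureTheory.integral_const_mul, h, cosConst, ← mul_assoc]
    congr 1
    rw [Real.rpow_add hx0, Real.rpow_one]
    field_simp

/-- The fourth central difference of `|x|^p` with step one. -/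
noncomputable def diffFour (p x : ℝ) : ℝ :=
  |x + 2| ^ p - 4 * |x + 1| ^ p + 6 * |x| ^ p - 4 * |x - 1| ^ p + |x - 2| ^ p

theorem cos_fourth_difference (x t : ℝ) :
    Real.cos ((x + 2) * t) - 4 * Real.cos ((x + 1) * t) + 6 * Real.cos (x * t)
      - 4 * Real.cos ((x - 1) * t) + Real.cos ((x - 2) * t) =
      (2 - 2 * Real.cos t) ^ 2 * Real.cos (x * t) := by
  have e1 : (x + 2) * t = x * t + 2 * t := by ring
  have e2 : (x - 2) * t = x * t - 2 * t := by ring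
  have e3 : (x + 1) * t = x * t + t := by ring
  have e4 : (x - 1) * t = x * t - t := by ring
  rw [e1, e2, e3, e4, Real.cos_add, Real.cos_add, Real.cos_sub, Real.cos_sub, Real.cos_two_mul]
  ring

/-- The spectral weight of `-diffFour p`, up to the factor `cosConst p`. -/
noncomputable def spectralWeight (p t : ℝ) : ℝ := (2 - 2 * Real.cos t) ^ 2 * t ^ (-1 - p)

/-- A fourth difference annihilates the constant in `1 - cos (x t)` and multiplies the cosine by
`(2 - 2 cos t)²`, so `-diffFour p` is a positive definite function. -/
theorem diffFour_spectral {p : ℝ} (hp : 0 < p) (hp' : p < 2) (x : ℝ) :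
    MeasureTheory.IntegrableOn (fun t : ℝ => Real.cos (x * t) * spectralWeight p t) (Ioi 0) ∧
    ∫ t in Ioi (0 : ℝ), Real.cos (x * t) * spectralWeight p t = -diffFour p x * cosConst p := by
  have hi := fun y => integrableOn_one_sub_cos_mul_rpow hp hp' y
  have e : (fun t : ℝ => Real.cos (x * t) * spectralWeight p t) = fun t : ℝ =>
      -((1 - Real.cos ((x + 2) * t)) * t ^ (-1 - p)
        - 4 * ((1 - Real.cos ((x + 1) * t)) * t ^ (-1 - p))
        + 6 * ((1 - Real.cos (x * t)) * t ^ (-1 - p))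
        - 4 * ((1 - Real.cos ((x - 1) * t)) * t ^ (-1 - p))
        + (1 - Real.cos ((x - 2) * t)) * t ^ (-1 - p)) := by
    funext t
    rw [spectralWeight]
    linear_combination (-t ^ (-1 - p)) * cos_fourth_difference x t
  have i1 := (hi (x + 2)).sub ((hi (x + 1)).const_mul 4)
  have i2 := i1.add ((hi x).const_mul 6)
  have i3 := i2.sub ((hi (x - 1)).const_mul 4)
  have i4 := i3.add (hi (x - 2))
  rw [e]
  refine ⟨i4.neg, ?_⟩
  rw [MeasureTheory.integral_neg]
  have := MeasureTheory.integral_add i3 (hi (x - 2))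
  have h2 := MeasureTheory.integral_sub i2 ((hi (x - 1)).const_mul 4)
  have h3 := MeasureTheory.integral_add i1 ((hi x).const_mul 6)
  have h4 := MeasureTheory.integral_sub (hi (x + 2)) ((hi (x + 1)).const_mul 4)
  simp only [Pi.add_apply, Pi.sub_apply, MeasureTheory.integral_const_mul,
    integral_one_sub_cos_mul_rpow hp] at this h2 h3 h4
  rw [this, h2, h3, h4, diffFour]
  ring

/-- The space-time form of the scheme is nonnegative: a causal convolution form in time,
averaged over the spatial frequencies. -/
theorem spaceTime_form_nonneg {p : ℝ} (hp : 0 < p) (hp' : p < 2) {l : ℕ → ℝ} {N : ℕ}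
    (hl : ∀ z : ℕ → ℝ, 0 ≤ ∑ n ∈ Finset.range N, ∑ k ∈ Finset.range (n + 1),
      l k * (z (n - k) * z n)) (s : Finset ℕ) (y : ℕ → ℕ → ℝ) :
    ∑ n ∈ Finset.range N, ∑ k ∈ Finset.range (n + 1), ∑ i ∈ s, ∑ j ∈ s,
      l k * (diffFour p ((i : ℝ) - j) * y j (n - k) * y i n) ≤ 0 := by
  have hK := cosConst_pos hp hp'
  set c : ℕ → ℕ → ℕ → ℕ → ℝ := fun n k i j => l k * (y j (n - k) * y i n)
  have hint : ∀ n k i j, MeasureTheory.IntegrableOn (fun t : ℝ => c n k i j *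
      (Real.cos (((i : ℝ) - j) * t) * spectralWeight p t)) (Ioi 0) := fun n k i j =>
    (diffFour_spectral hp hp' _).1.const_mul _
  have key : (∑ n ∈ Finset.range N, ∑ k ∈ Finset.range (n + 1), ∑ i ∈ s, ∑ j ∈ s,
      l k * (diffFour p ((i : ℝ) - j) * y j (n - k) * y i n)) * (-cosConst p) =
      ∫ t in Ioi (0 : ℝ), ∑ n ∈ Finset.range N, ∑ k ∈ Finset.range (n + 1), ∑ i ∈ s, ∑ j ∈ s,
        c n k i j * (Real.cos (((i : ℝ) - j) * t) * spectralWeight p t) := by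
    rw [MeasureTheory.integral_finsetSum _ fun n _ => MeasureTheory.integrable_finsetSum _
      fun k _ => MeasureTheory.integrable_finsetSum _ fun i _ =>
        MeasureTheory.integrable_finsetSum _ fun j _ => hint n k i j, Finset.sum_mul]
    refine Finset.sum_congr rfl fun n _ => ?_
    rw [MeasureTheory.integral_finsetSum _ fun k _ => MeasureTheory.integrable_finsetSum _
      fun i _ => MeasureTheory.integrable_finsetSum _ fun j _ => hint n k i j, Finset.sum_mul]
    refine Finset.sum_congr rfl fun k _ => ?_
    rw [MeasureTheory.integral_finsetSum _ fun i _ => MeasureTheory.integrable_finsetSum _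
      fun j _ => hint n k i j, Finset.sum_mul]
    refine Finset.sum_congr rfl fun i _ => ?_
    rw [MeasureTheory.integral_finsetSum _ fun j _ => hint n k i j, Finset.sum_mul]
    refine Finset.sum_congr rfl fun j _ => ?_
    rw [MeasureTheory.integral_const_mul, (diffFour_spectral hp hp' _).2]
    ring
  have hnn : 0 ≤ ∫ t in Ioi (0 : ℝ), ∑ n ∈ Finset.range N, ∑ k ∈ Finset.range (n + 1),
      ∑ i ∈ s, ∑ j ∈ s, c n k i j * (Real.cos (((i : ℝ) - j) * t) * spectralWeight p t) := by
    refine MeasureTheory.setIntegral_nonneg measurableSet_Ioi fun t ht => ?_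
    have hw : 0 ≤ spectralWeight p t :=
      mul_nonneg (sq_nonneg _) (Real.rpow_nonneg (le_of_lt ht) _)
    have e : ∑ n ∈ Finset.range N, ∑ k ∈ Finset.range (n + 1),
        ∑ i ∈ s, ∑ j ∈ s, c n k i j * (Real.cos (((i : ℝ) - j) * t) * spectralWeight p t) =
        spectralWeight p t * (∑ n ∈ Finset.range N, ∑ k ∈ Finset.range (n + 1),
          l k * ((∑ i ∈ s, y i (n - k) * Real.cos (i * t)) * ∑ i ∈ s, y i n * Real.cos (i * t)) +
          ∑ n ∈ Finset.range N, ∑ k ∈ Finset.range (n + 1),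
          l k * ((∑ i ∈ s, y i (n - k) * Real.sin (i * t)) *
            ∑ i ∈ s, y i n * Real.sin (i * t))) := by
      rw [← Finset.sum_add_distrib, Finset.mul_sum]
      refine Finset.sum_congr rfl fun n _ => ?_
      rw [← Finset.sum_add_distrib, Finset.mul_sum]
      refine Finset.sum_congr rfl fun k _ => ?_
      rw [Finset.sum_mul_sum, Finset.sum_mul_sum, ← mul_add, ← Finset.sum_add_distrib,
        Finset.mul_sum, Finset.mul_sum, Finset.sum_comm]
      refine Finset.sum_congr rfl fun j _ => ?_
      rw [← Finset.sum_add_distrib, Finset.mul_sum, Finset.mul_sum]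
      refine Finset.sum_congr rfl fun i _ => ?_
      rw [sub_mul, Real.cos_sub]
      ring
    rw [e]
    exact mul_nonneg hw (add_nonneg (hl fun n => ∑ i ∈ s, y i n * Real.cos (i * t))
      (hl fun n => ∑ i ∈ s, y i n * Real.sin (i * t)))
  rw [← key] at hnn
  by_contra hc
  push Not at hc
  nlinarith [mul_pos hc hK]

/-! ### Stability of the scheme -/

/-- The matrix of the scheme is Toeplitz, with the fourth central difference of `|x|^{3-α}` as its
generating function. The separately defined first weights are the values where the absolute value
folds the arguments and where `0 ^ (3 - α) = 0`. -/
theorem wMat_eq_diffFour {α : ℝ} (hα : α < 3) (i j : ℕ) :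
    wMat α i j = diffFour (3 - α) ((i : ℝ) - j) := by
  have hp : (3 - α) ≠ 0 := by linarith
  have h0 : (0 : ℝ) ^ (3 - α) = 0 := Real.zero_rpow hp
  have h4 : (2 : ℝ) ^ (5 - α) = 4 * 2 ^ (3 - α) := by
    rw [show 5 - α = 2 + (3 - α) by ring, Real.rpow_add (by norm_num)]; norm_num
  have hfar : ∀ k : ℕ, wWeight α (k + 3) = diffFour (3 - α) ((k : ℝ) + 2) := by
    intro k
    have hk : (0 : ℝ) ≤ k := k.cast_nonneg
    simp only [wWeight, diffFour]
    rw [abs_of_nonneg (by linarith), abs_of_nonneg (by linarith), abs_of_nonneg (by linarith),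
      abs_of_nonneg (by linarith), abs_of_nonneg (by linarith)]
    ring_nf
  have heven : ∀ x : ℝ, diffFour (3 - α) (-x) = diffFour (3 - α) x := by
    intro x
    simp only [diffFour]
    rw [abs_neg, show -x + 2 = -(x - 2) by ring, show -x + 1 = -(x - 1) by ring,
      show -x - 1 = -(x + 1) by ring, show -x - 2 = -(x + 2) by ring]
    simp only [abs_neg]
    ring
  have hone : wWeight α 0 + wWeight α 2 = diffFour (3 - α) 1 := by
    simp only [wWeight, diffFour, h4]
    norm_num [h0]
    ring
  have hzero : 2 * wWeight α 1 = diffFour (3 - α) 0 := by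
    simp only [wWeight, diffFour]
    norm_num [h0]
    ring
  unfold wMat
  split_ifs with h1 h2 h3 h5
  · obtain ⟨k, rfl⟩ : ∃ k, i = j + 2 + k := ⟨i - (j + 2), by omega⟩
    rw [show j + 2 + k - j + 1 = k + 3 by omega, hfar]
    congr 1; push_cast; ring
  · rw [hone]; congr 1; rw [← h2]; push_cast; ring
  · rw [hzero]; congr 1; rw [h3]; ring
  · rw [hone, ← heven]; congr 1; rw [h5]; push_cast; ring
  · obtain ⟨k, rfl⟩ : ∃ k, j = i + 2 + k := ⟨j - (i + 2), by omega⟩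
    rw [show i + 2 + k - i + 1 = k + 3 by omega, hfar, ← heven]
    congr 1; push_cast; ring

theorem kappa_neg {α : ℝ} (hα : 1 < α) (hα' : α ≤ 2) : kappa α < 0 := by
  have : Real.cos (α * Real.pi / 2) < 0 :=
    Real.cos_neg_of_pi_div_two_lt_of_lt (by nlinarith [Real.pi_pos]) (by nlinarith [Real.pi_pos])
  rw [kappa]
  exact one_div_neg.2 (by linarith)

theorem rieszFactor_nonneg {α b : ℝ} (hα : 1 < α) (hα' : α ≤ 2) (hb : 0 ≤ b) (M : ℕ) :
    0 ≤ -kappa α / (Real.Gamma (4 - α) * spaceStep b M ^ α) := by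
  have := kappa_neg hα hα'
  have := Real.Gamma_pos_of_pos (show 0 < 4 - α by linarith)
  have : 0 ≤ spaceStep b M := by unfold spaceStep; positivity
  have : 0 ≤ spaceStep b M ^ α := Real.rpow_nonneg this _
  apply div_nonneg <;> [linarith; positivity]

theorem memoryTerm_sub (α γ lam b T : ℝ) (M N : ℕ) (V W : ℕ → ℕ → ℝ) (i n : ℕ) :
    memoryTerm α γ lam b T M N (fun i n => V i n - W i n) i n =
      memoryTerm α γ lam b T M N V i n - memoryTerm α γ lam b T M N W i n := by
  simp only [memoryTerm, discreteRiesz]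
  rw [← mul_sub, ← Finset.sum_sub_distrib]
  congr 1
  refine Finset.sum_congr rfl fun k _ => ?_
  rw [← mul_sub, ← mul_sub, ← Finset.sum_sub_distrib]
  congr 2
  refine Finset.sum_congr rfl fun j _ => ?_
  ring

/-- The memory term dissipates the discrete energy when tested with `e^{n+1} + e^n`. -/
theorem sum_memoryTerm_mul_nonpos {α γ lam b T : ℝ} (hα : 1 < α) (hα' : α ≤ 2) (hγ : 1 < γ)
    (hγ' : γ ≤ 2) (hlam : 0 ≤ lam) (hb : 0 < b) (hT : 0 < T) (M N : ℕ) (e : ℕ → ℕ → ℝ) (K : ℕ) :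
    ∑ n ∈ Finset.range K, ∑ i ∈ Finset.Icc 1 (M - 1),
      memoryTerm α γ lam b T M N e i n * (e i (n + 1) + e i n) ≤ 0 := by
  have hτ : 0 ≤ timeStep T N := by unfold timeStep; positivity
  have h := spaceTime_form_nonneg (p := 3 - α) (by linarith) (by linarith)
    (l := lWeight (γ - 1) lam (timeStep T N)) (N := K)
    (fun z => lWeight_form_nonneg (by linarith) (by linarith) hlam hτ z K)
    (Finset.Icc 1 (M - 1)) (fun i n => e i (n + 1) + e i n)
  have hc := rieszFactor_nonneg hα hα' hb.le M
  set c := -kappa α / (Real.Gamma (4 - α) * spaceStep b M ^ α) with hcdef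
  have e1 : ∑ n ∈ Finset.range K, ∑ i ∈ Finset.Icc 1 (M - 1),
      memoryTerm α γ lam b T M N e i n * (e i (n + 1) + e i n) =
      timeStep T N ^ γ / 2 * c * ∑ n ∈ Finset.range K, ∑ k ∈ Finset.range (n + 1),
        ∑ i ∈ Finset.Icc 1 (M - 1), ∑ j ∈ Finset.Icc 1 (M - 1),
        lWeight (γ - 1) lam (timeStep T N) k * (diffFour (3 - α) ((i : ℝ) - j) *
          (e j (n - k + 1) + e j (n - k)) * (e i (n + 1) + e i n)) := by
    rw [Finset.mul_sum]
    refine Finset.sum_congr rfl fun n _ => ?_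
    rw [Finset.sum_comm, Finset.mul_sum]
    refine Finset.sum_congr rfl fun i _ => ?_
    rw [memoryTerm, mul_assoc (timeStep T N ^ γ / 2), mul_assoc, Finset.mul_sum, Finset.sum_mul]
    congr 1
    refine Finset.sum_congr rfl fun k hk => ?_
    have hk' : k ≤ n := Nat.lt_succ_iff.1 (Finset.mem_range.1 hk)
    rw [discreteRiesz, ← hcdef, Finset.mul_sum, Finset.mul_sum, Finset.mul_sum, Finset.sum_mul]
    refine Finset.sum_congr rfl fun j _ => ?_
    rw [wMat_eq_diffFour (by linarith), show n + 1 - k = n - k + 1 by omega]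
    ring
  rw [e1]
  exact mul_nonpos_of_nonneg_of_nonpos (by positivity) h

theorem discreteNorm_sq {b : ℝ} (hb : 0 ≤ b) (M : ℕ) (V : ℕ → ℝ) :
    discreteNorm b M V ^ 2 = spaceStep b M * ∑ i ∈ Finset.Icc 1 (M - 1), V i ^ 2 := by
  have : 0 ≤ spaceStep b M := by unfold spaceStep; positivity
  exact Real.sq_sqrt (mul_nonneg this (Finset.sum_nonneg fun i _ => sq_nonneg _))

/-- The discrete `L¹` norm is controlled by the discrete `L²` norm. -/
theorem spaceStep_mul_sum_abs_le {b : ℝ} (hb : 0 < b) {M : ℕ} (hM : 1 ≤ M) (V : ℕ → ℝ) :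
    spaceStep b M * ∑ i ∈ Finset.Icc 1 (M - 1), |V i| ≤ Real.sqrt b * discreteNorm b M V := by
  have hM0 : (0 : ℝ) < M := by exact_mod_cast hM
  have hh : 0 < spaceStep b M := by unfold spaceStep; positivity
  have hbM : spaceStep b M * M = b := by unfold spaceStep; field_simp
  rw [discreteNorm, ← Real.sqrt_mul hb.le]
  apply Real.le_sqrt_of_sq_le
  have h1 := sq_sum_le_card_mul_sum_sq (s := Finset.Icc 1 (M - 1)) (f := fun i => |V i|)
  simp only [sq_abs, Nat.card_Icc] at h1
  have h2 : ((M - 1 + 1 - 1 : ℕ) : ℝ) ≤ M := by exact_mod_cast (by omega)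
  have hS : 0 ≤ ∑ i ∈ Finset.Icc 1 (M - 1), V i ^ 2 := Finset.sum_nonneg fun i _ => sq_nonneg _
  calc (spaceStep b M * ∑ i ∈ Finset.Icc 1 (M - 1), |V i|) ^ 2
      = spaceStep b M ^ 2 * (∑ i ∈ Finset.Icc 1 (M - 1), |V i|) ^ 2 := by ring
    _ ≤ spaceStep b M ^ 2 * (M * ∑ i ∈ Finset.Icc 1 (M - 1), V i ^ 2) := by
        gcongr
        exact h1.trans (by gcongr)
    _ = b * (spaceStep b M * ∑ i ∈ Finset.Icc 1 (M - 1), V i ^ 2) := by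
        linear_combination (spaceStep b M * ∑ i ∈ Finset.Icc 1 (M - 1), V i ^ 2) * hbM

theorem gridNode_mem_Icc {b : ℝ} (hb : 0 ≤ b) {M i : ℕ} (hi : i ≤ M) :
    (i : ℝ) * spaceStep b M ∈ Icc 0 b := by
  unfold spaceStep
  rcases Nat.eq_zero_or_pos M with rfl | hM
  · simp [hb]
  have hM0 : (0 : ℝ) < M := by exact_mod_cast hM
  have hi' : (i : ℝ) ≤ M := by exact_mod_cast hi
  refine ⟨by positivity, ?_⟩
  rw [mul_div_assoc', div_le_iff₀ hM0]
  nlinarith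

/-- A truncation error of size `C τ ε` produces an error of size `2 C √b T ε`. -/
theorem stability {α γ lam b T : ℝ} (hα : 1 < α) (hα' : α ≤ 2) (hγ : 1 < γ)
    (hγ' : γ ≤ 2) (hlam : 0 ≤ lam) (hb : 0 < b) (hT : 0 < T) {f u : ℝ → ℝ → ℝ}
    (hu : IsExactSolution α γ lam b T f u) {C : ℝ} (hC : 0 < C) {M N : ℕ} (hM : 1 ≤ M)
    (hN : 1 ≤ N) (hR : TruncationBound α γ lam b T M N f u C) {U : ℕ → ℕ → ℝ}
    (hU : IsSchemeSolution α γ lam b T M N f U) {n : ℕ} (hn : n ≤ N) :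
    discreteNorm b M (fun i => gridValues b T M N u i n - U i n) ≤
      2 * C * b ^ (1 / 2 : ℝ) * T * (timeStep T N ^ 2 + spaceStep b M ^ 2) := by
  set e : ℕ → ℕ → ℝ := fun i n => gridValues b T M N u i n - U i n with he
  set ε : ℝ := timeStep T N ^ 2 + spaceStep b M ^ 2 with hε
  set τ := timeStep T N with hτdef
  set h := spaceStep b M with hhdef
  set D : ℕ → ℝ := fun n => discreteNorm b M fun i => e i n with hD
  set s := Finset.Icc 1 (M - 1) with hs
  have hN0 : (0 : ℝ) < N := by exact_mod_cast hN
  have hτ : 0 < τ := by rw [hτdef]; unfold timeStep; positivity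
  have hτN : N * τ = T := by rw [hτdef]; unfold timeStep; field_simp
  have hh : 0 < h := by
    have hM0 : (0 : ℝ) < M := by exact_mod_cast hM
    rw [hhdef]; unfold spaceStep; positivity
  have hε0 : 0 < ε := by positivity
  have hD0 : ∀ n, 0 ≤ D n := fun n => Real.sqrt_nonneg _
  have hstep : ∀ i ∈ s, ∀ n < N, e i (n + 1) - e i n =
      memoryTerm α γ lam b T M N e i n + residual α γ lam b T M N f u i n := by
    intro i hi n hn
    have h1 := hU.step i hi n hn
    rw [he, memoryTerm_sub, residual]
    linarith
  have hinit : ∀ i ∈ s, e i 0 = 0 := by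
    intro i hi
    have hiM : i ≤ M := by rw [hs, Finset.mem_Icc] at hi; omega
    simp only [he, gridValues, hU.initial i hiM, Nat.cast_zero, zero_mul, sub_zero]
    exact hu.initial _ (gridNode_mem_Icc hb.le hiM)
  -- testing the error equation with `e^{n+1} + e^n` and summing over the time levels
  have henergy : ∀ K ≤ N, D K ^ 2 ≤
      ∑ n ∈ Finset.range K, C * τ * ε * (Real.sqrt b * (D (n + 1) + D n)) := by
    intro K hK
    have htel : ∑ i ∈ s, e i K ^ 2 = ∑ n ∈ Finset.range K, ∑ i ∈ s,
        (e i (n + 1) - e i n) * (e i (n + 1) + e i n) := by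
      rw [Finset.sum_comm]
      refine Finset.sum_congr rfl fun i hi => ?_
      have := Finset.sum_range_sub (fun n => e i n ^ 2) K
      rw [hinit i hi] at this
      rw [show e i K ^ 2 = e i K ^ 2 - 0 ^ 2 by ring, ← this]
      exact Finset.sum_congr rfl fun n _ => by ring
    have hsplit : ∑ n ∈ Finset.range K, ∑ i ∈ s,
        (e i (n + 1) - e i n) * (e i (n + 1) + e i n) =
        ∑ n ∈ Finset.range K, ∑ i ∈ s,
          memoryTerm α γ lam b T M N e i n * (e i (n + 1) + e i n) +
        ∑ n ∈ Finset.range K, ∑ i ∈ s,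
          residual α γ lam b T M N f u i n * (e i (n + 1) + e i n) := by
      rw [← Finset.sum_add_distrib]
      refine Finset.sum_congr rfl fun n hn => ?_
      rw [← Finset.sum_add_distrib]
      refine Finset.sum_congr rfl fun i hi => ?_
      rw [hstep i hi n (lt_of_lt_of_le (Finset.mem_range.1 hn) hK)]
      ring
    have hneg := sum_memoryTerm_mul_nonpos hα hα' hγ hγ' hlam hb hT M N e K
    rw [hD]
    simp only [discreteNorm_sq hb.le]
    rw [← hs, htel, hsplit]
    calc h * (_ + _) ≤ h * ∑ n ∈ Finset.range K, ∑ i ∈ s,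
          residual α γ lam b T M N f u i n * (e i (n + 1) + e i n) := by
          gcongr; linarith
      _ = ∑ n ∈ Finset.range K, h * ∑ i ∈ s,
          residual α γ lam b T M N f u i n * (e i (n + 1) + e i n) := Finset.mul_sum _ _ _
      _ ≤ _ := by
          refine Finset.sum_le_sum fun n hn => ?_
          have hnN := lt_of_lt_of_le (Finset.mem_range.1 hn) hK
          have h1 : ∑ i ∈ s, residual α γ lam b T M N f u i n * (e i (n + 1) + e i n) ≤
              ∑ i ∈ s, C * τ * ε * (|e i (n + 1)| + |e i n|) := by
            refine Finset.sum_le_sum fun i hi => ?_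
            refine (le_abs_self _).trans ?_
            rw [abs_mul]
            exact mul_le_mul (hR i hi n hnN) (abs_add_le _ _) (abs_nonneg _) (by positivity)
          rw [← Finset.mul_sum, Finset.sum_add_distrib] at h1
          have h2 := spaceStep_mul_sum_abs_le hb hM fun i => e i (n + 1)
          have h3 := spaceStep_mul_sum_abs_le hb hM fun i => e i n
          calc h * ∑ i ∈ s, residual α γ lam b T M N f u i n * (e i (n + 1) + e i n)
              ≤ h * (C * τ * ε * (∑ i ∈ s, |e i (n + 1)| + ∑ i ∈ s, |e i n|)) := by gcongr
            _ = C * τ * ε * (h * ∑ i ∈ s, |e i (n + 1)| + h * ∑ i ∈ s, |e i n|) := by ring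
            _ ≤ C * τ * ε * (Real.sqrt b * D (n + 1) + Real.sqrt b * D n) := by gcongr
            _ = _ := by ring
  -- the energy estimate at the time level where the error norm is largest
  obtain ⟨m, hm, hmax⟩ := Finset.exists_max_image (Finset.range (N + 1)) D ⟨0, by simp⟩
  have hmN : m ≤ N := by simpa [Nat.lt_succ_iff] using hm
  have hDm : D m ^ 2 ≤ (2 * C * Real.sqrt b * T * ε) * D m := by
    refine (henergy m hmN).trans ?_
    calc ∑ n ∈ Finset.range m, C * τ * ε * (Real.sqrt b * (D (n + 1) + D n))
        ≤ ∑ n ∈ Finset.range m, C * τ * ε * (Real.sqrt b * (D m + D m)) := by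
          refine Finset.sum_le_sum fun n hn => ?_
          have hn' := Finset.mem_range.1 hn
          have h1 := hmax (n + 1) (Finset.mem_range.2 (by omega))
          have h2 := hmax n (Finset.mem_range.2 (by omega))
          gcongr
      _ = (m * τ) * (2 * C * Real.sqrt b * ε * D m) := by
          rw [Finset.sum_const, Finset.card_range, nsmul_eq_mul]; ring
      _ ≤ (N * τ) * (2 * C * Real.sqrt b * ε * D m) := by
          have := hD0 m
          have : (m : ℝ) ≤ N := by exact_mod_cast hmN
          gcongr
      _ = _ := by rw [hτN]; ring
  have hfin : D m ≤ 2 * C * Real.sqrt b * T * ε := by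
    rcases (hD0 m).eq_or_lt with h0 | h0
    · rw [← h0]; positivity
    · rw [sq] at hDm
      exact le_of_mul_le_mul_right hDm h0
  rw [← Real.sqrt_eq_rpow]
  exact (hmax n (Finset.mem_range.2 (by omega))).trans hfin

/-! ### Taylor expansions and finite differences -/

/-- `φ 0, …, φ n` are the successive derivatives of `φ 0`. -/
def DerivChain (n : ℕ) (φ : ℕ → ℝ → ℝ) : Prop :=
  ∀ k < n, ∀ x, HasDerivAt (φ k) (φ (k + 1) x) x

theorem DerivChain.mono {m n : ℕ} {φ : ℕ → ℝ → ℝ} (h : DerivChain n φ) (hmn : m ≤ n) :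
    DerivChain m φ := fun k hk => h k (hk.trans_le hmn)

theorem DerivChain.shift {m n : ℕ} {φ : ℕ → ℝ → ℝ} (h : DerivChain (m + n) φ) :
    DerivChain n (fun k => φ (m + k)) := fun k hk => h (m + k) (by omega)

theorem DerivChain.continuous {n : ℕ} {φ : ℕ → ℝ → ℝ} (h : DerivChain n φ) {k : ℕ} (hk : k < n) :
    Continuous (φ k) := continuous_iff_continuousAt.2 fun x => (h k hk x).continuousAt

/-- Reflection `x ↦ c - x`. -/
theorem DerivChain.reflect {n : ℕ} {φ : ℕ → ℝ → ℝ} (h : DerivChain n φ) (c : ℝ) :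
    DerivChain n (fun k x => (-1) ^ k * φ k (c - x)) := by
  intro k hk x
  have h1 : HasDerivAt (fun y : ℝ => c - y) (-1) x := (hasDerivAt_id x).const_sub c
  have h2 := ((h k hk (c - x)).comp x h1).const_mul ((-1) ^ k)
  refine h2.congr_deriv ?_
  ring

theorem abs_sub_taylor_le {n : ℕ} {φ : ℕ → ℝ → ℝ} (hφ : DerivChain n φ) {x h B : ℝ} (hh : 0 ≤ h)
    (hB : ∀ y ∈ Icc x (x + h), |φ n y| ≤ B) :
    |φ 0 (x + h) - ∑ k ∈ Finset.range n, φ k x * (h ^ k / k.factorial)| ≤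
      B * (h ^ n / n.factorial) := by
  induction n generalizing φ h with
  | zero => simpa using hB (x + h) ⟨by linarith, le_rfl⟩
  | succ n ih =>
    have hsh : DerivChain n (fun k => φ (k + 1)) := fun k hk => hφ (k + 1) (by omega)
    set f : ℝ → ℝ := fun s => φ 0 (x + s) -
      ∑ k ∈ Finset.range (n + 1), φ k x * (s ^ k / k.factorial) with hf
    have hpow : ∀ (k : ℕ) (s : ℝ), HasDerivAt (fun s : ℝ => s ^ (k + 1) / (k + 1).factorial)
        (s ^ k / k.factorial) s := by
      intro k s
      refine ((hasDerivAt_pow (k + 1) s).div_const _).congr_deriv ?_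
      rw [Nat.factorial_succ]
      have : (k.factorial : ℝ) ≠ 0 := by positivity
      have : (k : ℝ) + 1 ≠ 0 := by positivity
      rw [Nat.add_sub_cancel]
      push_cast
      field_simp
    have hder : ∀ s, HasDerivAt f (φ 1 (x + s) -
        ∑ k ∈ Finset.range n, φ (k + 1) x * (s ^ k / k.factorial)) s := by
      intro s
      have e : f = fun s => φ 0 (x + s) - (∑ k ∈ Finset.range n,
          φ (k + 1) x * (s ^ (k + 1) / (k + 1).factorial) + φ 0 x) := by
        funext s
        simp only [hf]
        rw [Finset.sum_range_succ']
        simp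
      rw [e]
      refine HasDerivAt.sub ((hφ 0 (by omega) (x + s)).comp_const_add x s) ?_
      refine HasDerivAt.add_const _ ?_
      exact HasDerivAt.fun_sum fun k _ => (hpow k s).const_mul _
    have hmain := image_norm_le_of_norm_deriv_right_le_deriv_boundary (a := 0) (b := h) (f := f)
      (B := fun s => B * (s ^ (n + 1) / (n + 1).factorial)) (B' := fun s => B * (s ^ n / n.factorial))
      (continuous_iff_continuousAt.2 fun s => (hder s).continuousAt).continuousOn
      (fun s _ => (hder s).hasDerivWithinAt)
      (by
        simp only [hf]
        rw [Finset.sum_range_succ']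
        simp)
      (fun s => (hpow n s).const_mul B)
      (fun s hs => by
        rw [Real.norm_eq_abs]
        exact ih hsh hs.1 fun y hy => hB y ⟨hy.1, hy.2.trans (by linarith [hs.2])⟩)
      (x := h) ⟨hh, le_rfl⟩
    exact hmain

theorem abs_sub_taylor_neg_le {n : ℕ} {φ : ℕ → ℝ → ℝ} (hφ : DerivChain n φ) {x h B : ℝ}
    (hh : 0 ≤ h) (hB : ∀ y ∈ Icc (x - h) x, |φ n y| ≤ B) :
    |φ 0 (x - h) - ∑ k ∈ Finset.range n, φ k x * ((-h) ^ k / k.factorial)| ≤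
      B * (h ^ n / n.factorial) := by
  have h1 := abs_sub_taylor_le (hφ.reflect 0) (x := -x) (h := h) (B := B) hh fun y hy => by
    rw [abs_mul, abs_pow, abs_neg, abs_one, one_pow, one_mul]
    exact hB _ ⟨by linarith [hy.2], by linarith [hy.1]⟩
  have e : ∀ k : ℕ, (-1) ^ k * φ k (0 - -x) * (h ^ k / k.factorial) =
      φ k x * ((-h) ^ k / k.factorial) := by
    intro k
    rw [neg_pow h, zero_sub, neg_neg]; ring
  simp only [e] at h1
  rw [show 0 - (-x + h) = x - h by ring, pow_zero, one_mul] at h1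
  exact h1

theorem abs_second_difference_le {φ : ℕ → ℝ → ℝ} (hφ : DerivChain 2 φ) {x h B : ℝ} (hh : 0 ≤ h)
    (hB : ∀ y ∈ Icc (x - h) (x + h), |φ 2 y| ≤ B) :
    |φ 0 (x + h) - 2 * φ 0 x + φ 0 (x - h)| ≤ B * h ^ 2 := by
  have h1 := abs_sub_taylor_le hφ hh fun y hy => hB y ⟨by linarith [hy.1], hy.2⟩
  have h2 := abs_sub_taylor_neg_le hφ hh fun y hy => hB y ⟨hy.1, by linarith [hy.2]⟩
  simp only [Finset.sum_range_succ, Finset.sum_range_zero, Nat.factorial] at h1 h2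
  norm_num at h1 h2
  rw [abs_le] at *
  constructor <;> linarith [h1.1, h1.2, h2.1, h2.2]

theorem abs_second_difference_sub_le {φ : ℕ → ℝ → ℝ} (hφ : DerivChain 4 φ) {x h B : ℝ}
    (hh : 0 ≤ h) (hB : ∀ y ∈ Icc (x - h) (x + h), |φ 4 y| ≤ B) :
    |φ 0 (x + h) - 2 * φ 0 x + φ 0 (x - h) - h ^ 2 * φ 2 x| ≤ B * h ^ 4 := by
  have h1 := abs_sub_taylor_le hφ hh fun y hy => hB y ⟨by linarith [hy.1], hy.2⟩
  have h2 := abs_sub_taylor_neg_le hφ hh fun y hy => hB y ⟨hy.1, by linarith [hy.2]⟩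
  have hB0 : 0 ≤ B * h ^ 4 :=
    mul_nonneg ((abs_nonneg _).trans (hB x ⟨by linarith, by linarith⟩)) (by positivity)
  simp only [Finset.sum_range_succ, Finset.sum_range_zero, Nat.factorial] at h1 h2
  norm_num at h1 h2
  rw [abs_le] at *
  constructor <;> linarith [h1.1, h1.2, h2.1, h2.2]

theorem abs_fourth_difference_sub_le {φ : ℕ → ℝ → ℝ} (hφ : DerivChain 6 φ) {x h B : ℝ}
    (hh : 0 ≤ h) (hB : ∀ y, |φ 6 y| ≤ B) :
    |φ 0 (x + 2 * h) - 4 * φ 0 (x + h) + 6 * φ 0 x - 4 * φ 0 (x - h) + φ 0 (x - 2 * h)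
      - h ^ 4 * φ 4 x| ≤ B * h ^ 6 := by
  have h1 := abs_sub_taylor_le hφ (x := x) hh fun y _ => hB y
  have h2 := abs_sub_taylor_neg_le hφ (x := x) hh fun y _ => hB y
  have h3 := abs_sub_taylor_le hφ (x := x) (h := 2 * h) (by linarith) fun y _ => hB y
  have h4 := abs_sub_taylor_neg_le hφ (x := x) (h := 2 * h) (by linarith) fun y _ => hB y
  have hB0 : 0 ≤ B * h ^ 6 := mul_nonneg ((abs_nonneg _).trans (hB x)) (by positivity)
  simp only [Finset.sum_range_succ, Finset.sum_range_zero, Nat.factorial] at h1 h2 h3 h4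
  norm_num at h1 h2 h3 h4
  rw [abs_le] at *
  ring_nf at h1 h2 h3 h4 hB0 ⊢
  constructor <;> linarith [h1.1, h1.2, h2.1, h2.2, h3.1, h3.2, h4.1, h4.2]

/-! ### Quadrature with a power weight -/

/-- If `|f'| ≤ m'` then increments of `f` are bounded by increments of `m`. -/
theorem abs_sub_le_sub_of_abs_deriv_le {f f' m m' : ℝ → ℝ} {X : ℝ}
    (hf : ContinuousOn f (Icc 0 X)) (hm : ContinuousOn m (Icc 0 X))
    (hf' : ∀ y ∈ Ioo 0 X, HasDerivAt f (f' y) y) (hm' : ∀ y ∈ Ioo 0 X, HasDerivAt m (m' y) y)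
    (hle : ∀ y ∈ Ioo 0 X, |f' y| ≤ m' y) {a y : ℝ} (ha : 0 ≤ a) (hay : a ≤ y) (hy : y ≤ X) :
    |f y - f a| ≤ m y - m a := by
  have h1 : MonotoneOn (fun y => m y - f y) (Icc 0 X) := by
    refine monotoneOn_of_deriv_nonneg (convex_Icc 0 X) (hm.sub hf) ?_ ?_
    · rw [interior_Icc]
      exact fun y hy => ((hm' y hy).sub (hf' y hy)).differentiableAt.differentiableWithinAt
    · rw [interior_Icc]
      intro y hy
      rw [((hm' y hy).fun_sub (hf' y hy)).deriv]
      linarith [(abs_le.1 (hle y hy)).2]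
  have h2 : MonotoneOn (fun y => m y + f y) (Icc 0 X) := by
    refine monotoneOn_of_deriv_nonneg (convex_Icc 0 X) (hm.add hf) ?_ ?_
    · rw [interior_Icc]
      exact fun y hy => ((hm' y hy).add (hf' y hy)).differentiableAt.differentiableWithinAt
    · rw [interior_Icc]
      intro y hy
      rw [((hm' y hy).fun_add (hf' y hy)).deriv]
      linarith [(abs_le.1 (hle y hy)).1]
  have ha' : a ∈ Icc 0 X := ⟨ha, hay.trans hy⟩
  have hy' : y ∈ Icc 0 X := ⟨ha.trans hay, hy⟩
  have h3 := h1 ha' hy' hay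
  have h4 := h2 ha' hy' hay
  simp only at h3 h4
  rw [abs_le]
  constructor <;> linarith

theorem abs_integral_sub_rectangle_le {ψ : ℝ → ℝ} {a h D : ℝ} (hh : 0 ≤ h)
    (hψ : IntervalIntegrable ψ MeasureTheory.volume a (a + h))
    (hD : ∀ y ∈ Icc a (a + h), |ψ y - ψ a| ≤ D) :
    |(∫ y in a..a + h, ψ y) - h * ψ a| ≤ h * D := by
  have e : (∫ y in a..a + h, ψ y) - h * ψ a = ∫ y in a..a + h, (ψ y - ψ a) := by
    rw [intervalIntegral.integral_sub hψ intervalIntegrable_const]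
    simp
  rw [e]
  have := intervalIntegral.norm_integral_le_of_norm_le_const (a := a) (b := a + h)
    (f := fun y => ψ y - ψ a) (C := D) fun y hy => by
      rw [uIoc_of_le (by linarith)] at hy
      exact hD y ⟨hy.1.le, hy.2⟩
  rw [Real.norm_eq_abs, add_sub_cancel_left, abs_of_nonneg hh] at this
  linarith

theorem abs_integral_sub_trapezoid_le {ψ ψ' : ℝ → ℝ} {a h D : ℝ} (hh : 0 ≤ h)
    (hψ : ∀ y ∈ Icc a (a + h), HasDerivAt ψ (ψ' y) y)
    (hD : ∀ y ∈ Icc a (a + h), |ψ' y - ψ' a| ≤ D) :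
    |(∫ y in a..a + h, ψ y) - h * ((ψ a + ψ (a + h)) / 2)| ≤ 2 * h ^ 2 * D := by
  have hah : a ≤ a + h := by linarith
  -- the rule is exact on affine functions; remove the tangent at `a`
  set r : ℝ → ℝ := fun y => ψ y - ψ' a * (y - a) with hr
  have hr' : ∀ y ∈ Icc a (a + h), HasDerivAt r (ψ' y - ψ' a) y := fun y hy => by
    refine ((hψ y hy).sub (((hasDerivAt_id y).sub_const a).const_mul (ψ' a))).congr_deriv ?_
    simp
  have hrb : ∀ y ∈ Icc a (a + h), |r y - r a| ≤ D * h := by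
    intro y hy
    have := norm_image_sub_le_of_norm_deriv_le_segment' (f := r) (a := a) (b := a + h) (C := D)
      (fun y hy => (hr' y hy).hasDerivWithinAt)
      (fun y hy => hD y ⟨hy.1, hy.2.le⟩) y hy
    have hD0 : 0 ≤ D := (abs_nonneg _).trans (hD a ⟨le_rfl, hah⟩)
    refine this.trans ?_
    gcongr
    linarith [hy.2]
  have hψc : ContinuousOn ψ (uIcc a (a + h)) := by
    rw [uIcc_of_le hah]
    exact fun y hy => (hψ y hy).continuousAt.continuousWithinAt
  have hrc : ContinuousOn r (uIcc a (a + h)) := by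
    rw [uIcc_of_le hah]
    exact fun y hy => (hr' y hy).continuousAt.continuousWithinAt
  have h1 := abs_integral_sub_rectangle_le hh hrc.intervalIntegrable hrb
  have h2 := hrb (a + h) ⟨hah, le_rfl⟩
  have e1 : ∫ y in a..a + h, r y = (∫ y in a..a + h, ψ y) - ψ' a * (h ^ 2 / 2) := by
    simp only [hr]
    rw [intervalIntegral.integral_sub hψc.intervalIntegrable
      (Continuous.intervalIntegrable (by fun_prop) _ _),
      intervalIntegral.integral_const_mul, intervalIntegral.integral_comp_sub_right (fun y => y)]
    simp
  have e2 : (∫ y in a..a + h, ψ y) - h * ((ψ a + ψ (a + h)) / 2) =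
      ((∫ y in a..a + h, r y) - h * r a) - h / 2 * (r (a + h) - r a) := by
    rw [e1]; simp only [hr]; ring
  rw [e2]
  refine (abs_sub _ _).trans ?_
  rw [abs_mul, abs_of_nonneg (by positivity : 0 ≤ h / 2)]
  have hD0 : 0 ≤ D := (abs_nonneg _).trans (hD a ⟨le_rfl, hah⟩)
  have h3 : h / 2 * |r (a + h) - r a| ≤ h / 2 * (D * h) := by gcongr
  nlinarith [mul_nonneg hD0 (sq_nonneg h)]

/-- First-order accuracy of the left rectangle rule with weight `y ^ p`. -/
theorem abs_rectangle_rule_le {p h B : ℝ} (hp : 0 < p) (hh : 0 ≤ h) {φ : ℕ → ℝ → ℝ}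
    (hφ : DerivChain 1 φ) (n : ℕ) (hB : ∀ k ≤ 1, ∀ y ∈ Icc 0 (n * h), |φ k y| ≤ B) :
    |h * ∑ k ∈ Finset.range n, (k * h) ^ p * φ 0 (k * h) - ∫ y in (0 : ℝ)..n * h, y ^ p * φ 0 y| ≤
      h * (B * ((n * h) ^ p + (n * h) ^ (p + 1))) := by
  set X : ℝ := n * h with hX
  set ψ : ℝ → ℝ := fun y => y ^ p * φ 0 y with hψ
  -- a majorant of the variation of the integrand, whose increments telescope over the cells
  set m : ℝ → ℝ := fun y => B * (y ^ p + y ^ (p + 1)) with hm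
  have hφc := hφ.continuous zero_lt_one
  have hpc : Continuous fun y : ℝ => y ^ p := Real.continuous_rpow_const hp.le
  have hpc1 : Continuous fun y : ℝ => y ^ (p + 1) := Real.continuous_rpow_const (by linarith)
  have hψc : Continuous ψ := by fun_prop
  have hmc : Continuous m := by fun_prop
  have hvar : ∀ {a y : ℝ}, 0 ≤ a → a ≤ y → y ≤ X → |ψ y - ψ a| ≤ m y - m a := by
    intro a y
    refine abs_sub_le_sub_of_abs_deriv_le (f' := fun y => p * y ^ (p - 1) * φ 0 y + y ^ p * φ 1 y)
      (m' := fun y => B * (p * y ^ (p - 1) + (p + 1) * y ^ p))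
      hψc.continuousOn hmc.continuousOn ?_ ?_ ?_
    · intro y hy
      exact (Real.hasDerivAt_rpow_const (Or.inl hy.1.ne')).mul (hφ 0 zero_lt_one y)
    · intro y hy
      have h1 := Real.hasDerivAt_rpow_const (x := y) (p := p) (Or.inl hy.1.ne')
      have h2 := Real.hasDerivAt_rpow_const (x := y) (p := p + 1) (Or.inl hy.1.ne')
      rw [add_sub_cancel_right] at h2
      exact (h1.add h2).const_mul B
    · intro y hy
      have hy' : y ∈ Icc 0 X := ⟨hy.1.le, hy.2.le⟩
      have b0 := hB 0 zero_le_one y hy'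
      have b1 := hB 1 le_rfl y hy'
      have q0 : 0 ≤ y ^ p := Real.rpow_nonneg hy.1.le _
      have q1 : 0 ≤ y ^ (p - 1) := Real.rpow_nonneg hy.1.le _
      have hB0 : 0 ≤ B := (abs_nonneg _).trans b0
      refine (abs_add_le _ _).trans ?_
      rw [abs_mul, abs_mul (y ^ p), abs_of_nonneg q0,
        abs_of_nonneg (by positivity : 0 ≤ p * y ^ (p - 1))]
      calc _ ≤ p * y ^ (p - 1) * B + y ^ p * B := by gcongr
        _ ≤ p * y ^ (p - 1) * B + y ^ p * B + p * (y ^ p * B) := by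
            have : 0 ≤ p * (y ^ p * B) := by positivity
            linarith
        _ = _ := by ring
  have hcell : ∀ k ∈ Finset.range n, |(∫ y in (k * h)..((k + 1 : ℕ) * h), ψ y) - h * ψ (k * h)| ≤
      h * (m ((k + 1 : ℕ) * h) - m (k * h)) := by
    intro k hk
    have hk0 : (0 : ℝ) ≤ k * h := by positivity
    have hkn : ((k + 1 : ℕ) : ℝ) ≤ n := by exact_mod_cast Finset.mem_range.1 hk
    have e : ((k + 1 : ℕ) : ℝ) * h = k * h + h := by push_cast; ring
    have hkX : k * h + h ≤ X := by rw [← e, hX]; gcongr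
    rw [e]
    refine abs_integral_sub_rectangle_le hh (hψc.intervalIntegrable _ _) fun y hy => ?_
    refine (hvar hk0 hy.1 (hy.2.trans hkX)).trans ?_
    have := (abs_nonneg _).trans (hvar (hk0.trans hy.1) hy.2 hkX)
    linarith
  have hsum := intervalIntegral.sum_integral_adjacent_intervals (f := ψ)
    (μ := MeasureTheory.volume) (a := fun k : ℕ => (k : ℝ) * h) (n := n)
    fun k _ => hψc.intervalIntegrable _ _
  rw [Nat.cast_zero, zero_mul] at hsum
  rw [abs_sub_comm, ← hsum, Finset.mul_sum, ← Finset.sum_sub_distrib]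
  refine (Finset.abs_sum_le_sum_abs _ _).trans ((Finset.sum_le_sum hcell).trans ?_)
  rw [← Finset.mul_sum, Finset.sum_range_sub fun k : ℕ => m (k * h)]
  have : m ((0 : ℕ) * h) = 0 := by
    simp [hm, Real.zero_rpow hp.ne', Real.zero_rpow (by linarith : p + 1 ≠ 0)]
  rw [this, sub_zero]

/-- Second-order accuracy of the trapezoidal rule with weight `y ^ p`, `p ≥ 1`. The end point terms
of the rule vanish, so it is written as a left rectangle rule. -/
theorem abs_trapezoidal_rule_le {p h B : ℝ} (hp : 1 ≤ p) (hh : 0 ≤ h) {φ : ℕ → ℝ → ℝ}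
    (hφ : DerivChain 2 φ) (n : ℕ) (hB : ∀ k ≤ 2, ∀ y ∈ Icc 0 (n * h), |φ k y| ≤ B)
    (hend : φ 0 (n * h) = 0) :
    |h * ∑ k ∈ Finset.range n, (k * h) ^ p * φ 0 (k * h) - ∫ y in (0 : ℝ)..n * h, y ^ p * φ 0 y| ≤
      2 * h ^ 2 * (B * (p * (n * h) ^ (p - 1) + 2 * (n * h) ^ p + (n * h) ^ (p + 1))) := by
  set X : ℝ := n * h with hX
  have hX0 : 0 ≤ X := by positivity
  have hB0 : 0 ≤ B := (abs_nonneg _).trans (hB 0 (by omega) 0 ⟨le_rfl, hX0⟩)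
  set ψ : ℝ → ℝ := fun y => y ^ p * φ 0 y with hψ
  set ψ' : ℝ → ℝ := fun y => p * y ^ (p - 1) * φ 0 y + y ^ p * φ 1 y with hψ'
  -- a majorant of the variation of `ψ'`, whose second derivative may be singular at `0`
  set m : ℝ → ℝ := fun y => B * (p * y ^ (p - 1) + 2 * y ^ p + y ^ (p + 1)) with hm
  have hφc := hφ.continuous zero_lt_two
  have hφc1 := hφ.continuous one_lt_two
  have hpc : Continuous fun y : ℝ => y ^ p := Real.continuous_rpow_const (by linarith)
  have hpc1 : Continuous fun y : ℝ => y ^ (p + 1) := Real.continuous_rpow_const (by linarith)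
  have hpc2 : Continuous fun y : ℝ => y ^ (p - 1) := Real.continuous_rpow_const (by linarith)
  have hψc : Continuous ψ := by fun_prop
  have hψc' : Continuous ψ' := by fun_prop
  have hmc : Continuous m := by fun_prop
  have hder : ∀ y, HasDerivAt ψ (ψ' y) y := fun y =>
    (Real.hasDerivAt_rpow_const (Or.inr hp)).mul (hφ 0 zero_lt_two y)
  have hvar : ∀ {a y : ℝ}, 0 ≤ a → a ≤ y → y ≤ X → |ψ' y - ψ' a| ≤ m y - m a := by
    intro a y
    refine abs_sub_le_sub_of_abs_deriv_le
      (f' := fun y => (p * ((p - 1) * y ^ (p - 1 - 1)) * φ 0 y + p * y ^ (p - 1) * φ 1 y) +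
        (p * y ^ (p - 1) * φ 1 y + y ^ p * φ 2 y))
      (m' := fun y => B * (p * ((p - 1) * y ^ (p - 1 - 1)) + 2 * (p * y ^ (p - 1)) +
        (p + 1) * y ^ p))
      hψc'.continuousOn hmc.continuousOn ?_ ?_ ?_
    · intro y hy
      have h1 := (Real.hasDerivAt_rpow_const (x := y) (p := p - 1) (Or.inl hy.1.ne')).const_mul p
      have h2 := Real.hasDerivAt_rpow_const (x := y) (p := p) (Or.inl hy.1.ne')
      exact (h1.mul (hφ 0 zero_lt_two y)).add (h2.mul (hφ 1 one_lt_two y))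
    · intro y hy
      have h1 := (Real.hasDerivAt_rpow_const (x := y) (p := p - 1) (Or.inl hy.1.ne')).const_mul p
      have h2 := (Real.hasDerivAt_rpow_const (x := y) (p := p) (Or.inl hy.1.ne')).const_mul 2
      have h3 := Real.hasDerivAt_rpow_const (x := y) (p := p + 1) (Or.inl hy.1.ne')
      rw [add_sub_cancel_right] at h3
      exact ((h1.add h2).add h3).const_mul B
    · intro y hy
      have hy' : y ∈ Icc 0 X := ⟨hy.1.le, hy.2.le⟩
      have b0 := hB 0 (by omega) y hy'
      have b1 := hB 1 (by omega) y hy'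
      have b2 := hB 2 le_rfl y hy'
      have q0 : 0 ≤ y ^ p := Real.rpow_nonneg hy.1.le _
      have q1 : 0 ≤ y ^ (p - 1) := Real.rpow_nonneg hy.1.le _
      have q2 : 0 ≤ y ^ (p - 1 - 1) := Real.rpow_nonneg hy.1.le _
      have hp0 : 0 ≤ p - 1 := by linarith
      have hmul : ∀ {c v : ℝ}, 0 ≤ c → |v| ≤ B → |c * v| ≤ c * B := fun hc hv => by
        rw [abs_mul, abs_of_nonneg hc]; gcongr
      have t1 := hmul (by positivity : 0 ≤ p * ((p - 1) * y ^ (p - 1 - 1))) b0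
      have t2 := hmul (by positivity : 0 ≤ p * y ^ (p - 1)) b1
      have t3 := hmul q0 b2
      have t4 : 0 ≤ p * (y ^ p * B) := by positivity
      refine (abs_add_le _ _).trans ((add_le_add (abs_add_le _ _) (abs_add_le _ _)).trans ?_)
      linarith
  have hcell : ∀ k ∈ Finset.range n, |(∫ y in (k * h)..((k + 1 : ℕ) * h), ψ y) -
      h * ((ψ (k * h) + ψ ((k + 1 : ℕ) * h)) / 2)| ≤
      2 * h ^ 2 * (m ((k + 1 : ℕ) * h) - m (k * h)) := by
    intro k hk
    have hk0 : (0 : ℝ) ≤ k * h := by positivity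
    have hkn : ((k + 1 : ℕ) : ℝ) ≤ n := by exact_mod_cast Finset.mem_range.1 hk
    have e : ((k + 1 : ℕ) : ℝ) * h = k * h + h := by push_cast; ring
    have hkX : k * h + h ≤ X := by rw [← e, hX]; gcongr
    rw [e]
    refine abs_integral_sub_trapezoid_le hh (fun y _ => hder y) fun y hy => ?_
    refine (hvar hk0 hy.1 (hy.2.trans hkX)).trans ?_
    have := (abs_nonneg _).trans (hvar (hk0.trans hy.1) hy.2 hkX)
    linarith
  have hsum := intervalIntegral.sum_integral_adjacent_intervals (f := ψ)
    (μ := MeasureTheory.volume) (a := fun k : ℕ => (k : ℝ) * h) (n := n)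
    fun k _ => hψc.intervalIntegrable _ _
  rw [Nat.cast_zero, zero_mul] at hsum
  have hψ0 : ψ ((0 : ℕ) * h) = 0 := by simp [hψ, Real.zero_rpow (by linarith : p ≠ 0)]
  have hψn : ψ (n * h) = 0 := by simp only [hψ, ← hX, hend, mul_zero]
  have htr : ∑ k ∈ Finset.range n, ψ (k * h) =
      ∑ k ∈ Finset.range n, (ψ (k * h) + ψ ((k + 1 : ℕ) * h)) / 2 := by
    have h1 := Finset.sum_range_sub (fun k : ℕ => ψ (k * h)) n
    rw [hψ0, hψn, Finset.sum_sub_distrib] at h1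
    rw [← Finset.sum_div, Finset.sum_add_distrib]
    linarith
  rw [abs_sub_comm, ← hsum, htr, Finset.mul_sum, ← Finset.sum_sub_distrib]
  refine (Finset.abs_sum_le_sum_abs _ _).trans ((Finset.sum_le_sum hcell).trans ?_)
  rw [← Finset.mul_sum, Finset.sum_range_sub fun k : ℕ => m (k * h)]
  have h0 : 0 ≤ m ((0 : ℕ) * h) := by
    have : (0 : ℝ) ≤ (0 : ℕ) * h := by simp
    simp only [hm]; positivity
  gcongr
  linarith

/-! ### Convolution with a kernel on the half line -/

/-- The convolution `∫₀ˣ k(y) φ(x - y) dy`. -/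
noncomputable def rayConv (k φ : ℝ → ℝ) (x : ℝ) : ℝ := ∫ y in (0 : ℝ)..x, k y * φ (x - y)

theorem rayConv_of_nonpos {k φ : ℝ → ℝ} (hφ0 : ∀ x ≤ 0, φ x = 0) {x : ℝ} (hx : x ≤ 0) :
    rayConv k φ x = 0 := by
  rw [rayConv, intervalIntegral.integral_congr (g := fun _ => 0)]
  · simp
  · intro y hy
    rw [uIcc_of_ge hx] at hy
    simp only
    rw [hφ0 _ (by linarith [hy.1]), mul_zero]

theorem intervalIntegrable_mul_comp_sub {k φ : ℝ → ℝ} {X : ℝ}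
    (hk : IntervalIntegrable k MeasureTheory.volume 0 X) (hφ : Continuous φ) (x : ℝ) :
    IntervalIntegrable (fun y => k y * φ (x - y)) MeasureTheory.volume 0 X :=
  hk.mul_continuousOn (by fun_prop)

/-- For `φ` vanishing on the negative axis the upper limit of the convolution is immaterial. -/
theorem rayConv_eq_integral {k φ : ℝ → ℝ} {X : ℝ}
    (hk : IntervalIntegrable k MeasureTheory.volume 0 X) (hφ : Continuous φ)
    (hφ0 : ∀ x ≤ 0, φ x = 0) (hX : 0 ≤ X) {x : ℝ} (hx : x ≤ X) :
    rayConv k φ x = ∫ y in (0 : ℝ)..X, k y * φ (x - y) := by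
  have hzero : ∀ a, x ≤ a → a ≤ X → ∫ y in a..X, k y * φ (x - y) = 0 := by
    intro a ha haX
    rw [intervalIntegral.integral_congr (g := fun _ => 0)]
    · simp
    · intro y hy
      rw [uIcc_of_le haX] at hy
      simp only
      rw [hφ0 _ (by linarith [hy.1]), mul_zero]
  rcases le_total x 0 with h0 | h0
  · rw [rayConv_of_nonpos hφ0 h0, hzero 0 h0 hX]
  · have hi := intervalIntegrable_mul_comp_sub hk hφ x
    have h1 := intervalIntegral.integral_add_adjacent_intervals
      (hi.mono_set (by rw [uIcc_of_le h0, uIcc_of_le hX]; exact Icc_subset_Icc_right hx))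
      (hi.mono_set (c := x) (d := X)
        (by rw [uIcc_of_le hx, uIcc_of_le hX]; exact Icc_subset_Icc_left h0))
    rw [← h1, hzero x le_rfl hx, add_zero, rayConv]

theorem hasDerivAt_rayConv {k φ φ' : ℝ → ℝ}
    (hk : ∀ X, IntervalIntegrable k MeasureTheory.volume 0 X) (hφ : ∀ x, HasDerivAt φ (φ' x) x)
    (hφ' : Continuous φ') (hφ0 : ∀ x ≤ 0, φ x = 0) (hφ0' : ∀ x ≤ 0, φ' x = 0) (x : ℝ) :
    HasDerivAt (rayConv k φ) (rayConv k φ' x) x := by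
  have hφc : Continuous φ := continuous_iff_continuousAt.2 fun x => (hφ x).continuousAt
  set X : ℝ := |x| + 1 with hX
  have hX0 : 0 ≤ X := by positivity
  have hxX : x ≤ X := by linarith [le_abs_self x]
  obtain ⟨C, hC⟩ := (isCompact_Icc (a := x - 1 - X) (b := x + 1)).exists_bound_of_continuousOn
    hφ'.continuousOn
  have hd : HasDerivAt (fun z => ∫ y in (0 : ℝ)..X, k y * φ (z - y))
      (∫ y in (0 : ℝ)..X, k y * φ' (x - y)) x := by
    refine (intervalIntegral.hasDerivAt_integral_of_dominated_loc_of_deriv_le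
      (F := fun z y => k y * φ (z - y)) (F' := fun z y => k y * φ' (z - y))
      (bound := fun y => |k y| * C) (Metric.ball_mem_nhds x one_pos) ?_ ?_ ?_ ?_ ?_ ?_).2
    · exact Filter.Eventually.of_forall fun z =>
        (intervalIntegrable_mul_comp_sub (hk X) hφc z).aestronglyMeasurable_restrict_uIoc
    · exact intervalIntegrable_mul_comp_sub (hk X) hφc x
    · exact (intervalIntegrable_mul_comp_sub (hk X) hφ' x).aestronglyMeasurable_restrict_uIoc
    · refine Filter.Eventually.of_forall fun y hy z hz => ?_
      rw [uIoc_of_le hX0] at hy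
      rw [Metric.mem_ball, Real.dist_eq, abs_lt] at hz
      rw [norm_mul, Real.norm_eq_abs]
      gcongr
      exact hC _ ⟨by linarith [hy.2, hz.1], by linarith [hy.1, hz.2]⟩
    · exact (hk X).abs.mul_const C
    · refine Filter.Eventually.of_forall fun y _ z _ => ?_
      exact ((hφ (z - y)).comp_sub_const z y).const_mul (k y)
  rw [rayConv_eq_integral (hk X) hφ' hφ0' hX0 hxX]
  refine hd.congr_of_eventuallyEq ?_
  filter_upwards [Iio_mem_nhds (show x < X by linarith [le_abs_self x])] with z hz
  exact rayConv_eq_integral (hk X) hφc hφ0 hX0 (le_of_lt hz)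

theorem DerivChain.rayConv {n : ℕ} {k : ℝ → ℝ} {φ : ℕ → ℝ → ℝ} (hφ : DerivChain n φ)
    (hk : ∀ X, IntervalIntegrable k MeasureTheory.volume 0 X) (hc : ∀ j ≤ n, Continuous (φ j))
    (hφ0 : ∀ j ≤ n, ∀ x ≤ 0, φ j x = 0) : DerivChain n (fun j => rayConv k (φ j)) :=
  fun j hj x => hasDerivAt_rayConv hk (hφ j hj) (hc (j + 1) hj) (hφ0 j hj.le) (hφ0 (j + 1) hj) x

theorem abs_rayConv_le {k φ : ℝ → ℝ} {X B : ℝ}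
    (hk : IntervalIntegrable k MeasureTheory.volume 0 X) (hφ : Continuous φ)
    (hφ0 : ∀ x ≤ 0, φ x = 0) (hX : 0 ≤ X) (hB : ∀ x ≤ X, |φ x| ≤ B) {x : ℝ} (hx : x ≤ X) :
    |rayConv k φ x| ≤ B * ∫ y in (0 : ℝ)..X, |k y| := by
  rw [rayConv_eq_integral hk hφ hφ0 hX hx, ← intervalIntegral.integral_const_mul]
  rw [← Real.norm_eq_abs]
  refine intervalIntegral.norm_integral_le_of_norm_le hX (Filter.Eventually.of_forall fun y hy => ?_)
    (hk.abs.const_mul B)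
  rw [norm_mul, Real.norm_eq_abs, Real.norm_eq_abs, mul_comm B]
  gcongr
  exact hB _ (by linarith [hy.1])

/-- The kernel `y^{q-1} / Γ(q)` of the Riemann--Liouville integral of order `q`. -/
noncomputable def rlKernel (q y : ℝ) : ℝ := y ^ (q - 1) / Real.Gamma q

theorem intervalIntegrable_rlKernel {q : ℝ} (hq : 0 < q) (X : ℝ) :
    IntervalIntegrable (rlKernel q) MeasureTheory.volume 0 X :=
  (intervalIntegral.intervalIntegrable_rpow' (by linarith)).div_const _

/-- Integration by parts: a fractional integral of a derivative of one order higher. -/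
theorem rayConv_rlKernel_succ {q : ℝ} (hq : 0 < q) {φ φ' : ℝ → ℝ}
    (hφ : ∀ x, HasDerivAt φ (φ' x) x) (hφ' : Continuous φ') (hφ0 : φ 0 = 0) {x : ℝ} (hx : 0 ≤ x) :
    rayConv (rlKernel (q + 1)) φ' x = rayConv (rlKernel q) φ x := by
  have hφc : Continuous φ := continuous_iff_continuousAt.2 fun x => (hφ x).continuousAt
  have hG := (Real.Gamma_pos_of_pos hq).ne'
  have hpc : Continuous fun y : ℝ => y ^ q := Real.continuous_rpow_const hq.le
  have hi1 : IntervalIntegrable (fun y => y ^ (q - 1) * φ (x - y)) MeasureTheory.volume 0 x :=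
    intervalIntegrable_mul_comp_sub
      (intervalIntegral.intervalIntegrable_rpow' (by linarith)) hφc x
  have hi2 : IntervalIntegrable (fun y => y ^ q * φ' (x - y)) MeasureTheory.volume 0 x :=
    (by fun_prop : Continuous _).intervalIntegrable _ _
  have hftc := intervalIntegral.integral_eq_sub_of_hasDerivAt_of_le hx
    (f := fun y => y ^ q * φ (x - y))
    (f' := fun y => q * (y ^ (q - 1) * φ (x - y)) - y ^ q * φ' (x - y))
    (by fun_prop)
    (fun y hy => by
      have h1 := Real.hasDerivAt_rpow_const (x := y) (p := q) (Or.inl hy.1.ne')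
      have h2 := (hφ (x - y)).comp y ((hasDerivAt_id y).const_sub x)
      refine (h1.mul h2).congr_deriv ?_
      simp only [Function.comp]
      ring)
    ((hi1.const_mul q).sub hi2)
  rw [intervalIntegral.integral_sub (hi1.const_mul q) hi2,
    intervalIntegral.integral_const_mul] at hftc
  simp only [sub_self, hφ0, mul_zero, Real.zero_rpow hq.ne', zero_mul] at hftc
  have e1 : rayConv (rlKernel (q + 1)) φ' x =
      (∫ y in (0 : ℝ)..x, y ^ q * φ' (x - y)) / Real.Gamma (q + 1) := by
    rw [rayConv, ← intervalIntegral.integral_div]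
    refine intervalIntegral.integral_congr fun y _ => ?_
    simp only [rlKernel, add_sub_cancel_right]
    ring
  have e2 : rayConv (rlKernel q) φ x =
      (∫ y in (0 : ℝ)..x, y ^ (q - 1) * φ (x - y)) / Real.Gamma q := by
    rw [rayConv, ← intervalIntegral.integral_div]
    refine intervalIntegral.integral_congr fun y _ => ?_
    simp only [rlKernel]
    ring
  rw [e1, e2, Real.Gamma_add_one hq.ne', div_eq_div_iff (mul_ne_zero hq.ne' hG) hG]
  linear_combination (-Real.Gamma q) * hftc

/-! ### The Riemann--Liouville derivatives of a smooth function -/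

theorem leftIntegral_eq_rayConv {α : ℝ} (hα : α < 2) (g : ℝ → ℝ) :
    leftIntegral α g = rayConv (rlKernel (2 - α)) g := by
  funext x
  rw [leftIntegral, if_neg hα.ne, rayConv]
  have := intervalIntegral.integral_comp_sub_left (a := 0) (b := x)
    (fun ξ => (x - ξ) ^ (1 - α) * g ξ) x
  simp only [sub_self, sub_zero, sub_sub_cancel] at this
  rw [← this, ← intervalIntegral.integral_const_mul]
  refine intervalIntegral.integral_congr fun y _ => ?_
  simp only [rlKernel, show 2 - α - 1 = 1 - α by ring]
  ring

/-- For a smooth function vanishing on the negative axis, the left Riemann--Liouville derivative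
of order `α` is the fractional integral of order `4 - α` of the fourth derivative. -/
theorem leftRL_eq_rayConv {α : ℝ} (hα : 1 < α) (hα' : α ≤ 2) {φ : ℕ → ℝ → ℝ}
    (hφ : DerivChain 4 φ) (hc : ∀ j ≤ 4, Continuous (φ j)) (hφ0 : ∀ j ≤ 4, ∀ x ≤ 0, φ j x = 0)
    {x : ℝ} (hx : 0 ≤ x) : leftRL α (φ 0) x = rayConv (rlKernel (4 - α)) (φ 4) x := by
  have e3 : rayConv (rlKernel (4 - α)) (φ 4) x = rayConv (rlKernel (3 - α)) (φ 3) x := by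
    have := rayConv_rlKernel_succ (q := 3 - α) (by linarith) (hφ 3 (by omega)) (hc 4 le_rfl)
      (hφ0 3 (by omega) 0 le_rfl) hx
    rwa [show 3 - α + 1 = 4 - α by ring] at this
  rw [e3]
  rcases hα'.lt_or_eq with h | rfl
  · have hch := (hφ.mono (show 2 ≤ 4 by omega)).rayConv
      (fun X => intervalIntegrable_rlKernel (show 0 < 2 - α by linarith) X)
      (fun j hj => hc j (by omega)) (fun j hj => hφ0 j (by omega))
    have d1 : deriv (rayConv (rlKernel (2 - α)) (φ 0)) = rayConv (rlKernel (2 - α)) (φ 1) :=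
      funext fun y => (hch 0 (by omega) y).deriv
    rw [leftRL, leftIntegral_eq_rayConv h, d1, (hch 1 (by omega) x).deriv]
    have := rayConv_rlKernel_succ (q := 2 - α) (by linarith) (hφ 2 (by omega)) (hc 3 (by omega))
      (hφ0 2 (by omega) 0 le_rfl) hx
    rw [show 2 - α + 1 = 3 - α by ring] at this
    exact this.symm
  · have d1 : deriv (φ 0) = φ 1 := funext fun y => (hφ 0 (by omega) y).deriv
    have hl : leftIntegral 2 (φ 0) = φ 0 := by simp [leftIntegral]
    rw [leftRL, hl, d1, (hφ 1 (by omega) x).deriv, rayConv]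
    have hk : ∀ y, rlKernel (3 - 2) y = 1 := fun y => by norm_num [rlKernel]
    simp only [hk, one_mul]
    have := intervalIntegral.integral_comp_sub_left (a := 0) (b := x) (φ 3) x
    rw [this, sub_self, sub_zero, intervalIntegral.integral_eq_sub_of_hasDerivAt
      (fun y _ => hφ 2 (by omega) y) ((hc 3 (by omega)).intervalIntegrable _ _),
      hφ0 2 (by omega) 0 le_rfl, sub_zero]

theorem rightIntegral_eq_leftIntegral (α b : ℝ) (g : ℝ → ℝ) :
    rightIntegral α b g = fun x => leftIntegral α (fun y => g (b - y)) (b - x) := by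
  funext x
  rw [rightIntegral, leftIntegral]
  split_ifs
  · simp
  · refine congrArg (1 / Real.Gamma (2 - α) * ·) ?_
    have := intervalIntegral.integral_comp_sub_left (a := x) (b := b)
      (fun ξ => (b - x - ξ) ^ (1 - α) * g (b - ξ)) b
    simp only [sub_self, sub_sub_cancel] at this
    rw [← this]
    refine intervalIntegral.integral_congr fun y _ => ?_
    congr 2
    ring

theorem rightRL_eq_leftRL (α b : ℝ) (g : ℝ → ℝ) (x : ℝ) :
    rightRL α b g x = leftRL α (fun y => g (b - y)) (b - x) := by
  rw [rightRL, leftRL, rightIntegral_eq_leftIntegral]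
  have h1 : (deriv fun x => leftIntegral α (fun y => g (b - y)) (b - x)) =
      fun x => -deriv (leftIntegral α fun y => g (b - y)) (b - x) :=
    funext fun x => deriv_comp_const_sub ..
  rw [h1, deriv.fun_neg, deriv_comp_const_sub, neg_neg]

/-! ### Summation by parts in space -/

/-- The second central difference of `|x|^p` with step one. -/
noncomputable def diffTwo (p x : ℝ) : ℝ := |x + 1| ^ p - 2 * |x| ^ p + |x - 1| ^ p

theorem diffFour_eq_diffTwo (p x : ℝ) :
    diffFour p x = diffTwo p (x + 1) - 2 * diffTwo p x + diffTwo p (x - 1) := by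
  simp only [diffFour, diffTwo]
  rw [show x + 1 + 1 = x + 2 by ring, show x + 1 - 1 = x by ring, show x - 1 + 1 = x by ring,
    show x - 1 - 1 = x - 2 by ring]
  ring

theorem diffTwo_nonneg {p : ℝ} (hp : 1 ≤ p) (x : ℝ) : 0 ≤ diffTwo p x := by
  have h1 : |x| ≤ (1 / 2 : ℝ) • |x + 1| + (1 / 2 : ℝ) • |x - 1| := by
    have := abs_add_le (x + 1) (x - 1)
    rw [show x + 1 + (x - 1) = 2 * x by ring, abs_mul, abs_two] at this
    simp only [smul_eq_mul]
    linarith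
  have h2 := (convexOn_rpow hp).2 (mem_Ici.2 (abs_nonneg (x + 1))) (mem_Ici.2 (abs_nonneg (x - 1)))
    (by norm_num : (0 : ℝ) ≤ 1 / 2) (by norm_num : (0 : ℝ) ≤ 1 / 2) (by norm_num)
  have h3 : |x| ^ p ≤ _ := (Real.rpow_le_rpow (abs_nonneg x) h1 (by linarith)).trans h2
  simp only [smul_eq_mul] at h3
  rw [diffTwo]
  linarith

/-- Summation by parts: the second difference is symmetric. -/
theorem tsum_second_difference_mul (f V : ℤ → ℝ) (hV : (Function.support V).Finite) :
    ∑' m, (f (m + 1) - 2 * f m + f (m - 1)) * V m =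
      ∑' m, f m * (V (m + 1) - 2 * V m + V (m - 1)) := by
  have hs : ∀ g : ℤ → ℝ, Summable fun m => g m * V m := fun g =>
    summable_of_hasFiniteSupport (hV.subset fun m hm => by
      rw [Function.mem_support] at hm ⊢
      exact right_ne_zero_of_mul hm)
  have h1 : ∑' m, f (m + 1) * V m = ∑' m, f m * V (m - 1) := by
    rw [← (Equiv.addRight (1 : ℤ)).tsum_eq fun m => f m * V (m - 1)]
    simp
  have h2 : ∑' m, f (m - 1) * V m = ∑' m, f m * V (m + 1) := by
    rw [← (Equiv.subRight (1 : ℤ)).tsum_eq fun m => f m * V (m + 1)]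
    simp
  have s1 : Summable fun m => f m * V (m - 1) := by
    rw [← (Equiv.addRight (1 : ℤ)).summable_iff]
    simpa [Function.comp_def] using hs fun m => f (m + 1)
  have s2 : Summable fun m => f m * V (m + 1) := by
    rw [← (Equiv.subRight (1 : ℤ)).summable_iff]
    simpa [Function.comp_def] using hs fun m => f (m - 1)
  have e1 : ∀ m, (f (m + 1) - 2 * f m + f (m - 1)) * V m =
      f (m + 1) * V m - 2 * (f m * V m) + f (m - 1) * V m := fun m => by ring
  have e2 : ∀ m, f m * (V (m + 1) - 2 * V m + V (m - 1)) =
      f m * V (m + 1) - 2 * (f m * V m) + f m * V (m - 1) := fun m => by ring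
  simp only [e1, e2]
  rw [(((hs fun m => f (m + 1)).sub ((hs f).mul_left 2))).tsum_add (hs fun m => f (m - 1)),
    (hs fun m => f (m + 1)).tsum_sub ((hs f).mul_left 2),
    (s2.sub ((hs f).mul_left 2)).tsum_add s1, s2.tsum_sub ((hs f).mul_left 2), h1, h2]
  ring

/-- The second difference of a sequence. -/
def seqDiffTwo (V : ℤ → ℝ) (m : ℤ) : ℝ := V (m + 1) - 2 * V m + V (m - 1)

theorem seqDiffTwo_eq_zero {V : ℤ → ℝ} {a c : ℤ} (hV : ∀ m, m ≤ a ∨ c ≤ m → V m = 0) (m : ℤ)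
    (hm : m ≤ a - 1 ∨ c + 1 ≤ m) : seqDiffTwo V m = 0 := by
  rw [seqDiffTwo, hV m (by omega), hV (m + 1) (by omega), hV (m - 1) (by omega)]
  ring

theorem finite_support_of_eq_zero {V : ℤ → ℝ} {a c : ℤ} (hV : ∀ m, m ≤ a ∨ c ≤ m → V m = 0) :
    (Function.support V).Finite :=
  (Set.finite_Icc a c).subset fun m hm => by
    rw [Function.mem_support] at hm
    by_contra h
    rw [mem_Icc] at h
    exact hm (hV m (by omega))

theorem tsum_int_eq_sum_range {F : ℤ → ℝ} {K : ℕ} (hF : ∀ m : ℤ, m < 0 ∨ K ≤ m → F m = 0) :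
    ∑' m, F m = ∑ j ∈ Finset.range K, F j := by
  rw [tsum_eq_sum (s := (Finset.range K).map Nat.castEmbedding) fun m hm => ?_, Finset.sum_map]
  · rfl
  · apply hF
    by_contra h
    push Not at h
    exact hm (Finset.mem_map.2 ⟨m.toNat, Finset.mem_range.2 (by omega), by simp; omega⟩)

theorem sum_diffFour_eq_tsum {p : ℝ} {M : ℕ} {V : ℤ → ℝ}
    (hV : ∀ m : ℤ, m ≤ 0 ∨ M ≤ m → V m = 0) (i : ℝ) :
    ∑ j ∈ Finset.Icc 1 (M - 1), diffFour p (i - j) * V j =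
      ∑' m : ℤ, diffTwo p (i - m) * seqDiffTwo V m := by
  have h1 := tsum_second_difference_mul (fun m => diffTwo p (i - m)) V (finite_support_of_eq_zero hV)
  simp only [seqDiffTwo]
  rw [← h1]
  have e : ∀ m : ℤ, diffTwo p (i - (m + 1 : ℤ)) - 2 * diffTwo p (i - m) +
      diffTwo p (i - (m - 1 : ℤ)) = diffFour p (i - m) := by
    intro m
    rw [diffFour_eq_diffTwo]
    push_cast
    rw [show i - (m + 1 : ℝ) = i - m - 1 by ring, show i - (m - 1 : ℝ) = i - m + 1 by ring]
    ring
  simp only [e]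
  rw [tsum_int_eq_sum_range (K := M) fun m hm => by rw [hV m (by omega), mul_zero]]
  simp only [Int.cast_natCast]
  refine Finset.sum_subset (fun j hj => ?_) fun j hj hj' => ?_
  · rw [Finset.mem_Icc] at hj
    exact Finset.mem_range.2 (by omega)
  · rw [Finset.mem_range] at hj
    rw [Finset.mem_Icc] at hj'
    rw [hV j (by omega), mul_zero]

theorem tsum_diffTwo_eq_tsum {p : ℝ} {M : ℕ} {V : ℤ → ℝ}
    (hV : ∀ m : ℤ, m ≤ 0 ∨ M ≤ m → V m = 0) (i : ℝ) :
    ∑' m : ℤ, diffTwo p (i - m) * seqDiffTwo V m =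
      ∑' m : ℤ, |i - m| ^ p * seqDiffTwo (seqDiffTwo V) m := by
  have h1 := tsum_second_difference_mul (fun m => |i - m| ^ p) (seqDiffTwo V)
    (finite_support_of_eq_zero (seqDiffTwo_eq_zero hV))
  change _ = ∑' m : ℤ, |i - m| ^ p *
    (seqDiffTwo V (m + 1) - 2 * seqDiffTwo V m + seqDiffTwo V (m - 1))
  rw [← h1]
  refine tsum_congr fun m => ?_
  congr 1
  rw [diffTwo]
  push_cast
  rw [show i - (m + 1 : ℝ) = i - m - 1 by ring, show i - (m - 1 : ℝ) = i - m + 1 by ring]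
  ring

/-! ### Consistency of the discrete Riesz derivative -/

/-- `φ 0, …, φ n` are successive derivatives, vanish outside `(0, b)` and are bounded by `B`. -/
structure BumpChain (n : ℕ) (b B : ℝ) (φ : ℕ → ℝ → ℝ) : Prop where
  chain : DerivChain n φ
  cont : ∀ k ≤ n, Continuous (φ k)
  zero : ∀ k ≤ n, ∀ x, x ≤ 0 ∨ b ≤ x → φ k x = 0
  bound : ∀ k ≤ n, ∀ x, |φ k x| ≤ B

theorem BumpChain.mono {m n : ℕ} {b B : ℝ} {φ : ℕ → ℝ → ℝ} (h : BumpChain n b B φ) (hmn : m ≤ n) :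
    BumpChain m b B φ :=
  ⟨h.chain.mono hmn, fun k hk => h.cont k (hk.trans hmn), fun k hk => h.zero k (hk.trans hmn),
    fun k hk => h.bound k (hk.trans hmn)⟩

theorem grid_eq_zero {b : ℝ} {M : ℕ} (hb : 0 < b) (hM : 1 ≤ M) {g : ℝ → ℝ}
    (hg : ∀ x, x ≤ 0 ∨ b ≤ x → g x = 0) (m : ℤ) (hm : m ≤ 0 ∨ (M : ℤ) ≤ m) :
    g (m * spaceStep b M) = 0 := by
  have hM0 : (0 : ℝ) < M := by exact_mod_cast hM
  apply hg
  unfold spaceStep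
  rcases hm with h | h
  · left
    have : (m : ℝ) ≤ 0 := by exact_mod_cast h
    exact mul_nonpos_of_nonpos_of_nonneg this (by positivity)
  · right
    have : (M : ℝ) ≤ m := by exact_mod_cast h
    rw [mul_div_assoc', le_div_iff₀ hM0]
    nlinarith

theorem discreteRiesz_eq_sum_diffFour {α : ℝ} (hα : α < 3) (b : ℝ) (M : ℕ) (V : ℕ → ℝ) (i : ℕ) :
    discreteRiesz α b M V i = -kappa α / (Real.Gamma (4 - α) * spaceStep b M ^ α) *
      ∑ j ∈ Finset.Icc 1 (M - 1), diffFour (3 - α) ((i : ℝ) - j) * V j := by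
  rw [discreteRiesz]
  congr 1
  exact Finset.sum_congr rfl fun j _ => by rw [wMat_eq_diffFour hα]

theorem rpow_succ_sub_rpow_le {p x : ℝ} (hp : 1 ≤ p) (hx : 0 ≤ x) :
    (x + 1) ^ p - x ^ p ≤ p * (x + 1) ^ (p - 1) := by
  have hx1 : 0 < x + 1 := by linarith
  have h1 : 1 + p * (-1 / (x + 1)) ≤ (1 + -1 / (x + 1)) ^ p := by
    refine one_add_mul_self_le_rpow_one_add ?_ hp
    rw [le_div_iff₀ hx1]; linarith
  have h2 : x ^ p = (x + 1) ^ p * (1 + -1 / (x + 1)) ^ p := by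
    rw [← Real.mul_rpow hx1.le]
    · congr 1; field_simp; ring
    · rw [show 1 + -1 / (x + 1) = x / (x + 1) by field_simp; ring]; positivity
  have h3 : 0 < (x + 1) ^ p := Real.rpow_pos_of_pos hx1 _
  rw [Real.rpow_sub_one hx1.ne', h2]
  have h4 := mul_le_mul_of_nonneg_left h1 h3.le
  have h5 : (x + 1) ^ p * (1 + p * (-1 / (x + 1))) =
      (x + 1) ^ p - p * ((x + 1) ^ p / (x + 1)) := by ring
  linarith

/-- The second differences of `|x|^p` telescope to two boundary differences. -/
theorem sum_diffTwo_le {p : ℝ} (hp : 1 ≤ p) {M i : ℕ} (hi : i ≤ M) :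
    ∑ m ∈ Finset.range (M + 1), diffTwo p ((i : ℝ) - m) ≤ 2 * (p * ((M : ℝ) + 1) ^ (p - 1)) := by
  have hi' : (i : ℝ) ≤ M := by exact_mod_cast hi
  have hi0 : (0 : ℝ) ≤ i := i.cast_nonneg
  have htel : ∀ m : ℕ, diffTwo p ((i : ℝ) - m) =
      -((|(i : ℝ) - (m + 1 : ℕ) + 1| ^ p - |(i : ℝ) - (m + 1 : ℕ)| ^ p) -
        (|(i : ℝ) - m + 1| ^ p - |(i : ℝ) - m| ^ p)) := by
    intro m
    rw [diffTwo]
    push_cast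
    rw [show (i : ℝ) - (m + 1) + 1 = i - m by ring, show (i : ℝ) - (m + 1) = i - m - 1 by ring]
    ring
  simp only [htel]
  rw [Finset.sum_neg_distrib, Finset.sum_range_sub
    fun m : ℕ => |(i : ℝ) - m + 1| ^ p - |(i : ℝ) - m| ^ p]
  have a1 := rpow_succ_sub_rpow_le hp hi0
  have a2 := rpow_succ_sub_rpow_le hp (show (0 : ℝ) ≤ M - i by linarith)
  have b1 : ((i : ℝ) + 1) ^ (p - 1) ≤ ((M : ℝ) + 1) ^ (p - 1) := by gcongr
  have b2 : ((M : ℝ) - i + 1) ^ (p - 1) ≤ ((M : ℝ) + 1) ^ (p - 1) := by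
    apply Real.rpow_le_rpow <;> linarith
  have c1 : |(i : ℝ) - (0 : ℕ) + 1| = i + 1 := by
    rw [Nat.cast_zero, sub_zero, abs_of_nonneg (by linarith)]
  have c2 : |(i : ℝ) - (0 : ℕ)| = i := by
    rw [Nat.cast_zero, sub_zero, abs_of_nonneg (by linarith)]
  have c3 : |(i : ℝ) - (M + 1 : ℕ) + 1| = M - i := by
    push_cast
    rw [show (i : ℝ) - (M + 1) + 1 = -(M - i) by ring, abs_neg, abs_of_nonneg (by linarith)]
  have c4 : |(i : ℝ) - (M + 1 : ℕ)| = M - i + 1 := by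
    push_cast
    rw [show (i : ℝ) - (M + 1) = -(M - i + 1) by ring, abs_neg, abs_of_nonneg (by linarith)]
  rw [c1, c2, c3, c4]
  have hp0 : 0 ≤ p := by linarith
  nlinarith [mul_le_mul_of_nonneg_left b1 hp0, mul_le_mul_of_nonneg_left b2 hp0]

/-- The discrete Riesz derivative is bounded by the second derivative, uniformly in the mesh: two of
the four differences are moved to the grid function, and the remaining second differences of
`|x|^{3-α}` are nonnegative with sum of order `M^{2-α}`. -/
theorem exists_abs_discreteRiesz_le {α b : ℝ} (hα : 1 < α) (hα' : α ≤ 2) (hb : 0 < b) :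
    ∃ C : ℝ, 0 ≤ C ∧ ∀ (φ : ℕ → ℝ → ℝ) (B : ℝ), BumpChain 2 b B φ → ∀ M i : ℕ,
      i ∈ Finset.Icc 1 (M - 1) →
      |discreteRiesz α b M (fun j => φ 0 (j * spaceStep b M)) i| ≤ C * B := by
  have hκ := kappa_neg hα hα'
  have hG := Real.Gamma_pos_of_pos (show 0 < 4 - α by linarith)
  refine ⟨-kappa α / Real.Gamma (4 - α) * (2 * ((3 - α) * (2 * b) ^ (2 - α))), ?_, ?_⟩
  · have : 0 ≤ -kappa α := by linarith
    have : 0 ≤ 3 - α := by linarith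
    positivity
  intro φ B hφ M i hi
  rw [Finset.mem_Icc] at hi
  have hM : 1 ≤ M := by omega
  have hM0 : (0 : ℝ) < M := by exact_mod_cast hM
  set h := spaceStep b M with hh
  have hh0 : 0 < h := by rw [hh]; unfold spaceStep; positivity
  have hMh : h * M = b := by rw [hh]; unfold spaceStep; field_simp
  have hB0 : 0 ≤ B := (abs_nonneg _).trans (hφ.bound 0 (by omega) 0)
  set V : ℤ → ℝ := fun m => φ 0 (m * h) with hVdef
  have hV : ∀ m : ℤ, m ≤ 0 ∨ (M : ℤ) ≤ m → V m = 0 :=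
    grid_eq_zero hb hM (hφ.zero 0 (by omega))
  have h1 := sum_diffFour_eq_tsum (p := 3 - α) hV i
  simp only [hVdef, Int.cast_natCast] at h1
  have hz : ∀ m : ℤ, m < 0 ∨ ((M + 1 : ℕ) : ℤ) ≤ m →
      diffTwo (3 - α) ((i : ℝ) - m) * seqDiffTwo V m = 0 := fun m hm => by
    rw [seqDiffTwo_eq_zero hV m (by omega), mul_zero]
  rw [discreteRiesz_eq_sum_diffFour (by linarith), h1, tsum_int_eq_sum_range hz, abs_mul,
    ← hh, abs_of_nonneg (rieszFactor_nonneg hα hα' hb.le M)]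
  have hδ : ∀ m : ℤ, |seqDiffTwo V m| ≤ B * h ^ 2 := by
    intro m
    have := abs_second_difference_le hφ.chain (x := m * h) hh0.le fun y _ => hφ.bound 2 le_rfl y
    rw [seqDiffTwo]
    simp only [hVdef]
    push_cast
    rwa [show ((m : ℝ) + 1) * h = m * h + h by ring, show ((m : ℝ) - 1) * h = m * h - h by ring]
  have hsum : |∑ m ∈ Finset.range (M + 1), diffTwo (3 - α) ((i : ℝ) - (m : ℤ)) * seqDiffTwo V m| ≤
      2 * ((3 - α) * ((M : ℝ) + 1) ^ (2 - α)) * (B * h ^ 2) := by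
    refine (Finset.abs_sum_le_sum_abs _ _).trans ?_
    have := sum_diffTwo_le (p := 3 - α) (by linarith) (show i ≤ M by omega)
    rw [show 3 - α - 1 = 2 - α by ring] at this
    refine le_trans ?_ (mul_le_mul_of_nonneg_right this (by positivity))
    rw [Finset.sum_mul]
    refine Finset.sum_le_sum fun m _ => ?_
    rw [abs_mul, abs_of_nonneg (diffTwo_nonneg (by linarith) _), Int.cast_natCast]
    exact mul_le_mul_of_nonneg_left (hδ m) (diffTwo_nonneg (by linarith) _)
  have hpow : ((M : ℝ) + 1) ^ (2 - α) * h ^ 2 ≤ h ^ α * (2 * b) ^ (2 - α) := by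
    have e : h ^ 2 = h ^ α * h ^ (2 - α) := by
      rw [← Real.rpow_add hh0]; norm_num
    have h2 : ((M : ℝ) + 1) * h ≤ 2 * b := by
      have : (1 : ℝ) ≤ M := by exact_mod_cast hM
      nlinarith
    calc ((M : ℝ) + 1) ^ (2 - α) * h ^ 2 = h ^ α * (((M : ℝ) + 1) * h) ^ (2 - α) := by
          rw [e, Real.mul_rpow (by positivity) hh0.le]; ring
      _ ≤ h ^ α * (2 * b) ^ (2 - α) := by gcongr
  have hhα : 0 < h ^ α := Real.rpow_pos_of_pos hh0 _
  have hκ0 : 0 ≤ -kappa α := by linarith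
  have h3α : 0 ≤ 3 - α := by linarith
  calc _ ≤ -kappa α / (Real.Gamma (4 - α) * h ^ α) *
        (2 * ((3 - α) * ((M : ℝ) + 1) ^ (2 - α)) * (B * h ^ 2)) := by gcongr
    _ = -kappa α / (Real.Gamma (4 - α) * h ^ α) *
        (2 * (3 - α) * B) * (((M : ℝ) + 1) ^ (2 - α) * h ^ 2) := by ring
    _ ≤ -kappa α / (Real.Gamma (4 - α) * h ^ α) *
        (2 * (3 - α) * B) * (h ^ α * (2 * b) ^ (2 - α)) := by gcongr
    _ = _ := by field_simp

/-- Splitting a weighted grid sum at the node `i` into its left and right halves. -/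
theorem sum_abs_rpow_mul_eq {p : ℝ} (hp : p ≠ 0) {F : ℤ → ℝ} {M i : ℕ} (hi : i ≤ M)
    (hF0 : F 0 = 0) :
    ∑ m ∈ Finset.range M, |(i : ℝ) - (m : ℕ)| ^ p * F m =
      ∑ k ∈ Finset.range i, (k : ℝ) ^ p * F (i - k) +
        ∑ k ∈ Finset.range (M - i), (k : ℝ) ^ p * F (i + k) := by
  obtain ⟨r, rfl⟩ := Nat.exists_eq_add_of_le hi
  rw [Finset.sum_range_add, Nat.add_sub_cancel_left]
  congr 1
  · have h1 := Finset.sum_range_succ (fun k : ℕ => (k : ℝ) ^ p * F (i - k)) i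
    have h2 := Finset.sum_range_succ' (fun k : ℕ => (k : ℝ) ^ p * F (i - k)) i
    simp only [sub_self, hF0, mul_zero, add_zero, Nat.cast_zero, Real.zero_rpow hp,
      zero_mul] at h1 h2
    rw [← h1, h2, ← Finset.sum_range_reflect]
    refine Finset.sum_congr rfl fun k hk => ?_
    have hk' := Finset.mem_range.1 hk
    have e : ((i - 1 - k : ℕ) : ℝ) = i - (k + 1 : ℕ) := by
      rw [Nat.sub_sub, Nat.cast_sub (by omega)]; push_cast; ring
    have e' : ((i - 1 - k : ℕ) : ℤ) = i - (k + 1 : ℕ) := by omega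
    rw [e, e', sub_sub_cancel, abs_of_nonneg (by positivity)]
  · refine Finset.sum_congr rfl fun k _ => ?_
    push_cast
    rw [show (i : ℝ) - (i + k) = -k by ring, abs_neg, abs_of_nonneg (by positivity)]

theorem riesz_eq_rayConv {α b B : ℝ} (hα : 1 < α) (hα' : α ≤ 2) {φ : ℕ → ℝ → ℝ}
    (hφ : BumpChain 4 b B φ) {x : ℝ} (hx : x ∈ Icc 0 b) :
    riesz α b (φ 0) x = -kappa α * (rayConv (rlKernel (4 - α)) (φ 4) x +
      rayConv (rlKernel (4 - α)) (fun y => φ 4 (b - y)) (b - x)) := by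
  rw [riesz, leftRL_eq_rayConv hα hα' hφ.chain hφ.cont
    (fun j hj x hx => hφ.zero j hj x (Or.inl hx)) hx.1, rightRL_eq_leftRL]
  have h := leftRL_eq_rayConv hα hα' (hφ.chain.reflect b)
    (fun j hj => by have := hφ.cont j hj; fun_prop)
    (fun j hj x hx => by rw [hφ.zero j hj _ (Or.inr (by linarith)), mul_zero])
    (x := b - x) (by linarith [hx.2])
  simp only [pow_zero, one_mul, Even.neg_pow, (by decide : Even 4), one_pow] at h
  rw [h]

/-- Second-order accuracy of the discrete Riesz derivative. All four differences are moved to the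
grid function; they are `h⁴` times its fourth derivative up to `O(h⁶)`, and what is left are
trapezoidal sums for the two fractional integrals of order `4 - α` of the fourth derivative. -/
theorem exists_abs_discreteRiesz_sub_riesz_le {α b : ℝ} (hα : 1 < α) (hα' : α ≤ 2) (hb : 0 < b) :
    ∃ C : ℝ, 0 ≤ C ∧ ∀ (φ : ℕ → ℝ → ℝ) (B : ℝ), BumpChain 6 b B φ → ∀ M i : ℕ,
      i ∈ Finset.Icc 1 (M - 1) →
      |discreteRiesz α b M (fun j => φ 0 (j * spaceStep b M)) i -
        riesz α b (φ 0) (i * spaceStep b M)| ≤ C * B * spaceStep b M ^ 2 := by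
  have hκ : 0 ≤ -kappa α := by linarith [kappa_neg hα hα']
  have hG := Real.Gamma_pos_of_pos (show 0 < 4 - α by linarith)
  set p : ℝ := 3 - α with hp
  have hp1 : 1 ≤ p := by linarith
  have hp0 : 0 < p := by linarith
  set C₁ : ℝ := 2 * (p * b ^ (p - 1) + 2 * b ^ p + b ^ (p + 1)) with hC₁
  set C₂ : ℝ := 4 * b ^ (p + 1) with hC₂
  have hC₁0 : 0 ≤ C₁ := by positivity
  have hC₂0 : 0 ≤ C₂ := by positivity
  refine ⟨-kappa α / Real.Gamma (4 - α) * (C₂ + C₁ + C₁), by positivity, ?_⟩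
  intro φ B hφ M i hi
  rw [Finset.mem_Icc] at hi
  have hM : 1 ≤ M := by omega
  have hM0 : (0 : ℝ) < M := by exact_mod_cast hM
  have hM1 : (1 : ℝ) ≤ M := by exact_mod_cast hM
  have hiM : (i : ℝ) ≤ M := by exact_mod_cast (by omega : i ≤ M)
  set h := spaceStep b M with hh
  have hh0 : 0 < h := by rw [hh]; unfold spaceStep; positivity
  have hMh : h * M = b := by rw [hh]; unfold spaceStep; field_simp
  have hB0 : 0 ≤ B := (abs_nonneg _).trans (hφ.bound 0 (by omega) 0)
  set x : ℝ := i * h with hx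
  have hx0 : 0 ≤ x := by positivity
  have hxb : x ≤ b := by rw [hx, ← hMh]; nlinarith
  have hhα : 0 < h ^ α := Real.rpow_pos_of_pos hh0 _
  set V : ℤ → ℝ := fun m => φ 0 (m * h) with hVdef
  set F : ℤ → ℝ := fun m => φ 4 (m * h) with hFdef
  have hV : ∀ m : ℤ, m ≤ 0 ∨ (M : ℤ) ≤ m → V m = 0 :=
    grid_eq_zero hb hM (hφ.zero 0 (by omega))
  have hF : ∀ m : ℤ, m ≤ 0 ∨ (M : ℤ) ≤ m → F m = 0 :=
    grid_eq_zero hb hM (hφ.zero 4 (by omega))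
  -- the discrete operator as a weighted sum of fourth differences
  have h1 : ∑ j ∈ Finset.Icc 1 (M - 1), diffFour p ((i : ℝ) - j) * V j =
      ∑' m : ℤ, |(i : ℝ) - m| ^ p * seqDiffTwo (seqDiffTwo V) m := by
    rw [sum_diffFour_eq_tsum hV, tsum_diffTwo_eq_tsum hV]
  set s : Finset ℤ := Finset.Icc (-1) (M + 1) with hs
  have hzV : ∀ m ∉ s, |(i : ℝ) - m| ^ p * seqDiffTwo (seqDiffTwo V) m = 0 := by
    intro m hm
    rw [hs, Finset.mem_Icc] at hm
    rw [seqDiffTwo_eq_zero (seqDiffTwo_eq_zero hV) m (by omega), mul_zero]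
  have hzF : ∀ m ∉ s, |(i : ℝ) - m| ^ p * F m = 0 := by
    intro m hm
    rw [hs, Finset.mem_Icc] at hm
    rw [hF m (by omega), mul_zero]
  have hδ : ∀ m : ℤ, |seqDiffTwo (seqDiffTwo V) m - h ^ 4 * F m| ≤ B * h ^ 6 := by
    intro m
    have := abs_fourth_difference_sub_le hφ.chain (x := m * h) hh0.le (hφ.bound 6 le_rfl)
    convert this using 2
    simp only [seqDiffTwo, hVdef, hFdef]
    push_cast
    rw [show ((m : ℝ) + 1 + 1) * h = m * h + 2 * h by ring,
      show ((m : ℝ) + 1 - 1) * h = m * h by ring, show ((m : ℝ) + 1) * h = m * h + h by ring,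
      show ((m : ℝ) - 1 + 1) * h = m * h by ring, show ((m : ℝ) - 1) * h = m * h - h by ring,
      show ((m : ℝ) - 1 - 1) * h = m * h - 2 * h by ring]
    ring
  have hdiff : |∑ j ∈ Finset.Icc 1 (M - 1), diffFour p ((i : ℝ) - j) * V j -
      h ^ 4 * ∑' m : ℤ, |(i : ℝ) - m| ^ p * F m| ≤ h ^ α * (C₂ * B * h ^ 2) := by
    rw [h1, tsum_eq_sum hzV, tsum_eq_sum hzF, Finset.mul_sum, ← Finset.sum_sub_distrib]
    have hterm : ∀ m ∈ s, |(|(i : ℝ) - m| ^ p * seqDiffTwo (seqDiffTwo V) m -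
        h ^ 4 * (|(i : ℝ) - m| ^ p * F m))| ≤ (M : ℝ) ^ p * (B * h ^ 6) := by
      intro m hm
      rw [hs, Finset.mem_Icc] at hm
      have m1 : (-1 : ℝ) ≤ m := by exact_mod_cast hm.1
      have m2 : (m : ℝ) ≤ M + 1 := by exact_mod_cast hm.2
      have i1 : (1 : ℝ) ≤ i := by exact_mod_cast hi.1
      have i2 : (i : ℝ) + 1 ≤ M := by exact_mod_cast (by omega : i + 1 ≤ M)
      have hle : |(i : ℝ) - m| ≤ M := abs_le.2 ⟨by linarith, by linarith⟩
      have e : |(i : ℝ) - m| ^ p * seqDiffTwo (seqDiffTwo V) m -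
          h ^ 4 * (|(i : ℝ) - m| ^ p * F m) =
          |(i : ℝ) - m| ^ p * (seqDiffTwo (seqDiffTwo V) m - h ^ 4 * F m) := by ring
      rw [e, abs_mul, abs_of_nonneg (by positivity)]
      exact mul_le_mul (by gcongr) (hδ m) (abs_nonneg _) (by positivity)
    refine (Finset.abs_sum_le_sum_abs _ _).trans ((Finset.sum_le_sum hterm).trans ?_)
    rw [Finset.sum_const, nsmul_eq_mul]
    have hcard : (s.card : ℝ) ≤ 4 * M := by
      have : s.card = M + 3 := by rw [hs, Int.card_Icc]; omega
      rw [this]; push_cast; linarith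
    have e1 : h ^ 6 = h ^ α * (h ^ (p + 1) * h ^ 2) := by
      rw [← mul_assoc, ← Real.rpow_add hh0, hp, show α + (3 - α + 1) = (4 : ℕ) by push_cast; ring,
        Real.rpow_natCast]
      ring
    have e2 : (M : ℝ) * M ^ p * h ^ (p + 1) = b ^ (p + 1) := by
      rw [← hMh, Real.mul_rpow hh0.le hM0.le, Real.rpow_add hM0, Real.rpow_one]; ring
    calc (s.card : ℝ) * ((M : ℝ) ^ p * (B * h ^ 6)) ≤ 4 * M * ((M : ℝ) ^ p * (B * h ^ 6)) := by
          gcongr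
      _ = h ^ α * (4 * ((M : ℝ) * M ^ p * h ^ (p + 1)) * B * h ^ 2) := by rw [e1]; ring
      _ = _ := by rw [e2, hC₂]
  -- the two halves of the weighted sum are trapezoidal sums
  have hsplit : ∑' m : ℤ, |(i : ℝ) - m| ^ p * F m =
      ∑ k ∈ Finset.range i, (k : ℝ) ^ p * F (i - k) +
        ∑ k ∈ Finset.range (M - i), (k : ℝ) ^ p * F (i + k) := by
    rw [← sum_abs_rpow_mul_eq hp0.ne' (by omega : i ≤ M) (hF 0 (by omega)),
      tsum_int_eq_sum_range (K := M) fun m hm => by rw [hF m (by omega), mul_zero]]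
    simp
  have hpow : ∀ k : ℕ, h ^ 4 * (k : ℝ) ^ p = h ^ α * (h * (k * h) ^ p) := by
    intro k
    rw [Real.mul_rpow k.cast_nonneg hh0.le]
    have : h ^ 4 = h ^ α * (h ^ (1 : ℝ) * h ^ p) := by
      rw [← Real.rpow_add hh0, ← Real.rpow_add hh0, hp,
        show α + (1 + (3 - α)) = (4 : ℕ) by push_cast; ring, Real.rpow_natCast]
    rw [this, Real.rpow_one]; ring
  have hchain4 : DerivChain 2 (fun k => φ (4 + k)) := hφ.chain.shift (m := 4)
  have hmono : ∀ {X : ℝ}, 0 ≤ X → X ≤ b →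
      2 * h ^ 2 * (B * (p * X ^ (p - 1) + 2 * X ^ p + X ^ (p + 1))) ≤ C₁ * B * h ^ 2 := by
    intro X hX hXb
    have hp1' : 0 ≤ p - 1 := by linarith
    calc _ ≤ 2 * h ^ 2 * (B * (p * b ^ (p - 1) + 2 * b ^ p + b ^ (p + 1))) := by gcongr
      _ = _ := by rw [hC₁]; ring
  have hleft := abs_trapezoidal_rule_le hp1 hh0.le (hchain4.reflect x) i (B := B)
    (fun k hk y _ => by
      rw [abs_mul, abs_pow, abs_neg, abs_one, one_pow, one_mul]
      exact hφ.bound _ (by omega) _)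
    (by simp only [pow_zero, one_mul, add_zero, ← hx, sub_self]
        exact hφ.zero 4 (by omega) 0 (Or.inl le_rfl))
  have hMi : ((M - i : ℕ) : ℝ) * h = b - x := by
    rw [Nat.cast_sub (by omega), sub_mul, hx, ← hMh]; ring
  have hright := abs_trapezoidal_rule_le hp1 hh0.le
    (φ := fun k y => φ (4 + k) (x + y)) (fun k hk y => (hchain4 k hk (x + y)).comp_const_add x y)
    (M - i) (B := B) (fun k hk y _ => hφ.bound _ (by omega) _)
    (by rw [hMi, show x + (b - x) = b by ring]; exact hφ.zero 4 (by omega) b (Or.inr le_rfl))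
  rw [← hx] at hleft
  rw [hMi] at hright
  have hleft' := hleft.trans (hmono hx0 hxb)
  have hright' := hright.trans (hmono (by linarith) (by linarith))
  simp only [pow_zero, one_mul, add_zero] at hleft' hright'
  have hS1 : h ^ 4 * ∑ k ∈ Finset.range i, (k : ℝ) ^ p * F (i - k) =
      h ^ α * (h * ∑ k ∈ Finset.range i, (k * h) ^ p * φ 4 (x - k * h)) := by
    rw [Finset.mul_sum, Finset.mul_sum, Finset.mul_sum]
    refine Finset.sum_congr rfl fun k _ => ?_
    have : F (i - k) = φ 4 (x - k * h) := by
      simp only [hFdef, hx]; push_cast; rw [sub_mul]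
    rw [this, ← mul_assoc, hpow]; ring
  have hS2 : h ^ 4 * ∑ k ∈ Finset.range (M - i), (k : ℝ) ^ p * F (i + k) =
      h ^ α * (h * ∑ k ∈ Finset.range (M - i), (k * h) ^ p * φ 4 (x + k * h)) := by
    rw [Finset.mul_sum, Finset.mul_sum, Finset.mul_sum]
    refine Finset.sum_congr rfl fun k _ => ?_
    have : F (i + k) = φ 4 (x + k * h) := by
      simp only [hFdef, hx]; push_cast; rw [add_mul]
    rw [this, ← mul_assoc, hpow]; ring
  rw [hsplit, mul_add, hS1, hS2] at hdiff
  -- the Riesz derivative as the corresponding integrals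
  have hker : ∀ y, rlKernel (4 - α) y = y ^ p / Real.Gamma (4 - α) := by
    intro y; rw [rlKernel, show 4 - α - 1 = p by rw [hp]; ring]
  have hR := riesz_eq_rayConv hα hα' (hφ.mono (by omega : 4 ≤ 6)) (x := x) ⟨hx0, hxb⟩
  have hI1 : rayConv (rlKernel (4 - α)) (φ 4) x =
      (∫ y in (0 : ℝ)..x, y ^ p * φ 4 (x - y)) / Real.Gamma (4 - α) := by
    rw [rayConv, ← intervalIntegral.integral_div]
    exact intervalIntegral.integral_congr fun y _ => by simp only [hker]; ring
  have hI2 : rayConv (rlKernel (4 - α)) (fun y => φ 4 (b - y)) (b - x) =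
      (∫ y in (0 : ℝ)..b - x, y ^ p * φ 4 (x + y)) / Real.Gamma (4 - α) := by
    rw [rayConv, ← intervalIntegral.integral_div]
    refine intervalIntegral.integral_congr fun y _ => ?_
    simp only [hker]
    rw [show b - (b - x - y) = x + y by ring]; ring
  set S : ℝ := ∑ j ∈ Finset.Icc 1 (M - 1), diffFour p ((i : ℝ) - j) * V j with hSdef
  set A₁ := h * ∑ k ∈ Finset.range i, (k * h) ^ p * φ 4 (x - k * h)
  set A₂ := h * ∑ k ∈ Finset.range (M - i), (k * h) ^ p * φ 4 (x + k * h)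
  set J₁ := ∫ y in (0 : ℝ)..x, y ^ p * φ 4 (x - y)
  set J₂ := ∫ y in (0 : ℝ)..b - x, y ^ p * φ 4 (x + y)
  have hd' : |S / h ^ α - (A₁ + A₂)| ≤ C₂ * B * h ^ 2 := by
    have e : S / h ^ α - (A₁ + A₂) = (S - (h ^ α * A₁ + h ^ α * A₂)) / h ^ α := by
      field_simp
    rw [e, abs_div, abs_of_pos hhα, div_le_iff₀ hhα]
    linarith
  have hdr : discreteRiesz α b M (fun j => φ 0 (j * h)) i =
      -kappa α / Real.Gamma (4 - α) * (S / h ^ α) := by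
    have hS' : S = ∑ j ∈ Finset.Icc 1 (M - 1), diffFour p ((i : ℝ) - j) * φ 0 (j * h) := by
      simp only [hSdef, hVdef, Int.cast_natCast]
    rw [discreteRiesz_eq_sum_diffFour (by linarith), ← hh, ← hp, ← hS']
    field_simp
  have efin : discreteRiesz α b M (fun j => φ 0 (j * h)) i - riesz α b (φ 0) x =
      -kappa α / Real.Gamma (4 - α) * ((S / h ^ α - (A₁ + A₂)) + (A₁ - J₁) + (A₂ - J₂)) := by
    rw [hdr, hR, hI1, hI2]; ring
  have hK : 0 ≤ -kappa α / Real.Gamma (4 - α) := by positivity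
  rw [efin, abs_mul, abs_of_nonneg hK]
  calc _ ≤ -kappa α / Real.Gamma (4 - α) * (C₂ * B * h ^ 2 + C₁ * B * h ^ 2 + C₁ * B * h ^ 2) := by
        gcongr
        exact (abs_add_le _ _).trans (add_le_add ((abs_add_le _ _).trans
          (add_le_add hd' hleft')) hright')
    _ = _ := by ring

/-! ### Second-order expansion of the Grünwald--Letnikov sum -/

/-- `G 0, …, G n` are successive derivatives, vanish for nonpositive times and are bounded by `B`
up to time `T`. -/
structure CausalChain (n : ℕ) (T B : ℝ) (G : ℕ → ℝ → ℝ) : Prop where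
  chain : DerivChain n G
  cont : ∀ k ≤ n, Continuous (G k)
  zero : ∀ k ≤ n, ∀ x ≤ 0, G k x = 0
  bound : ∀ k ≤ n, ∀ x ≤ T, |G k x| ≤ B

/-- Abel summation against the coefficients of `(1 - z)^{1 - s}`. -/
theorem sum_gCoeff_mul_eq (s : ℝ) (a : ℕ → ℝ) (N : ℕ) :
    ∑ m ∈ Finset.range (N + 1), gCoeff (s - 1) m * a m =
      ∑ m ∈ Finset.range (N + 1), gCoeff s m * (a m - a (m + 1)) + gCoeff s N * a (N + 1) := by
  induction N with
  | zero => simp [gCoeff_zero]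
  | succ N ih =>
    rw [Finset.sum_range_succ, ih, Finset.sum_range_succ _ (N + 1), ← gCoeff_sub_gCoeff]
    ring

/-- Two Abel summations; the boundary terms vanish with `a`. -/
theorem sum_gCoeff_mul_eq_second_difference (β : ℝ) (a : ℕ → ℝ) (n : ℕ)
    (ha : ∀ m, n ≤ m → a m = 0) :
    ∑ m ∈ Finset.range n, gCoeff β m * a m =
      ∑ m ∈ Finset.range n, gCoeff (β + 2) m * (a m - 2 * a (m + 1) + a (m + 2)) := by
  cases n with
  | zero => simp
  | succ N =>
    have h1 := sum_gCoeff_mul_eq (β + 1) a N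
    have h2 := sum_gCoeff_mul_eq (β + 2) (fun m => a m - a (m + 1)) N
    rw [show β + 1 - 1 = β by ring, ha (N + 1) le_rfl, mul_zero, add_zero] at h1
    rw [show β + 2 - 1 = β + 1 by ring] at h2
    simp only [ha (N + 1) le_rfl, ha (N + 1 + 1) (by omega), sub_zero, mul_zero, add_zero] at h2
    rw [h1, h2]
    exact Finset.sum_congr rfl fun m _ => by ring

theorem sum_rpow_sub_one_le {β : ℝ} (hβ : 0 < β) (hβ' : β ≤ 1) (n : ℕ) :
    ∑ m ∈ Finset.range n, ((m : ℝ) + 1) ^ (β - 1) ≤ (n : ℝ) ^ β / β := by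
  induction n with
  | zero => simp [Real.zero_rpow hβ.ne']
  | succ n ih =>
    rw [Finset.sum_range_succ]
    have hn : (0 : ℝ) < n + 1 := by positivity
    have h1 : (1 + -1 / ((n : ℝ) + 1)) ^ β ≤ 1 + β * (-1 / ((n : ℝ) + 1)) := by
      refine rpow_one_add_le_one_add_mul_self ?_ hβ.le hβ'
      rw [le_div_iff₀ hn]; linarith [n.cast_nonneg (α := ℝ)]
    have h2 : (n : ℝ) ^ β = ((n : ℝ) + 1) ^ β * (1 + -1 / ((n : ℝ) + 1)) ^ β := by
      have e : 1 + -1 / ((n : ℝ) + 1) = n / (n + 1) := by field_simp; ring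
      rw [e, ← Real.mul_rpow hn.le (by positivity)]
      congr 1; field_simp
    have h3 : 0 < ((n : ℝ) + 1) ^ β := Real.rpow_pos_of_pos hn _
    have h4 := mul_le_mul_of_nonneg_left h1 h3.le
    rw [← h2] at h4
    rw [Real.rpow_sub_one hn.ne']
    push_cast
    have h5 : (n : ℝ) ^ β / β ≤ (((n : ℝ) + 1) ^ β * (1 + β * (-1 / ((n : ℝ) + 1)))) / β := by
      gcongr
    have h6 : (((n : ℝ) + 1) ^ β * (1 + β * (-1 / ((n : ℝ) + 1)))) / β =
        ((n : ℝ) + 1) ^ β / β - ((n : ℝ) + 1) ^ β / (n + 1) := by field_simp; ring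
    linarith

theorem exists_gCoeff_le {β : ℝ} (hβ : 0 < β) (hβ' : β ≤ 1) :
    ∃ K : ℝ, 0 ≤ K ∧ ∀ k : ℕ, gCoeff (β + 2) k ≤ K * ((k : ℝ) + 1) ^ (β + 1) := by
  obtain ⟨C, hC, h⟩ := exists_gCoeff_asymptotics hβ hβ'
  have hG := Real.Gamma_pos_of_pos (show 0 < β + 2 by linarith)
  have hG1 := Real.Gamma_pos_of_pos (show 0 < β + 1 by linarith)
  refine ⟨1 / Real.Gamma (β + 2) + β / 2 / Real.Gamma (β + 1) + C, by positivity, fun k => ?_⟩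
  have hk : (1 : ℝ) ≤ (k : ℝ) + 1 := by linarith [k.cast_nonneg (α := ℝ)]
  have h1 : ((k : ℝ) + 1) ^ β ≤ ((k : ℝ) + 1) ^ (β + 1) :=
    Real.rpow_le_rpow_of_exponent_le hk (by linarith)
  have h2 : ((k : ℝ) + 1) ^ (β - 1) ≤ ((k : ℝ) + 1) ^ (β + 1) :=
    Real.rpow_le_rpow_of_exponent_le hk (by linarith)
  have h3 := (abs_le.1 (h k)).2
  calc gCoeff (β + 2) k ≤ ((k : ℝ) + 1) ^ (β + 1) / Real.Gamma (β + 2) +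
        β / 2 * ((k : ℝ) + 1) ^ β / Real.Gamma (β + 1) + C * ((k : ℝ) + 1) ^ (β - 1) := by linarith
    _ ≤ ((k : ℝ) + 1) ^ (β + 1) / Real.Gamma (β + 2) +
        β / 2 * ((k : ℝ) + 1) ^ (β + 1) / Real.Gamma (β + 1) +
        C * ((k : ℝ) + 1) ^ (β + 1) := by gcongr
    _ = _ := by ring

/-- The Grünwald--Letnikov sum agrees with `I^β G + (β τ / 2) I^β G'` to second order. -/
theorem exists_abs_grunwald_sub_le {β T : ℝ} (hβ : 0 < β) (hβ' : β ≤ 1) (hT : 0 ≤ T) :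
    ∃ C : ℝ, 0 ≤ C ∧ ∀ (G : ℕ → ℝ → ℝ) (B : ℝ), CausalChain 4 T B G → ∀ (τ : ℝ) (n : ℕ),
      0 < τ → n * τ ≤ T →
      |τ ^ β * ∑ m ∈ Finset.range n, gCoeff β m * G 0 (n * τ - m * τ) -
        (rayConv (rlKernel β) (G 0) (n * τ) +
          β / 2 * τ * rayConv (rlKernel β) (G 1) (n * τ))| ≤ C * B * τ ^ 2 := by
  obtain ⟨C, hC, hasy⟩ := exists_gCoeff_asymptotics hβ hβ'
  obtain ⟨K, hK, hq⟩ := exists_gCoeff_le hβ hβ'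
  have hG2 := Real.Gamma_pos_of_pos (show 0 < β + 2 by linarith)
  have hG1 := Real.Gamma_pos_of_pos (show 0 < β + 1 by linarith)
  set D₁ : ℝ := 2 * ((β + 1) * T ^ (β + 1 - 1) + 2 * T ^ (β + 1) + T ^ (β + 1 + 1))
  set D₂ : ℝ := T ^ β + T ^ (β + 1)
  refine ⟨K * T ^ (β + 2) + C * (T ^ β / β) + D₁ / Real.Gamma (β + 2) +
    β / 2 * D₂ / Real.Gamma (β + 1), by positivity, ?_⟩
  intro G B hG τ n hτ hnT
  set t : ℝ := n * τ with ht
  have ht0 : 0 ≤ t := by positivity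
  have hB0 : 0 ≤ B := (abs_nonneg _).trans (hG.bound 0 (by omega) 0 hT)
  have hn0 : (0 : ℝ) ≤ n := n.cast_nonneg
  have hτβ : 0 < τ ^ β := Real.rpow_pos_of_pos hτ _
  have hτ2 : τ ^ (β + 2) = τ ^ β * τ ^ 2 := by rw [Real.rpow_add hτ]; norm_num
  have harg : ∀ m : ℕ, m < n → t - (m + 1 : ℕ) * τ ≤ T := fun m _ => by
    have : (0 : ℝ) ≤ (m + 1 : ℕ) * τ := by positivity
    linarith
  -- two Abel summations
  have hS := sum_gCoeff_mul_eq_second_difference β (fun m => G 0 (t - m * τ)) n fun m hm => by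
    refine hG.zero 0 (by omega) _ ?_
    have : (n : ℝ) ≤ m := by exact_mod_cast hm
    rw [ht]; nlinarith
  set q : ℕ → ℝ := gCoeff (β + 2) with hqdef
  have hq0 : ∀ m, 0 ≤ q m := fun m => (gCoeff_pos (by linarith) m).le
  have hE1 : |τ ^ β * ∑ m ∈ Finset.range n, gCoeff β m * G 0 (t - m * τ) -
      τ ^ (β + 2) * ∑ m ∈ Finset.range n, q m * G 2 (t - (m + 1 : ℕ) * τ)| ≤
      K * T ^ (β + 2) * B * τ ^ 2 := by
    rw [hS, hτ2, mul_assoc, ← mul_sub, Finset.mul_sum, ← Finset.sum_sub_distrib, abs_mul,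
      abs_of_pos hτβ]
    have hterm : ∀ m ∈ Finset.range n,
        |q m * (G 0 (t - m * τ) - 2 * G 0 (t - (m + 1 : ℕ) * τ) + G 0 (t - (m + 2 : ℕ) * τ)) -
          τ ^ 2 * (q m * G 2 (t - (m + 1 : ℕ) * τ))| ≤ K * (n : ℝ) ^ (β + 1) * (B * τ ^ 4) := by
      intro m hm
      have hmn := Finset.mem_range.1 hm
      have hx := abs_second_difference_sub_le hG.chain (x := t - (m + 1 : ℕ) * τ) (h := τ) (B := B)
        hτ.le fun y hy => by
          refine hG.bound 4 le_rfl y (hy.2.trans ?_)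
          push_cast
          have : (0 : ℝ) ≤ m * τ := by positivity
          linarith
      rw [show t - (m + 1 : ℕ) * τ + τ = t - m * τ by push_cast; ring,
        show t - (m + 1 : ℕ) * τ - τ = t - (m + 2 : ℕ) * τ by push_cast; ring] at hx
      have e : q m * (G 0 (t - m * τ) - 2 * G 0 (t - (m + 1 : ℕ) * τ) +
          G 0 (t - (m + 2 : ℕ) * τ)) - τ ^ 2 * (q m * G 2 (t - (m + 1 : ℕ) * τ)) =
          q m * (G 0 (t - m * τ) - 2 * G 0 (t - (m + 1 : ℕ) * τ) +
          G 0 (t - (m + 2 : ℕ) * τ) - τ ^ 2 * G 2 (t - (m + 1 : ℕ) * τ)) := by ring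
      rw [e, abs_mul, abs_of_nonneg (hq0 m)]
      refine mul_le_mul ((hq m).trans ?_) hx (abs_nonneg _) (by positivity)
      have : (m : ℝ) + 1 ≤ n := by exact_mod_cast hmn
      gcongr
    calc _ ≤ τ ^ β * (n * (K * (n : ℝ) ^ (β + 1) * (B * τ ^ 4))) := by
          gcongr
          refine (Finset.abs_sum_le_sum_abs _ _).trans ((Finset.sum_le_sum hterm).trans ?_)
          simp
      _ = K * (n * (n : ℝ) ^ (β + 1) * (τ ^ β * τ ^ 2)) * B * τ ^ 2 := by ring
      _ = K * t ^ (β + 2) * B * τ ^ 2 := by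
          have hn2 : (n : ℝ) ^ (β + 2) = n * (n : ℝ) ^ (β + 1) := by
            rw [show β + 2 = β + 1 + 1 by ring, Real.rpow_add_one' hn0 (by linarith), mul_comm]
          rw [← hτ2, ht, Real.mul_rpow hn0 hτ.le, hn2]
      _ ≤ _ := by gcongr
  -- replacing the coefficients by their asymptotic expansion
  set w : ℕ → ℝ := fun k => (k : ℝ) ^ (β + 1) / Real.Gamma (β + 2) +
    β / 2 * (k : ℝ) ^ β / Real.Gamma (β + 1) with hw
  have hE2 : |τ ^ (β + 2) * ∑ m ∈ Finset.range n, q m * G 2 (t - (m + 1 : ℕ) * τ) -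
      τ ^ (β + 2) * ∑ m ∈ Finset.range n, w (m + 1) * G 2 (t - (m + 1 : ℕ) * τ)| ≤
      C * (T ^ β / β) * B * τ ^ 2 := by
    rw [← mul_sub, ← Finset.sum_sub_distrib, abs_mul, abs_of_nonneg (by positivity)]
    have hterm : ∀ m ∈ Finset.range n, |q m * G 2 (t - (m + 1 : ℕ) * τ) -
        w (m + 1) * G 2 (t - (m + 1 : ℕ) * τ)| ≤ C * ((m : ℝ) + 1) ^ (β - 1) * B := by
      intro m hm
      rw [← sub_mul, abs_mul]
      have h1 := hasy m
      refine mul_le_mul ?_ (hG.bound 2 (by omega) _ (harg m (Finset.mem_range.1 hm)))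
        (abs_nonneg _) (by positivity)
      simp only [hw]
      push_cast
      exact h1
    have hsum := sum_rpow_sub_one_le hβ hβ' n
    calc _ ≤ τ ^ (β + 2) * (C * ((n : ℝ) ^ β / β) * B) := by
          gcongr
          refine (Finset.abs_sum_le_sum_abs _ _).trans ((Finset.sum_le_sum hterm).trans ?_)
          rw [← Finset.sum_mul, ← Finset.mul_sum]
          gcongr
      _ = C * (t ^ β / β) * B * τ ^ 2 := by
          rw [hτ2, ht, Real.mul_rpow hn0 hτ.le]; ring
      _ ≤ _ := by gcongr
  -- the remaining sums are quadrature sums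
  have hshift : ∀ f : ℕ → ℝ, f 0 = 0 → f n = 0 →
      ∑ m ∈ Finset.range n, f (m + 1) = ∑ k ∈ Finset.range n, f k := by
    intro f h0 hn
    have h1 := Finset.sum_range_succ' f n
    rw [Finset.sum_range_succ, h0, hn] at h1
    linarith
  have hw0 : w 0 = 0 := by
    simp [hw, Real.zero_rpow hβ.ne', Real.zero_rpow (by linarith : β + 1 ≠ 0)]
  have hsum : τ ^ (β + 2) * ∑ m ∈ Finset.range n, w (m + 1) * G 2 (t - (m + 1 : ℕ) * τ) =
      (τ * ∑ k ∈ Finset.range n, (k * τ) ^ (β + 1) * G 2 (t - k * τ)) / Real.Gamma (β + 2) +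
      β / 2 * τ * ((τ * ∑ k ∈ Finset.range n, (k * τ) ^ β * G 2 (t - k * τ)) /
        Real.Gamma (β + 1)) := by
    rw [hshift (fun k => w k * G 2 (t - k * τ)) (by simp [hw0])
      (by rw [← ht, sub_self, hG.zero 2 (by omega) 0 le_rfl, mul_zero])]
    simp only [Finset.mul_sum, Finset.sum_div]
    rw [← Finset.sum_add_distrib]
    refine Finset.sum_congr rfl fun k _ => ?_
    simp only [hw]
    rw [Real.mul_rpow k.cast_nonneg hτ.le, Real.mul_rpow k.cast_nonneg hτ.le, hτ2,
      Real.rpow_add_one hτ.ne']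
    ring
  have hch : DerivChain 2 (fun k => G (2 + k)) := hG.chain.shift (m := 2)
  have hQ2 := abs_trapezoidal_rule_le (p := β + 1) (by linarith) hτ.le (hch.reflect t) n (B := B)
    (fun k hk y hy => by
      rw [abs_mul, abs_pow, abs_neg, abs_one, one_pow, one_mul]
      exact hG.bound _ (by omega) _ (by linarith [hy.1]))
    (by simp only [pow_zero, one_mul, add_zero, ← ht, sub_self]
        exact hG.zero 2 (by omega) 0 le_rfl)
  have hQ1 := abs_rectangle_rule_le hβ hτ.le ((hch.mono one_le_two).reflect t) n (B := B)
    (fun k hk y hy => by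
      rw [abs_mul, abs_pow, abs_neg, abs_one, one_pow, one_mul]
      exact hG.bound _ (by omega) _ (by linarith [hy.1]))
  simp only [pow_zero, one_mul, add_zero, ← ht] at hQ1 hQ2
  have hQ2' : _ ≤ D₁ * B * τ ^ 2 := hQ2.trans (by
    calc _ ≤ 2 * τ ^ 2 * (B * ((β + 1) * T ^ (β + 1 - 1) + 2 * T ^ (β + 1) + T ^ (β + 1 + 1))) := by
          have : 0 ≤ β + 1 - 1 := by linarith
          gcongr
      _ = _ := by ring)
  have hQ1' : _ ≤ D₂ * B * τ := hQ1.trans (by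
    calc _ ≤ τ * (B * (T ^ β + T ^ (β + 1))) := by gcongr
      _ = _ := by ring)
  have hc1 := hG.cont 1 (by omega)
  have hc2 := hG.cont 2 (by omega)
  have hI2 : rayConv (rlKernel β) (G 0) t =
      (∫ y in (0 : ℝ)..t, y ^ (β + 1) * G 2 (t - y)) / Real.Gamma (β + 2) := by
    rw [← rayConv_rlKernel_succ hβ (hG.chain 0 (by omega)) hc1 (hG.zero 0 (by omega) 0 le_rfl) ht0,
      ← rayConv_rlKernel_succ (by linarith) (hG.chain 1 (by omega)) hc2
        (hG.zero 1 (by omega) 0 le_rfl) ht0, rayConv, ← intervalIntegral.integral_div]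
    refine intervalIntegral.integral_congr fun y _ => ?_
    simp only [rlKernel, show β + 1 + 1 = β + 2 by ring, show β + 2 - 1 = β + 1 by ring]
    ring
  have hI1 : rayConv (rlKernel β) (G 1) t =
      (∫ y in (0 : ℝ)..t, y ^ β * G 2 (t - y)) / Real.Gamma (β + 1) := by
    rw [← rayConv_rlKernel_succ hβ (hG.chain 1 (by omega)) hc2
        (hG.zero 1 (by omega) 0 le_rfl) ht0, rayConv, ← intervalIntegral.integral_div]
    refine intervalIntegral.integral_congr fun y _ => ?_
    simp only [rlKernel, add_sub_cancel_right]
    ring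
  rw [hI1, hI2]
  rw [hsum] at hE2
  set S₀ := τ ^ β * ∑ m ∈ Finset.range n, gCoeff β m * G 0 (t - m * τ)
  set S₁ := τ ^ (β + 2) * ∑ m ∈ Finset.range n, q m * G 2 (t - (m + 1 : ℕ) * τ)
  set A₂ := τ * ∑ k ∈ Finset.range n, (k * τ) ^ (β + 1) * G 2 (t - k * τ)
  set A₁ := τ * ∑ k ∈ Finset.range n, (k * τ) ^ β * G 2 (t - k * τ)
  set J₂ := ∫ y in (0 : ℝ)..t, y ^ (β + 1) * G 2 (t - y)
  set J₁ := ∫ y in (0 : ℝ)..t, y ^ β * G 2 (t - y)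
  have e : S₀ - (J₂ / Real.Gamma (β + 2) + β / 2 * τ * (J₁ / Real.Gamma (β + 1))) =
      (S₀ - S₁) + (S₁ - (A₂ / Real.Gamma (β + 2) + β / 2 * τ * (A₁ / Real.Gamma (β + 1)))) +
      (A₂ - J₂) / Real.Gamma (β + 2) + β / 2 * τ * ((A₁ - J₁) / Real.Gamma (β + 1)) := by ring
  have b2 : |(A₂ - J₂) / Real.Gamma (β + 2)| ≤ D₁ * B * τ ^ 2 / Real.Gamma (β + 2) := by
    rw [abs_div, abs_of_pos hG2]; gcongr
  have b1 : |β / 2 * τ * ((A₁ - J₁) / Real.Gamma (β + 1))| ≤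
      β / 2 * τ * (D₂ * B * τ / Real.Gamma (β + 1)) := by
    rw [abs_mul, abs_of_nonneg (by positivity : 0 ≤ β / 2 * τ), abs_div, abs_of_pos hG1]; gcongr
  rw [e]
  refine (abs_add_le _ _).trans ((add_le_add ((abs_add_le _ _).trans (add_le_add
    ((abs_add_le _ _).trans (add_le_add hE1 hE2)) b2)) b1).trans (le_of_eq ?_))
  ring

/-! ### Second-order convolution quadrature -/

theorem sum_range_sum_range_eq (F : ℕ → ℕ → ℝ) (n : ℕ) :
    ∑ k ∈ Finset.range n, ∑ m ∈ Finset.range (k + 1), F m (k - m) =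
      ∑ m ∈ Finset.range n, ∑ j ∈ Finset.range (n - m), F m j := by
  induction n with
  | zero => simp
  | succ n ih =>
    rw [Finset.sum_range_succ, ih]
    have h : ∀ m ∈ Finset.range (n + 1), ∑ j ∈ Finset.range (n + 1 - m), F m j =
        ∑ j ∈ Finset.range (n - m), F m j + F m (n - m) := by
      intro m hm
      rw [show n + 1 - m = n - m + 1 by have := Finset.mem_range.1 hm; omega,
        Finset.sum_range_succ]
    have h' : ∑ m ∈ Finset.range (n + 1), ∑ j ∈ Finset.range (n - m), F m j =
        ∑ m ∈ Finset.range n, ∑ j ∈ Finset.range (n - m), F m j := by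
      rw [Finset.sum_range_succ]; simp
    rw [Finset.sum_congr rfl h, Finset.sum_add_distrib, h']

/-- The coefficients of the smoothing filter `(3/2 - z/2)^{-β}`, which turns the
Grünwald--Letnikov weights into those of the second-order backward difference formula. -/
noncomputable def filterCoeff (β : ℝ) (m : ℕ) : ℝ :=
  (3 / 2 : ℝ) ^ (-β) * (((3 : ℝ) ^ m)⁻¹ * gCoeff β m)

theorem filterCoeff_nonneg {β : ℝ} (hβ : 0 < β) (m : ℕ) : 0 ≤ filterCoeff β m :=
  mul_nonneg (by positivity) (mul_nonneg (by positivity) (gCoeff_pos hβ m).le)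

theorem hasSum_filterCoeff (β : ℝ) : HasSum (filterCoeff β) 1 := by
  have h := (hasSum_gCoeff_mul_pow_real β (x := 1 / 3) (by norm_num [abs_of_pos])).mul_left
    ((3 / 2 : ℝ) ^ (-β))
  have e : (3 / 2 : ℝ) ^ (-β) * (1 - 1 / 3) ^ (-β) = 1 := by
    rw [← Real.mul_rpow (by norm_num) (by norm_num)]; norm_num
  rw [e] at h
  refine h.congr_fun fun m => ?_
  rw [filterCoeff, one_div, inv_pow]; ring

/-- The filter has mean `β / 2`, which cancels the first-order term of the Grünwald--Letnikov sum. -/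
theorem hasSum_mul_filterCoeff (β : ℝ) :
    HasSum (fun m : ℕ => (m : ℝ) * filterCoeff β m) (β / 2) := by
  have h := (hasSum_gCoeff_mul_pow_real (β + 1) (x := 1 / 3) (by norm_num [abs_of_pos])).mul_left
    ((3 / 2 : ℝ) ^ (-β) * (β / 3))
  have e : (3 / 2 : ℝ) ^ (-β) * (β / 3) * (1 - 1 / 3) ^ (-(β + 1)) = β / 2 := by
    have h1 : (1 - 1 / 3 : ℝ) ^ (-(β + 1)) = (1 - 1 / 3) ^ (-β) * (3 / 2) := by
      rw [show -(β + 1) = -β + -1 by ring, Real.rpow_add (by norm_num), Real.rpow_neg_one]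
      norm_num
    have h2 : (3 / 2 : ℝ) ^ (-β) * (1 - 1 / 3) ^ (-β) = 1 := by
      rw [← Real.mul_rpow (by norm_num) (by norm_num)]; norm_num
    rw [h1]
    linear_combination (β / 2) * h2
  rw [e] at h
  rw [← hasSum_nat_add_iff' 1]
  simp only [Finset.range_one, Finset.sum_singleton, Nat.cast_zero, zero_mul, sub_zero]
  refine h.congr_fun fun m => ?_
  have := succ_mul_gCoeff_succ β m
  rw [filterCoeff, one_div, inv_pow, pow_succ, mul_inv]
  push_cast
  linear_combination ((3 / 2 : ℝ) ^ (-β) * ((3 : ℝ) ^ m)⁻¹ * 3⁻¹) * this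

theorem summable_sq_mul_filterCoeff {β : ℝ} (hβ : 0 < β) (hβ' : β ≤ 1) :
    Summable fun m : ℕ => (m : ℝ) ^ 2 * filterCoeff β m := by
  have h := (summable_pow_mul_geometric_of_norm_lt_one 2
    (show ‖(1 / 3 : ℝ)‖ < 1 by norm_num)).mul_left ((3 / 2 : ℝ) ^ (-β))
  refine Summable.of_nonneg_of_le (fun m => mul_nonneg (by positivity) (filterCoeff_nonneg hβ m))
    (fun m => ?_) h
  have hg := gCoeff_le_one hβ hβ' m
  calc (m : ℝ) ^ 2 * filterCoeff β m =
        (3 / 2 : ℝ) ^ (-β) * ((m : ℝ) ^ 2 * (1 / 3) ^ m) * gCoeff β m := by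
        rw [filterCoeff, one_div, inv_pow]; ring
    _ ≤ (3 / 2 : ℝ) ^ (-β) * ((m : ℝ) ^ 2 * (1 / 3) ^ m) * 1 := by gcongr
    _ = _ := mul_one _

/-- The backward difference quadrature is the filtered Grünwald--Letnikov sum. -/
theorem sum_bdfCoeff_mul_eq {β τ : ℝ} (g : ℝ → ℝ) (n : ℕ) :
    (3 / 2 : ℝ) ^ (-β) * ∑ k ∈ Finset.range n, bdfCoeff β k * g (n * τ - k * τ) =
      ∑ m ∈ Finset.range n, filterCoeff β m *
        ∑ j ∈ Finset.range (n - m), gCoeff β j * g ((n - m : ℕ) * τ - j * τ) := by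
  have h := sum_range_sum_range_eq
    (fun m j => ((3 : ℝ) ^ m)⁻¹ * gCoeff β m * gCoeff β j * g (n * τ - (m + j : ℕ) * τ)) n
  have e1 : ∑ k ∈ Finset.range n, bdfCoeff β k * g (n * τ - k * τ) =
      ∑ k ∈ Finset.range n, ∑ m ∈ Finset.range (k + 1), ((3 : ℝ) ^ m)⁻¹ * gCoeff β m *
        gCoeff β (k - m) * g (n * τ - (m + (k - m) : ℕ) * τ) := by
    refine Finset.sum_congr rfl fun k _ => ?_
    rw [bdfCoeff, Finset.sum_mul]
    refine Finset.sum_congr rfl fun m hm => ?_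
    rw [Nat.add_sub_cancel' (Nat.lt_succ_iff.1 (Finset.mem_range.1 hm))]
  rw [e1, h, Finset.mul_sum]
  refine Finset.sum_congr rfl fun m hm => ?_
  rw [Finset.mul_sum, Finset.mul_sum]
  refine Finset.sum_congr rfl fun j _ => ?_
  rw [filterCoeff, Nat.cast_sub (Finset.mem_range.1 hm).le]
  push_cast
  rw [show (n : ℝ) * τ - (m + j) * τ = (n - m) * τ - j * τ by ring]
  ring

/-- Second-order accuracy of the untempered convolution quadrature at the grid points. -/
theorem exists_abs_bdf_sub_le {β T : ℝ} (hβ : 0 < β) (hβ' : β ≤ 1) (hT : 0 ≤ T) :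
    ∃ C : ℝ, 0 ≤ C ∧ ∀ (G : ℕ → ℝ → ℝ) (B : ℝ), CausalChain 4 T B G → ∀ (τ : ℝ) (n : ℕ),
      0 < τ → n * τ ≤ T →
      |τ ^ β * ((3 / 2 : ℝ) ^ (-β) *
          ∑ k ∈ Finset.range n, bdfCoeff β k * G 0 (n * τ - k * τ)) -
        rayConv (rlKernel β) (G 0) (n * τ)| ≤ C * B * τ ^ 2 := by
  obtain ⟨C, hC, hgl⟩ := exists_abs_grunwald_sub_le hβ hβ' hT
  set K : ℝ := ∫ y in (0 : ℝ)..T, |rlKernel β y|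
  have hK : 0 ≤ K := intervalIntegral.integral_nonneg hT fun y _ => abs_nonneg _
  set M₂ : ℝ := ∑' m : ℕ, (m : ℝ) ^ 2 * filterCoeff β m
  have hM₂ : 0 ≤ M₂ := tsum_nonneg fun m => mul_nonneg (by positivity) (filterCoeff_nonneg hβ m)
  refine ⟨K * M₂ + β / 2 * (K * (β / 2)) + C, by positivity, ?_⟩
  intro G B hG τ n hτ hnT
  have hB0 : 0 ≤ B := (abs_nonneg _).trans (hG.bound 0 (by omega) 0 hT)
  set t : ℝ := n * τ with ht
  have hker := fun X => intervalIntegrable_rlKernel hβ X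
  set Φ : ℕ → ℝ → ℝ := fun j => rayConv (rlKernel β) (G j) with hΦ
  have hΦc : DerivChain 2 Φ := (hG.chain.mono (by omega)).rayConv hker
    (fun j hj => hG.cont j (by omega)) (fun j hj => hG.zero j (by omega))
  have hΦb : ∀ j ≤ 4, ∀ x ≤ T, |Φ j x| ≤ B * K := fun j hj x hx =>
    abs_rayConv_le (hker T) (hG.cont j hj) (hG.zero j hj) hT (hG.bound j hj) hx
  have hΦ0 : ∀ j ≤ 4, ∀ x ≤ 0, Φ j x = 0 := fun j hj x hx => rayConv_of_nonpos (hG.zero j hj) hx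
  have hzero : ∀ j ≤ 4, ∀ m ∉ Finset.range n, filterCoeff β m * Φ j (t - m * τ) = 0 := by
    intro j hj m hm
    have hm' : (n : ℝ) ≤ m := by exact_mod_cast not_lt.1 fun h => hm (Finset.mem_range.2 h)
    rw [hΦ0 j hj _ (by rw [ht]; nlinarith), mul_zero]
  have hsum0 : HasSum (fun m : ℕ => filterCoeff β m * Φ 0 (t - m * τ)) _ :=
    hasSum_sum_of_ne_finset_zero (hzero 0 (by omega))
  have hsum1 : HasSum (fun m : ℕ => filterCoeff β m * Φ 1 (t - m * τ)) _ :=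
    hasSum_sum_of_ne_finset_zero (hzero 1 (by omega))
  have hf1 := hasSum_filterCoeff β
  have hfm := hasSum_mul_filterCoeff β
  have hmτ : ∀ m : ℕ, 0 ≤ (m : ℝ) * τ := fun m => by positivity
  -- the filter applied to `Φ 0`
  have hc0 : |∑ m ∈ Finset.range n, filterCoeff β m * Φ 0 (t - m * τ) -
      (Φ 0 t - β / 2 * τ * Φ 1 t)| ≤ B * K * τ ^ 2 * M₂ := by
    have h := (hsum0.sub (hf1.mul_right (Φ 0 t))).add (hfm.mul_right (τ * Φ 1 t))
    have hb := (summable_sq_mul_filterCoeff hβ hβ').hasSum.mul_left (B * K * τ ^ 2)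
    have hterm : ∀ m : ℕ, ‖filterCoeff β m * Φ 0 (t - m * τ) - filterCoeff β m * Φ 0 t +
        m * filterCoeff β m * (τ * Φ 1 t)‖ ≤ B * K * τ ^ 2 * ((m : ℝ) ^ 2 * filterCoeff β m) := by
      intro m
      have ht2 := abs_sub_taylor_neg_le hΦc (x := t) (hmτ m) (B := B * K)
        fun y hy => hΦb 2 (by omega) y (hy.2.trans hnT)
      simp only [Finset.sum_range_succ, Finset.sum_range_zero, Nat.factorial] at ht2
      norm_num at ht2
      have e : filterCoeff β m * Φ 0 (t - m * τ) - filterCoeff β m * Φ 0 t +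
          m * filterCoeff β m * (τ * Φ 1 t) =
          filterCoeff β m * (Φ 0 (t - m * τ) - (Φ 0 t + -(Φ 1 t * (m * τ)))) := by ring
      have hf := filterCoeff_nonneg hβ m
      rw [e, Real.norm_eq_abs, abs_mul, abs_of_nonneg hf]
      calc _ ≤ filterCoeff β m * (B * K * ((m * τ) ^ 2 / 2)) := by gcongr
        _ ≤ filterCoeff β m * (B * K * (m * τ) ^ 2) := by
            gcongr; linarith [sq_nonneg ((m : ℝ) * τ)]
        _ = _ := by ring
    have := tsum_of_norm_bounded hb hterm
    rw [h.tsum_eq, Real.norm_eq_abs] at this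
    convert this using 2
    ring
  -- the filter applied to `Φ 1`
  have hc1 : |∑ m ∈ Finset.range n, filterCoeff β m * Φ 1 (t - m * τ) - Φ 1 t| ≤
      B * K * τ * (β / 2) := by
    have h := hsum1.sub (hf1.mul_right (Φ 1 t))
    have hb := hfm.mul_left (B * K * τ)
    have hterm : ∀ m : ℕ, ‖filterCoeff β m * Φ 1 (t - m * τ) - filterCoeff β m * Φ 1 t‖ ≤
        B * K * τ * (m * filterCoeff β m) := by
      intro m
      have hch : DerivChain 1 (fun k => Φ (1 + k)) := hΦc.shift (m := 1)
      have ht2 := abs_sub_taylor_neg_le hch (x := t) (hmτ m) (B := B * K)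
        fun y hy => hΦb 2 (by omega) y (hy.2.trans hnT)
      simp only [Finset.sum_range_succ, Finset.sum_range_zero, Nat.factorial] at ht2
      norm_num at ht2
      have hf := filterCoeff_nonneg hβ m
      rw [← mul_sub, Real.norm_eq_abs, abs_mul, abs_of_nonneg hf]
      calc _ ≤ filterCoeff β m * (B * K * (m * τ)) := by gcongr
        _ = _ := by ring
    have := tsum_of_norm_bounded hb hterm
    rwa [h.tsum_eq, Real.norm_eq_abs, one_mul] at this
  have he : |∑ m ∈ Finset.range n, filterCoeff β m * (τ ^ β *
      ∑ j ∈ Finset.range (n - m), gCoeff β j * G 0 ((n - m : ℕ) * τ - j * τ) -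
      (Φ 0 (t - m * τ) + β / 2 * τ * Φ 1 (t - m * τ)))| ≤ C * B * τ ^ 2 := by
    refine (Finset.abs_sum_le_sum_abs _ _).trans ?_
    have hterm : ∀ m ∈ Finset.range n, |filterCoeff β m * (τ ^ β *
        ∑ j ∈ Finset.range (n - m), gCoeff β j * G 0 ((n - m : ℕ) * τ - j * τ) -
        (Φ 0 (t - m * τ) + β / 2 * τ * Φ 1 (t - m * τ)))| ≤
        filterCoeff β m * (C * B * τ ^ 2) := by
      intro m hm
      have hmn := (Finset.mem_range.1 hm).le
      have e : ((n - m : ℕ) : ℝ) * τ = t - m * τ := by rw [Nat.cast_sub hmn, ht]; ring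
      have := hgl G B hG τ (n - m) hτ (by rw [e]; linarith [hmτ m])
      rw [abs_mul, abs_of_nonneg (filterCoeff_nonneg hβ m)]
      refine mul_le_mul_of_nonneg_left ?_ (filterCoeff_nonneg hβ m)
      rw [← e]
      exact this
    refine (Finset.sum_le_sum hterm).trans ?_
    rw [← Finset.sum_mul]
    refine mul_le_of_le_one_left (by positivity) ?_
    exact sum_le_hasSum _ (fun m _ => filterCoeff_nonneg hβ m) hf1
  rw [sum_bdfCoeff_mul_eq]
  have e : τ ^ β * ∑ m ∈ Finset.range n, filterCoeff β m *
      ∑ j ∈ Finset.range (n - m), gCoeff β j * G 0 ((n - m : ℕ) * τ - j * τ) - Φ 0 t =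
      (∑ m ∈ Finset.range n, filterCoeff β m * Φ 0 (t - m * τ) - (Φ 0 t - β / 2 * τ * Φ 1 t)) +
      β / 2 * τ * (∑ m ∈ Finset.range n, filterCoeff β m * Φ 1 (t - m * τ) - Φ 1 t) +
      ∑ m ∈ Finset.range n, filterCoeff β m * (τ ^ β *
        ∑ j ∈ Finset.range (n - m), gCoeff β j * G 0 ((n - m : ℕ) * τ - j * τ) -
        (Φ 0 (t - m * τ) + β / 2 * τ * Φ 1 (t - m * τ))) := by
    simp only [mul_sub, mul_add, Finset.sum_sub_distrib, Finset.sum_add_distrib, Finset.mul_sum]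
    have a1 : ∀ m, filterCoeff β m * (β / 2 * τ * Φ 1 (t - m * τ)) =
        β / 2 * τ * (filterCoeff β m * Φ 1 (t - m * τ)) := fun m => by ring
    have a2 : ∀ m j, filterCoeff β m * (τ ^ β * (gCoeff β j * G 0 ((n - m : ℕ) * τ - j * τ))) =
        τ ^ β * (filterCoeff β m * (gCoeff β j * G 0 ((n - m : ℕ) * τ - j * τ))) :=
      fun m j => by ring
    simp only [a1, a2]
    ring
  have b1 : |β / 2 * τ * (∑ m ∈ Finset.range n, filterCoeff β m * Φ 1 (t - m * τ) - Φ 1 t)| ≤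
      β / 2 * τ * (B * K * τ * (β / 2)) := by
    rw [abs_mul, abs_of_nonneg (by positivity : 0 ≤ β / 2 * τ)]; gcongr
  change |_ - Φ 0 t| ≤ _
  rw [e]
  refine (abs_add_le _ _).trans ((add_le_add ((abs_add_le _ _).trans
    (add_le_add hc0 b1)) he).trans (le_of_eq ?_))
  ring

/-! ### Tempered convolution quadrature at the half steps -/

/-- The kernel `y^{β-1} e^{-λ y} / Γ(β)` of the tempered fractional integral. -/
noncomputable def temperedKernel (β lam y : ℝ) : ℝ := rlKernel β y * Real.exp (-lam * y)

theorem intervalIntegrable_temperedKernel {β : ℝ} (hβ : 0 < β) (lam X : ℝ) :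
    IntervalIntegrable (temperedKernel β lam) MeasureTheory.volume 0 X :=
  (intervalIntegrable_rlKernel hβ X).mul_continuousOn (by fun_prop)

/-- Tempering is conjugation by `e^{λ t}`. -/
theorem rayConv_temperedKernel (β lam : ℝ) {g g' : ℝ → ℝ}
    (h : ∀ s, g' s = Real.exp (lam * s) * g s) (t : ℝ) :
    rayConv (temperedKernel β lam) g t = Real.exp (-lam * t) * rayConv (rlKernel β) g' t := by
  rw [rayConv, rayConv, ← intervalIntegral.integral_const_mul]
  refine intervalIntegral.integral_congr fun y _ => ?_
  simp only [temperedKernel]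
  rw [h, show -lam * y = -lam * t + lam * (t - y) by ring, Real.exp_add]
  ring

/-- Second-order accuracy of the tempered quadrature at the half steps. The factor `e^{λ t}` reduces
both grid values to the untempered rule applied to `G'`, and their average differs from the midpoint
value of the smooth function `t ↦ I^{β,λ} G` by `O(τ²)`. -/
theorem exists_abs_tempered_sub_le {β lam T : ℝ} (hβ : 0 < β) (hβ' : β ≤ 1) (hlam : 0 ≤ lam)
    (hT : 0 ≤ T) :
    ∃ C : ℝ, 0 ≤ C ∧ ∀ (G G' : ℕ → ℝ → ℝ) (B : ℝ), CausalChain 2 T B G → CausalChain 4 T B G' →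
      (∀ s, G' 0 s = Real.exp (lam * s) * G 0 s) → ∀ (τ : ℝ) (n : ℕ),
      0 < τ → ((n : ℝ) + 1) * τ ≤ T →
      |τ ^ β / 2 * ∑ k ∈ Finset.range (n + 1), lWeight β lam τ k *
          (G 0 ((n + 1 - k : ℕ) * τ) + G 0 ((n - k : ℕ) * τ)) -
        rayConv (temperedKernel β lam) (G 0) (((n : ℝ) + 1 / 2) * τ)| ≤ C * B * τ ^ 2 := by
  obtain ⟨C, hC, hbdf⟩ := exists_abs_bdf_sub_le hβ hβ' hT
  set K : ℝ := ∫ y in (0 : ℝ)..T, |temperedKernel β lam y|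
  have hK : 0 ≤ K := intervalIntegral.integral_nonneg hT fun y _ => abs_nonneg _
  refine ⟨C + K, by positivity, ?_⟩
  intro G G' B hG hG' hGG' τ n hτ hnT
  have hB0 : 0 ≤ B := (abs_nonneg _).trans (hG.bound 0 (by omega) 0 hT)
  have hker := fun X => intervalIntegrable_temperedKernel hβ lam X
  set H : ℕ → ℝ → ℝ := fun j => rayConv (temperedKernel β lam) (G j) with hH
  have hHc : DerivChain 2 H := hG.chain.rayConv hker hG.cont hG.zero
  have hHb : ∀ x ≤ T, |H 2 x| ≤ B * K := fun x hx =>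
    abs_rayConv_le (hker T) (hG.cont 2 le_rfl) (hG.zero 2 le_rfl) hT (hG.bound 2 le_rfl) hx
  have hgrid : ∀ j : ℕ, j * τ ≤ T →
      |τ ^ β * ∑ k ∈ Finset.range j, lWeight β lam τ k * G 0 (j * τ - k * τ) - H 0 (j * τ)| ≤
        C * B * τ ^ 2 := by
    intro j hj
    have h1 := hbdf G' B hG' τ j hτ hj
    have e1 : τ ^ β * ∑ k ∈ Finset.range j, lWeight β lam τ k * G 0 (j * τ - k * τ) =
        Real.exp (-lam * (j * τ)) * (τ ^ β * ((3 / 2 : ℝ) ^ (-β) *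
          ∑ k ∈ Finset.range j, bdfCoeff β k * G' 0 (j * τ - k * τ))) := by
      simp only [Finset.mul_sum]
      refine Finset.sum_congr rfl fun k _ => ?_
      rw [lWeight_eq, hGG', ← Real.exp_nat_mul]
      have : Real.exp (k * (-lam * τ)) =
          Real.exp (-lam * (j * τ)) * Real.exp (lam * (j * τ - k * τ)) := by
        rw [← Real.exp_add]; congr 1; ring
      rw [this]
      ring
    have e2 : H 0 (j * τ) = Real.exp (-lam * (j * τ)) * rayConv (rlKernel β) (G' 0) (j * τ) :=
      rayConv_temperedKernel β lam hGG' _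
    rw [e1, e2, ← mul_sub, abs_mul, abs_of_pos (Real.exp_pos _)]
    refine (mul_le_of_le_one_left (abs_nonneg _) (Real.exp_le_one_iff.2 ?_)).trans h1
    have : 0 ≤ lam * (j * τ) := by positivity
    linarith
  have hA1 := hgrid (n + 1) (by push_cast; exact hnT)
  have hA0 := hgrid n (by nlinarith)
  have hsum : τ ^ β / 2 * ∑ k ∈ Finset.range (n + 1), lWeight β lam τ k *
      (G 0 ((n + 1 - k : ℕ) * τ) + G 0 ((n - k : ℕ) * τ)) =
      (τ ^ β * ∑ k ∈ Finset.range (n + 1), lWeight β lam τ k * G 0 ((n + 1 : ℕ) * τ - k * τ) +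
        τ ^ β * ∑ k ∈ Finset.range n, lWeight β lam τ k * G 0 (n * τ - k * τ)) / 2 := by
    have h0 : ∑ k ∈ Finset.range n, lWeight β lam τ k * G 0 (n * τ - k * τ) =
        ∑ k ∈ Finset.range (n + 1), lWeight β lam τ k * G 0 (n * τ - k * τ) := by
      rw [Finset.sum_range_succ, sub_self, hG.zero 0 (by omega) 0 le_rfl, mul_zero, add_zero]
    rw [h0, ← mul_add, ← Finset.sum_add_distrib, div_mul_eq_mul_div]
    congr 2
    refine Finset.sum_congr rfl fun k hk => ?_
    have hk' : k ≤ n := Nat.lt_succ_iff.1 (Finset.mem_range.1 hk)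
    rw [Nat.cast_sub (by omega : k ≤ n + 1), Nat.cast_sub hk', sub_mul, sub_mul, mul_add]
  -- the average at the endpoints of the step against the value at the midpoint
  have hmid := abs_second_difference_le hHc (x := ((n : ℝ) + 1 / 2) * τ) (h := τ / 2) (B := B * K)
    (by positivity) fun y hy => hHb y (hy.2.trans (by linarith))
  rw [show ((n : ℝ) + 1 / 2) * τ + τ / 2 = (n + 1 : ℕ) * τ by push_cast; ring,
    show ((n : ℝ) + 1 / 2) * τ - τ / 2 = n * τ by ring] at hmid
  rw [hsum]
  have hBK : 0 ≤ B * K * τ ^ 2 := by positivity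
  have ee : B * K * (τ / 2) ^ 2 = B * K * τ ^ 2 / 4 := by ring
  rw [ee] at hmid
  change |_ - H 0 _| ≤ _
  rw [abs_le] at *
  constructor <;> linarith [hA1.1, hA1.2, hA0.1, hA0.2, hmid.1, hmid.2]

/-! ### Smooth functions of space and time -/

/-- The partial derivative in space. -/
noncomputable def dX (v : ℝ × ℝ → ℝ) (p : ℝ × ℝ) : ℝ := fderiv ℝ v p (1, 0)

/-- The partial derivative in time. -/
noncomputable def dT (v : ℝ × ℝ → ℝ) (p : ℝ × ℝ) : ℝ := fderiv ℝ v p (0, 1)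

/-- `v` is of class `C^n` and vanishes for `x ∉ (0, b)` and for `t ≤ 0`. -/
structure ZeroExtended (n : ℕ) (b : ℝ) (v : ℝ × ℝ → ℝ) : Prop where
  smooth : ContDiff ℝ n v
  zero : ∀ x t, x ≤ 0 ∨ b ≤ x ∨ t ≤ 0 → v (x, t) = 0

theorem ZeroExtended.mono {m n : ℕ} {b : ℝ} {v : ℝ × ℝ → ℝ} (h : ZeroExtended n b v)
    (hmn : m ≤ n) : ZeroExtended m b v :=
  ⟨h.smooth.of_le (by exact_mod_cast hmn), h.zero⟩

/-- On the closed zero region the derivative vanishes by continuity from the interior. -/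
theorem ZeroExtended.fderiv_eq_zero {n : ℕ} {b : ℝ} {v : ℝ × ℝ → ℝ}
    (h : ZeroExtended (n + 1) b v) {x t : ℝ} (hxt : x ≤ 0 ∨ b ≤ x ∨ t ≤ 0) :
    fderiv ℝ v (x, t) = 0 := by
  have hc : Continuous (fderiv ℝ v) := h.smooth.continuous_fderiv (by simp)
  have key : ∀ U : Set (ℝ × ℝ), IsOpen U → (∀ p ∈ U, v p = 0) → ∀ p ∈ closure U,
      fderiv ℝ v p = 0 := by
    intro U hU hv
    refine fun q hq => closure_minimal (s := U) (t := fderiv ℝ v ⁻¹' {0}) (fun p hp => ?_)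
      (isClosed_singleton.preimage hc) hq
    have he : v =ᶠ[nhds p] fun _ => 0 := Filter.eventually_of_mem (hU.mem_nhds hp) hv
    rw [mem_preimage, mem_singleton_iff, he.fderiv_eq, fderiv_fun_const]
    rfl
  rcases hxt with hx | hx | ht
  · refine key (Iio 0 ×ˢ univ) (isOpen_Iio.prod isOpen_univ)
      (fun p hp => h.zero p.1 p.2 (Or.inl (le_of_lt hp.1))) _ ?_
    rw [closure_prod_eq, closure_Iio]
    exact ⟨hx, by simp⟩
  · refine key (Ioi b ×ˢ univ) (isOpen_Ioi.prod isOpen_univ)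
      (fun p hp => h.zero p.1 p.2 (Or.inr (Or.inl (le_of_lt hp.1)))) _ ?_
    rw [closure_prod_eq, closure_Ioi]
    exact ⟨hx, by simp⟩
  · refine key (univ ×ˢ Iio 0) (isOpen_univ.prod isOpen_Iio)
      (fun p hp => h.zero p.1 p.2 (Or.inr (Or.inr (le_of_lt hp.2)))) _ ?_
    rw [closure_prod_eq, closure_Iio]
    exact ⟨by simp, ht⟩

theorem ZeroExtended.dX {n : ℕ} {b : ℝ} {v : ℝ × ℝ → ℝ} (h : ZeroExtended (n + 1) b v) :
    ZeroExtended n b (dX v) := by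
  refine ⟨?_, fun x t hxt => ?_⟩
  · exact (h.smooth.fderiv_right (m := n) (by norm_cast)).clm_apply contDiff_const
  · rw [TemperedWave.dX, h.fderiv_eq_zero hxt]; rfl

theorem ZeroExtended.dT {n : ℕ} {b : ℝ} {v : ℝ × ℝ → ℝ} (h : ZeroExtended (n + 1) b v) :
    ZeroExtended n b (dT v) := by
  refine ⟨?_, fun x t hxt => ?_⟩
  · exact (h.smooth.fderiv_right (m := n) (by norm_cast)).clm_apply contDiff_const
  · rw [TemperedWave.dT, h.fderiv_eq_zero hxt]; rfl

theorem ZeroExtended.iterate_dX {n k : ℕ} {b : ℝ} {v : ℝ × ℝ → ℝ} (h : ZeroExtended (n + k) b v) :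
    ZeroExtended n b (TemperedWave.dX^[k] v) := by
  induction k generalizing v with
  | zero => exact h
  | succ k ih => exact ih h.dX

theorem ZeroExtended.iterate_dT {n k : ℕ} {b : ℝ} {v : ℝ × ℝ → ℝ} (h : ZeroExtended (n + k) b v) :
    ZeroExtended n b (TemperedWave.dT^[k] v) := by
  induction k generalizing v with
  | zero => exact h
  | succ k ih => exact ih h.dT

theorem ZeroExtended.hasDerivAt_dX {n : ℕ} {b : ℝ} {v : ℝ × ℝ → ℝ}
    (h : ZeroExtended (n + 1) b v) (x t : ℝ) :
    HasDerivAt (fun y => v (y, t)) (TemperedWave.dX v (x, t)) x := by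
  have h1 : HasFDerivAt v (fderiv ℝ v (x, t)) (x, t) :=
    ((h.smooth.differentiable (by simp)) (x, t)).hasFDerivAt
  exact h1.comp_hasDerivAt x ((hasDerivAt_id x).prodMk (hasDerivAt_const x t))

theorem ZeroExtended.hasDerivAt_dT {n : ℕ} {b : ℝ} {v : ℝ × ℝ → ℝ}
    (h : ZeroExtended (n + 1) b v) (x t : ℝ) :
    HasDerivAt (fun s => v (x, s)) (TemperedWave.dT v (x, t)) t := by
  have h1 : HasFDerivAt v (fderiv ℝ v (x, t)) (x, t) :=
    ((h.smooth.differentiable (by simp)) (x, t)).hasFDerivAt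
  exact h1.comp_hasDerivAt t ((hasDerivAt_const t x).prodMk (hasDerivAt_id t))

theorem ZeroExtended.exists_bound {n : ℕ} {b : ℝ} {v : ℝ × ℝ → ℝ} (h : ZeroExtended n b v)
    (T : ℝ) : ∃ B : ℝ, 0 ≤ B ∧ ∀ x, ∀ t ≤ T, |v (x, t)| ≤ B := by
  obtain ⟨B, hB⟩ := ((isCompact_Icc (a := (0 : ℝ)) (b := b)).prod
    (isCompact_Icc (a := (0 : ℝ)) (b := T))).exists_bound_of_continuousOn
    h.smooth.continuous.continuousOn
  refine ⟨max B 0, le_max_right _ _, fun x t ht => ?_⟩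
  by_cases hxt : x ≤ 0 ∨ b ≤ x ∨ t ≤ 0
  · rw [h.zero x t hxt, abs_zero]; exact le_max_right _ _
  · push Not at hxt
    exact (hB (x, t) ⟨⟨hxt.1.le, hxt.2.1.le⟩, ⟨hxt.2.2.le, ht⟩⟩).trans (le_max_left _ _)

/-- Finitely many statements, each true for all large constants, share a constant. -/
theorem exists_uniform_bound {P : ℕ → ℝ → Prop} (hmono : ∀ k B B', B ≤ B' → P k B → P k B')
    (n : ℕ) (h : ∀ k ≤ n, ∃ B, 0 ≤ B ∧ P k B) : ∃ B, 0 ≤ B ∧ ∀ k ≤ n, P k B := by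
  induction n with
  | zero =>
    obtain ⟨B, hB, hP⟩ := h 0 le_rfl
    exact ⟨B, hB, fun k hk => by rwa [Nat.le_zero.1 hk]⟩
  | succ n ih =>
    obtain ⟨B, hB, hP⟩ := ih fun k hk => h k (by omega)
    obtain ⟨B', hB', hP'⟩ := h (n + 1) le_rfl
    refine ⟨B + B', by positivity, fun k hk => ?_⟩
    rcases Nat.lt_or_ge n k with hk' | hk'
    · rw [show k = n + 1 by omega]
      exact hmono _ _ _ (by linarith) hP'
    · exact hmono _ _ _ (by linarith) (hP k hk')

theorem ZeroExtended.exists_bumpChain {n : ℕ} {b : ℝ} {v : ℝ × ℝ → ℝ} (h : ZeroExtended n b v)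
    (T : ℝ) : ∃ B : ℝ, 0 ≤ B ∧ ∀ t ≤ T,
      BumpChain n b B (fun k x => (TemperedWave.dX^[k] v) (x, t)) := by
  have hk : ∀ k ≤ n, ZeroExtended (n - k) b (TemperedWave.dX^[k] v) := fun k hk =>
    ZeroExtended.iterate_dX (by rwa [Nat.sub_add_cancel hk])
  obtain ⟨B, hB, hb⟩ := exists_uniform_bound
    (P := fun k B => ∀ x, ∀ t ≤ T, |(TemperedWave.dX^[k] v) (x, t)| ≤ B)
    (fun k B B' hBB' h x t ht => (h x t ht).trans hBB') n fun k hkn => (hk k hkn).exists_bound T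
  refine ⟨B, hB, fun t ht => ⟨fun k hkn x => ?_, fun k hkn => ?_, fun k hkn x hx => ?_,
    fun k hkn x => hb k hkn x t ht⟩⟩
  · rw [Function.iterate_succ_apply']
    have := hk k hkn.le
    rw [show n - k = (n - k - 1) + 1 by omega] at this
    exact this.hasDerivAt_dX x t
  · exact (hk k hkn).smooth.continuous.comp (by fun_prop)
  · exact (hk k hkn).zero x t (by tauto)

theorem ZeroExtended.derivChain_dT {n : ℕ} {b : ℝ} {v : ℝ × ℝ → ℝ} (h : ZeroExtended n b v)
    (x : ℝ) : DerivChain n (fun k t => (TemperedWave.dT^[k] v) (x, t)) := by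
  intro k hk t
  have h1 : ZeroExtended (n - k - 1 + 1) b (TemperedWave.dT^[k] v) :=
    ZeroExtended.iterate_dT (h.mono (by omega))
  simp only [Function.iterate_succ_apply']
  exact h1.hasDerivAt_dT x t

theorem ZeroExtended.exp_mul {n : ℕ} {b : ℝ} {v : ℝ × ℝ → ℝ} (h : ZeroExtended n b v) (lam : ℝ) :
    ZeroExtended n b (fun p => Real.exp (lam * p.2) * v p) :=
  ⟨(Real.contDiff_exp.comp (contDiff_const.mul contDiff_snd)).mul h.smooth,
    fun x t hxt => by simp [h.zero x t hxt]⟩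

/-- Applying the discrete Riesz derivative in space to a smooth zero-extended function gives
smooth causal functions of time, with bounds uniform in the mesh. -/
theorem ZeroExtended.exists_causalChain {α b : ℝ} (hα : 1 < α) (hα' : α ≤ 2) (hb : 0 < b) (T : ℝ)
    {n : ℕ} {v : ℝ × ℝ → ℝ} (h : ZeroExtended (n + 2) b v) :
    ∃ B : ℝ, 0 ≤ B ∧ ∀ M i : ℕ, i ∈ Finset.Icc 1 (M - 1) → CausalChain n T B
      (fun k t => discreteRiesz α b M
        (fun j => (TemperedWave.dT^[k] v) (j * spaceStep b M, t)) i) := by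
  obtain ⟨C, hC, hbd⟩ := exists_abs_discreteRiesz_le hα hα' hb
  have hk : ∀ k ≤ n, ZeroExtended (n - k + 2) b (TemperedWave.dT^[k] v) := fun k hk =>
    ZeroExtended.iterate_dT (h.mono (by omega))
  obtain ⟨B, hB, hBk⟩ := exists_uniform_bound
    (P := fun k B => ∀ t ≤ T,
      BumpChain 2 b B (fun m x => (TemperedWave.dX^[m] (TemperedWave.dT^[k] v)) (x, t)))
    (fun k B B' hBB' h t ht => ⟨(h t ht).chain, (h t ht).cont, (h t ht).zero,
      fun m hm x => ((h t ht).bound m hm x).trans hBB'⟩) n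
    fun k hkn => ((hk k hkn).mono (by omega)).exists_bumpChain T
  refine ⟨C * B, by positivity, fun M i hi => ⟨fun k hkn t => ?_, fun k hkn => ?_,
    fun k hkn t ht => ?_, fun k hkn t ht => ?_⟩⟩
  · have hd := fun j : ℕ => h.derivChain_dT (j * spaceStep b M) k (by omega) t
    simp only [discreteRiesz]
    exact (HasDerivAt.fun_sum fun j _ => (hd j).const_mul (wMat α i j)).const_mul _
  · have hc := (hk k hkn).smooth.continuous
    simp only [discreteRiesz]
    fun_prop
  · simp only [discreteRiesz]
    rw [Finset.sum_eq_zero fun j _ => by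
      rw [(hk k hkn).zero _ t (Or.inr (Or.inr ht)), mul_zero], mul_zero]
  · exact hbd _ B (hBk k hkn t ht) M i hi

/-! ### The truncation error -/

theorem riesz_congr {α b : ℝ} {g g' : ℝ → ℝ} (h : ∀ y ∈ Icc 0 b, g y = g' y) {x : ℝ}
    (hx : x ∈ Ioo 0 b) : riesz α b g x = riesz α b g' x := by
  have hnhds : Ioo 0 b ∈ nhds x := Ioo_mem_nhds hx.1 hx.2
  have hl : ∀ y ∈ Ioo 0 b, leftIntegral α g y = leftIntegral α g' y := by
    intro y hy
    unfold leftIntegral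
    split_ifs
    · exact h y ⟨hy.1.le, hy.2.le⟩
    · simp only
      congr 1
      refine intervalIntegral.integral_congr fun ξ hξ => ?_
      rw [uIcc_of_le hy.1.le] at hξ
      rw [h ξ ⟨hξ.1, hξ.2.trans hy.2.le⟩]
  have hr : ∀ y ∈ Ioo 0 b, rightIntegral α b g y = rightIntegral α b g' y := by
    intro y hy
    unfold rightIntegral
    split_ifs
    · exact h y ⟨hy.1.le, hy.2.le⟩
    · simp only
      congr 1
      refine intervalIntegral.integral_congr fun ξ hξ => ?_
      rw [uIcc_of_le hy.2.le] at hξ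
      rw [h ξ ⟨hy.1.le.trans hξ.1, hξ.2⟩]
  unfold riesz leftRL rightRL
  rw [(Filter.EventuallyEq.deriv (Filter.eventually_of_mem hnhds hl)).deriv_eq,
    (Filter.EventuallyEq.deriv (Filter.eventually_of_mem hnhds hr)).deriv_eq]

theorem rayConv_temperedKernel_eq_temperedIntegral (β lam : ℝ) (g : ℝ → ℝ) (t : ℝ) :
    rayConv (temperedKernel β lam) g t = temperedIntegral β lam g t := by
  have h := intervalIntegral.integral_comp_sub_left (a := 0) (b := t)
    (fun s => temperedKernel β lam (t - s) * g s) t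
  simp only [sub_sub_cancel, sub_self, sub_zero] at h
  rw [rayConv, h, temperedIntegral, ← intervalIntegral.integral_const_mul]
  refine intervalIntegral.integral_congr fun s _ => ?_
  simp only [temperedKernel, rlKernel, temperedIntegrand]
  ring

theorem intervalIntegrable_temperedIntegrand {β : ℝ} (hβ : 0 < β) (lam : ℝ) {g : ℝ → ℝ}
    (hg : Continuous g) (t : ℝ) :
    IntervalIntegrable (temperedIntegrand β lam g t) MeasureTheory.volume 0 t := by
  have h := (((intervalIntegrable_temperedKernel hβ lam t).comp_sub_left t).symm.mul_continuousOn
    hg.continuousOn).const_mul (Real.Gamma β)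
  rw [sub_self, sub_zero] at h
  have hG := (Real.Gamma_pos_of_pos hβ).ne'
  refine h.congr fun s _ => ?_
  simp only [temperedKernel, rlKernel, temperedIntegrand]
  field_simp

theorem abs_temperedIntegral_sub_le {β lam T : ℝ} (hβ : 0 < β) {g g' : ℝ → ℝ} {t E : ℝ}
    (ht : 0 ≤ t) (htT : t ≤ T)
    (hg : IntervalIntegrable (temperedIntegrand β lam g t) MeasureTheory.volume 0 t)
    (hg' : IntervalIntegrable (temperedIntegrand β lam g' t) MeasureTheory.volume 0 t)
    (hE : ∀ s ∈ Icc 0 t, |g s - g' s| ≤ E) :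
    |temperedIntegral β lam g t - temperedIntegral β lam g' t| ≤
      E * ∫ y in (0 : ℝ)..T, |temperedKernel β lam y| := by
  have hE0 : 0 ≤ E := (abs_nonneg _).trans (hE 0 ⟨le_rfl, ht⟩)
  have hk := fun X => intervalIntegrable_temperedKernel hβ lam X
  have h1 : temperedIntegral β lam g t - temperedIntegral β lam g' t =
      ∫ s in (0 : ℝ)..t, temperedKernel β lam (t - s) * (g s - g' s) := by
    rw [temperedIntegral, temperedIntegral, ← mul_sub, ← intervalIntegral.integral_sub hg hg',
      ← intervalIntegral.integral_const_mul]
    refine intervalIntegral.integral_congr fun s _ => ?_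
    simp only [temperedKernel, rlKernel, temperedIntegrand]
    ring
  have hsub := intervalIntegral.integral_comp_sub_left (a := 0) (b := t)
    (fun y => |temperedKernel β lam y|) t
  rw [sub_self, sub_zero] at hsub
  have hi : IntervalIntegrable (fun s => E * |temperedKernel β lam (t - s)|)
      MeasureTheory.volume 0 t := by
    have := ((hk t).abs.comp_sub_left t).symm.const_mul E
    rwa [sub_self, sub_zero] at this
  rw [h1, ← Real.norm_eq_abs]
  refine (intervalIntegral.norm_integral_le_of_norm_le ht
    (g := fun s => E * |temperedKernel β lam (t - s)|) ?_ hi).trans ?_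
  · refine Filter.Eventually.of_forall fun s hs => ?_
    rw [norm_mul, Real.norm_eq_abs, Real.norm_eq_abs, mul_comm]
    exact mul_le_mul_of_nonneg_right (hE s ⟨hs.1.le, hs.2⟩) (abs_nonneg _)
  · rw [intervalIntegral.integral_const_mul, hsub]
    refine mul_le_mul_of_nonneg_left ?_ hE0
    exact intervalIntegral.integral_mono_interval le_rfl ht htT
      (Filter.Eventually.of_forall fun y => abs_nonneg _) (hk T).abs

theorem discreteRiesz_add (α b : ℝ) (M : ℕ) (V W : ℕ → ℝ) (i : ℕ) :
    discreteRiesz α b M (fun j => V j + W j) i =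
      discreteRiesz α b M V i + discreteRiesz α b M W i := by
  simp only [discreteRiesz, mul_add, Finset.sum_add_distrib]

theorem discreteRiesz_const_mul (α b c : ℝ) (M : ℕ) (V : ℕ → ℝ) (i : ℕ) :
    discreteRiesz α b M (fun j => c * V j) i = c * discreteRiesz α b M V i := by
  simp only [discreteRiesz, Finset.mul_sum]
  exact Finset.sum_congr rfl fun j _ => by ring

theorem discreteRiesz_congr {α b : ℝ} {M : ℕ} {V W : ℕ → ℝ}
    (h : ∀ j ∈ Finset.Icc 1 (M - 1), V j = W j) (i : ℕ) :
    discreteRiesz α b M V i = discreteRiesz α b M W i := by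
  simp only [discreteRiesz]
  rw [Finset.sum_congr rfl fun j hj => by rw [h j hj]]

theorem CausalChain.of_le {m n : ℕ} {T B B' : ℝ} {G : ℕ → ℝ → ℝ} (h : CausalChain n T B G)
    (hmn : m ≤ n) (hB : B ≤ B') : CausalChain m T B' G :=
  ⟨h.chain.mono hmn, fun k hk => h.cont k (hk.trans hmn), fun k hk => h.zero k (hk.trans hmn),
    fun k hk x hx => (h.bound k (hk.trans hmn) x hx).trans hB⟩

theorem abs_midpoint_sub_le {φ : ℕ → ℝ → ℝ} (hφ : DerivChain 3 φ) {t τ B T : ℝ} (hτ : 0 ≤ τ)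
    (htT : t + τ / 2 ≤ T) (hB : ∀ y ≤ T, |φ 3 y| ≤ B) :
    |φ 0 (t + τ / 2) - φ 0 (t - τ / 2) - τ * φ 1 t| ≤ B * τ ^ 3 := by
  have h1 := abs_sub_taylor_le hφ (x := t) (h := τ / 2) (B := B) (by positivity)
    fun y hy => hB y (hy.2.trans htT)
  have h2 := abs_sub_taylor_neg_le hφ (x := t) (h := τ / 2) (B := B) (by positivity)
    fun y hy => hB y (by linarith [hy.2])
  simp only [Finset.sum_range_succ, Finset.sum_range_zero, Nat.factorial] at h1 h2
  norm_num at h1 h2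
  have hB0 : 0 ≤ B := (abs_nonneg _).trans (hB T le_rfl)
  have h3 : 0 ≤ B * τ ^ 3 := by positivity
  rw [abs_le] at *
  constructor <;> nlinarith [h1.1, h1.2, h2.1, h2.2]

theorem IsExactSolution.dT_eq {α γ lam b T : ℝ} {f u : ℝ → ℝ → ℝ}
    (hu : IsExactSolution α γ lam b T f u) {n : ℕ} {v : ℝ × ℝ → ℝ} (hv : ZeroExtended (n + 1) b v)
    (huv : ∀ x ∈ Icc 0 b, ∀ t ∈ Icc 0 T, v (x, t) = u x t) {x t : ℝ} (hx : x ∈ Ioo 0 b)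
    (ht : t ∈ Ioo 0 T) :
    dT v (x, t) = temperedIntegral (γ - 1) lam (fun s => riesz α b (fun y => u y s) x) t + f x t := by
  have h1 := (hu.equation x hx t ⟨ht.1, ht.2.le⟩).hasDerivAt (Icc_mem_nhds ht.1 ht.2)
  have h2 : (fun s => v (x, s)) =ᶠ[nhds t] fun s => u x s :=
    Filter.eventually_of_mem (Icc_mem_nhds ht.1 ht.2) fun s hs => huv x ⟨hx.1.le, hx.2.le⟩ s hs
  exact (hv.hasDerivAt_dT x t).unique (h1.congr_of_eventuallyEq h2)

/-- Consistency: the truncation error of a smooth solution is of order `τ (τ² + h²)`. It splits into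
the midpoint error of the time step, the error of the convolution quadrature applied to
`t ↦ ∇_h^α u`, and the tempered integral of the space error `∇_h^α u - ∇^α u`. -/
theorem exists_truncationBound {α γ lam b T : ℝ} (hα : 1 < α) (hα' : α ≤ 2) (hγ : 1 < γ)
    (hγ' : γ ≤ 2) (hlam : 0 ≤ lam) (hb : 0 < b) (hT : 0 < T) {f u : ℝ → ℝ → ℝ}
    (hu : IsExactSolution α γ lam b T f u) (hs : HasSmoothZeroExtension b T u) :
    ∃ C : ℝ, 0 < C ∧ ∀ M N : ℕ, 1 ≤ M → 1 ≤ N → TruncationBound α γ lam b T M N f u C := by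
  obtain ⟨v, hv6, huv, hv0⟩ := hs
  have hv : ZeroExtended 6 b v := ⟨by exact_mod_cast hv6, hv0⟩
  have hβ : 0 < γ - 1 := by linarith
  obtain ⟨Cq, hCq, hquad⟩ := exists_abs_tempered_sub_le (β := γ - 1) (lam := lam) hβ (by linarith)
    hlam hT.le
  obtain ⟨Cs, hCs, hspace⟩ := exists_abs_discreteRiesz_sub_riesz_le hα hα' hb
  obtain ⟨B₁, hB₁, hG⟩ := ZeroExtended.exists_causalChain hα hα' hb T (n := 4) hv
  obtain ⟨B₂, hB₂, hG'⟩ := ZeroExtended.exists_causalChain hα hα' hb T (n := 4) (hv.exp_mul lam)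
  obtain ⟨Bs, hBs, hbump⟩ := hv.exists_bumpChain T
  obtain ⟨Bt, hBt, hdt⟩ :=
    (ZeroExtended.iterate_dT (n := 3) (k := 3) hv).exists_bound T
  set K : ℝ := ∫ y in (0 : ℝ)..T, |temperedKernel (γ - 1) lam y| with hKdef
  have hK : 0 ≤ K := intervalIntegral.integral_nonneg hT.le fun y _ => abs_nonneg _
  refine ⟨Bt + Cq * (B₁ + B₂) + Cs * Bs * K + 1, by positivity, ?_⟩
  intro M N hM hN i hi n hn
  have hi' := Finset.mem_Icc.1 hi
  set h := spaceStep b M with hh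
  set τ := timeStep T N with hτdef
  have hM0 : (0 : ℝ) < M := by exact_mod_cast hM
  have hN0 : (0 : ℝ) < N := by exact_mod_cast hN
  have hτ : 0 < τ := div_pos hT hN0
  have hh0 : 0 < h := div_pos hb hM0
  have hNτ : N * τ = T := by rw [hτdef, timeStep]; field_simp
  have hMh : M * h = b := by rw [hh, spaceStep]; field_simp
  have hnN : ((n : ℝ) + 1) ≤ N := by exact_mod_cast hn
  have hnT : ((n : ℝ) + 1) * τ ≤ T := by rw [← hNτ]; gcongr
  have hn0 : (0 : ℝ) ≤ n * τ := by positivity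
  set x : ℝ := i * h with hx
  set t : ℝ := ((n : ℝ) + 1 / 2) * τ with ht
  have hxI : x ∈ Ioo 0 b := by
    have h1 : (1 : ℝ) ≤ i := by exact_mod_cast hi'.1
    have h2 : (i : ℝ) < M := by exact_mod_cast (by omega : i < M)
    refine ⟨by positivity, ?_⟩
    rw [← hMh]
    exact mul_lt_mul_of_pos_right h2 hh0
  have htI : t ∈ Ioo 0 T := ⟨by positivity, by linarith⟩
  have hgridT : ∀ m : ℕ, m ≤ N → (m : ℝ) * τ ∈ Icc 0 T := fun m hm =>
    ⟨by positivity, by rw [← hNτ]; gcongr⟩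
  have hgrid : ∀ j m : ℕ, j ≤ M → m ≤ N → gridValues b T M N u j m = v (j * h, m * τ) :=
    fun j m hj hm => (huv _ (gridNode_mem_Icc hb.le hj) _ (hgridT m hm)).symm
  set G : ℕ → ℝ → ℝ := fun k s => discreteRiesz α b M (fun j => (dT^[k] v) (j * h, s)) i with hGdef
  have hGi := hG M i hi
  -- the error of the quadrature in time
  have e1 := hquad _ _ (B₁ + B₂) ((hGi).of_le (by omega) (by linarith))
    ((hG' M i hi).of_le le_rfl (by linarith))
    (fun s => discreteRiesz_const_mul α b (Real.exp (lam * s)) M (fun j => v (j * h, s)) i) τ n hτ hnT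
  have hmem : memoryTerm α γ lam b T M N (gridValues b T M N u) i n =
      τ * (τ ^ (γ - 1) / 2 * ∑ k ∈ Finset.range (n + 1), lWeight (γ - 1) lam τ k *
        (G 0 ((n + 1 - k : ℕ) * τ) + G 0 ((n - k : ℕ) * τ))) := by
    rw [memoryTerm, ← hτdef, ← mul_assoc]
    congr 1
    · rw [Real.rpow_sub_one hτ.ne']
      field_simp
    · refine Finset.sum_congr rfl fun k hk => ?_
      rw [hGdef, ← discreteRiesz_add]
      congr 1
      refine discreteRiesz_congr (fun j hj => ?_) i
      have hj' := Finset.mem_Icc.1 hj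
      rw [hgrid j _ (by omega) (by omega), hgrid j _ (by omega) (by omega)]
      rfl
  -- the error of the discretization in space
  have e2 : |temperedIntegral (γ - 1) lam (G 0) t -
      temperedIntegral (γ - 1) lam (fun s => riesz α b (fun y => u y s) x) t| ≤
        Cs * Bs * h ^ 2 * K := by
    refine abs_temperedIntegral_sub_le hβ htI.1.le htI.2.le
      (intervalIntegrable_temperedIntegrand hβ lam (hGi.cont 0 (by omega)) t)
      (hu.integrable x hxI t ⟨htI.1, htI.2.le⟩) fun s hs => ?_
    have hsT : s ≤ T := hs.2.trans htI.2.le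
    rw [riesz_congr (g' := fun y => v (y, s)) (fun y hy => (huv y hy s ⟨hs.1, hsT⟩).symm) hxI]
    exact hspace _ Bs (hbump s hsT) M i hi
  rw [rayConv_temperedKernel_eq_temperedIntegral] at e1
  -- the midpoint rule for the time step
  have e3 := abs_midpoint_sub_le ((hv.mono (by omega : 3 ≤ 6)).derivChain_dT x) (t := t) (τ := τ)
    (B := Bt) (T := T) hτ.le (by rw [ht]; linarith) (fun y hy => hdt x y hy)
  have e4 := hu.dT_eq (n := 5) hv huv hxI htI
  have ep : t + τ / 2 = (n + 1 : ℕ) * τ := by rw [ht]; push_cast; ring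
  have em : t - τ / 2 = n * τ := by rw [ht]; ring
  rw [ep, em] at e3
  simp only [Function.iterate_zero, Function.iterate_succ, Function.comp, id] at e3
  rw [residual, hmem, hgrid i (n + 1) (by omega) (by omega), hgrid i n (by omega) (by omega),
    halfForce, ← hτdef, ← hh, ← hx, ← ht]
  change |_ - _ * _| ≤ _ at e3
  set Q : ℝ := τ ^ (γ - 1) / 2 * ∑ k ∈ Finset.range (n + 1), lWeight (γ - 1) lam τ k *
    (G 0 ((n + 1 - k : ℕ) * τ) + G 0 ((n - k : ℕ) * τ))
  set I := temperedIntegral (γ - 1) lam (G 0) t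
  set J := temperedIntegral (γ - 1) lam (fun s => riesz α b (fun y => u y s) x) t
  change |Q - I| ≤ _ at e1
  have e : v (x, (n + 1 : ℕ) * τ) - v (x, n * τ) - τ * Q - τ * f x t =
      (v (x, (n + 1 : ℕ) * τ) - v (x, n * τ) - τ * dT v (x, t)) - τ * (Q - I) - τ * (I - J) := by
    rw [e4]; ring
  rw [e]
  refine (abs_sub _ _).trans ((add_le_add_left (abs_sub _ _) _).trans ?_)
  rw [abs_mul, abs_mul, abs_of_pos hτ]
  calc _ ≤ Bt * τ ^ 3 + τ * (Cq * (B₁ + B₂) * τ ^ 2) + τ * (Cs * Bs * h ^ 2 * K) := by gcongr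
    _ ≤ Bt * τ ^ 3 + τ * (Cq * (B₁ + B₂) * τ ^ 2) + τ * (Cs * Bs * h ^ 2 * K) +
        (Bt * τ * h ^ 2 + Cq * (B₁ + B₂) * τ * h ^ 2 + Cs * Bs * K * τ * τ ^ 2 +
          τ * (τ ^ 2 + h ^ 2)) := le_add_of_nonneg_right (by positivity)
    _ = _ := by ring

end TemperedWave

theorem mainTheorem2 (α γ lam b T : ℝ) (hα : 1 < α) (hα' : α ≤ 2) (hγ : 1 < γ) (hγ' : γ ≤ 2)
    (hlam : 0 ≤ lam) (hb : 0 < b) (hT : 0 < T) (f u : ℝ → ℝ → ℝ)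
    (hu : TemperedWave.IsExactSolution α γ lam b T f u) :
    (∀ C : ℝ, 0 < C → ∀ M N : ℕ, 1 ≤ M → 1 ≤ N →
      TemperedWave.TruncationBound α γ lam b T M N f u C →
      ∀ U : ℕ → ℕ → ℝ, TemperedWave.IsSchemeSolution α γ lam b T M N f U →
      ∀ n ≤ N,
        TemperedWave.discreteNorm b M
            (fun i => TemperedWave.gridValues b T M N u i n - U i n) ≤
          2 * C * b ^ (1 / 2 : ℝ) * T *
            (TemperedWave.timeStep T N ^ 2 + TemperedWave.spaceStep b M ^ 2)) ∧
    (TemperedWave.HasSmoothZeroExtension b T u →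
      ∃ C : ℝ, 0 < C ∧ ∀ M N : ℕ, 1 ≤ M → 1 ≤ N →
        TemperedWave.TruncationBound α γ lam b T M N f u C ∧
        ∀ U : ℕ → ℕ → ℝ, TemperedWave.IsSchemeSolution α γ lam b T M N f U →
        ∀ n ≤ N,
          TemperedWave.discreteNorm b M
              (fun i => TemperedWave.gridValues b T M N u i n - U i n) ≤
            2 * C * b ^ (1 / 2 : ℝ) * T *
              (TemperedWave.timeStep T N ^ 2 + TemperedWave.spaceStep b M ^ 2)) := by
  refine ⟨fun C hC M N hM hN hR U hU n hn =>
    TemperedWave.stability hα hα' hγ hγ' hlam hb hT hu hC hM hN hR hU hn, fun hs => ?_⟩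
  obtain ⟨C, hC, hR⟩ :=
    TemperedWave.exists_truncationBound hα hα' hγ hγ' hlam hb hT hu hs
  exact ⟨C, hC, fun M N hM hN => ⟨hR M N hM hN, fun U hU n hn =>
    TemperedWave.stability hα hα' hγ hγ' hlam hb hT hu hC hM hN (hR M N hM hN) hU hn⟩⟩
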